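/- Let $N\in\mathbb N$, $\mathcal H=L^2(\mathbb R^N)$ (inner product conjugate linear in the first argument), and let $\mathcal S(\mathbb R^N)\subset\mathcal H$ be the Schwartz functions. On $\mathcal S(\mathbb R^N)$ let $Q_i$ be multiplication by the $i$-th coordinate and $P_i=-i\,\partial/\partial q_i$; for multi-indices write $Q^\alpha=\prod_i Q_i^{\alpha_i}$, $P^\beta=\prod_i P_i^{\beta_i}$. Let $H_{\rm tot}=\frac12\sum_{i=1}^N(Q_i^2+P_i^2)$ be the selfadjoint harmonic oscillator Hamiltonian (each power $H_{\rm tot}^m$ is the closure of its restriction to $\mathcal S(\mathbb R^N)$). *Schwartz operators.* $\mathfrak S(\mathcal H)$ is the space of bounded operators $T$ on $\mathcal H$ for which, for all $\alpha,\beta,\alpha',\beta'\in\mathbb N_0^N$, $$\|T\|_{\alpha,\alpha',\beta,\beta'}:=\sup\bigl\{|\langle P^\beta Q^\alpha\psi\,|\,T P^{\beta'}Q^{\alpha'}\varphi\rangle| : \psi,\varphi\in\mathcal S(\mathbb R^N),\ \|\psi\|\le1,\ \|\varphi\|\le1\bigr\}<\infty ,$$ with the locally convex topology given by these seminorms. $\mathfrak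 S'(\mathcal H)$ denotes the space of continuous linear functionals $\Phi:\mathfrak S(\mathcal H)\to\mathbb C$. *Polynomially bounded operators.* A densely defined operator $A$ on $\mathcal H$ is polynomially bounded if both $A$ and its adjoint $A^*$ are relatively bounded with respect to some power $H_{\rm tot}^m$, $m\in\mathbb N_0$ (where $A$ is relatively bounded with respect to $K$ if $\mathrm{dom}\,K\subset\mathrm{dom}\,A$ and $\|A\varphi\|\le a\|K\varphi\|+b\|\varphi\|$ on $\mathrm{dom}\,K$ for some $a,b>0$). Such an $A$ defines $\Phi_A\in\mathfrak S'(\mathcal H)$ by $\Phi_A(T)=\mathrm{tr}[AT]$, where $AT$ is everywhere defined and trace class for every $T\in\mathfrak S(\mathcal H)$. *Derivatives.* For $y=(q,p)\in\mathbb R^{2N}$ let $(W(q,p)\psi)(t)=e^{-iq\cdot p/2}e^{ip\cdot t}\psi(t-q)$, so that $W(y)^*=W(-y)$. For $\alpha\in\mathbb N_0^{2N}$ and $T\in\mathfrak S(\mathcal H)$ all the functions $y\mapsto\langle\varphi|W(y)TW(-y)\psi\rangle$, $\varphi,\psi\in\mathcal H$, are smooth, and there is a unique $D^\alpha T\in\mathfrak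 S(\mathcal H)$ with $$\langle\varphi|D^\alpha T\,\psi\rangle=(-1)^{|\alpha|}\,D_y^\alpha\langle\varphi|W(y)TW(-y)\psi\rangle\big|_{y=0}\qquad(\varphi,\psi\in\mathcal H).$$ For $\Phi\in\mathfrak S'(\mathcal H)$, the derivative $D^\alpha\Phi\in\mathfrak S'(\mathcal H)$ is defined by $(D^\alpha\Phi)(T)=(-1)^{|\alpha|}\Phi(D^\alpha T)$. **Theorem (quantum regularity theorem).** For every $\Phi\in\mathfrak S'(\mathcal H)$ there are $m\in\mathbb N_0$ and densely defined polynomially bounded operators $A_\alpha$ ($\alpha\in\mathbb N_0^{2N}$, $|\alpha|\le m$) such that $$\Phi=\sum_{|\alpha|\le m}D^\alpha\Phi_{A_\alpha}.$$ -/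

import Mathlib

open MeasureTheory SchwartzMap

noncomputable section

namespace QDist

/-! ### Hilbert space, position and momentum -/

/-- Configuration space `ℝᴺ`. -/
abbrev Conf (N : ℕ) : Type := EuclideanSpace ℝ (Fin N)

/-- Phase space: pairs `x = (q, p)`. -/
abbrev Phase (N : ℕ) : Type := Conf N × Conf N

/-- The Hilbert space `L²(ℝᴺ, dq)`; the inner product is conjugate linear in the first slot. -/
abbrev Hil (N : ℕ) : Type := Lp ℂ 2 (volume : Measure (Conf N))

/-- The Schwartz functions on configuration space. -/
abbrev Sch (N : ℕ) : Type := 𝓢(Conf N, ℂ)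

/-- The inclusion of the Schwartz functions into the Hilbert space. -/
def emb (N : ℕ) : Sch N →L[ℂ] Hil N := toLpCLM ℂ ℂ 2 volume

/-- The position operator `(Q_i ψ)(t) = t_i ψ(t)` on Schwartz functions. -/
def opQ {N : ℕ} (i : Fin N) : Sch N →L[ℂ] Sch N :=
  smulLeftCLM ℂ (fun t : Conf N => ((t i : ℝ) : ℂ))

/-- The momentum operator `P_i ψ = -i ∂ψ/∂q_i` on Schwartz functions. -/
def opP {N : ℕ} (i : Fin N) : Sch N →L[ℂ] Sch N :=
  (-Complex.I) • LineDeriv.lineDerivOpCLM ℂ (Sch N) (EuclideanSpace.single i (1 : ℝ))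

theorem opQ_apply {N : ℕ} (i : Fin N) (ψ : Sch N) (t : Conf N) :
    opQ i ψ t = ((t i : ℝ) : ℂ) * ψ t := by
  have h : (fun t : Conf N => ((t i : ℝ) : ℂ)).HasTemperateGrowth :=
    (Complex.ofRealCLM ∘L EuclideanSpace.proj (𝕜 := ℝ) i).hasTemperateGrowth
  rw [opQ, smulLeftCLM_apply_apply h, smul_eq_mul]

theorem opP_apply {N : ℕ} (i : Fin N) (ψ : Sch N) (t : Conf N) :
    opP i ψ t = -Complex.I * lineDeriv ℝ ψ t (EuclideanSpace.single i 1) := by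
  rw [← lineDerivOp_apply]
  rfl

/-- `Q^α = Q_1^{α_1} ⋯ Q_N^{α_N}`. -/
def powQ {N : ℕ} (α : Fin N → ℕ) : Sch N →L[ℂ] Sch N := (List.ofFn fun i => opQ i ^ α i).prod

/-- `P^β = P_1^{β_1} ⋯ P_N^{β_N}`. -/
def powP {N : ℕ} (β : Fin N → ℕ) : Sch N →L[ℂ] Sch N := (List.ofFn fun i => opP i ^ β i).prod

/-! ### Schwartz operators and their topology -/

/-- Quadruples `(α, β, α', β')` of multi-indices. -/
abbrev Idx4 (N : ℕ) : Type := (Fin N → ℕ) × (Fin N → ℕ) × (Fin N → ℕ) × (Fin N → ℕ)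

/-- The sesquilinear form `(ψ, φ) ↦ ⟨P^β Q^α ψ | T P^β' Q^α' φ⟩` on Schwartz functions. -/
def sform {N : ℕ} (k : Idx4 N) (T : Hil N →L[ℂ] Hil N) (ψ φ : Sch N) : ℂ :=
  inner ℂ (emb N (powP k.2.1 (powQ k.1 ψ))) (T (emb N (powP k.2.2.2 (powQ k.2.2.1 φ))))

/-- The set `{ |⟨P^β Q^α ψ | T P^β' Q^α' φ⟩| : ψ, φ Schwartz, ‖ψ‖ ≤ 1, ‖φ‖ ≤ 1 }`,
with Hilbert space norms. -/
def formValues {N : ℕ} (k : Idx4 N) (T : Hil N →L[ℂ] Hil N) : Set ℝ :=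
  {r | ∃ ψ φ : Sch N, ‖emb N ψ‖ ≤ 1 ∧ ‖emb N φ‖ ≤ 1 ∧ ‖sform k T ψ φ‖ = r}

theorem formValues_nonempty {N : ℕ} (k : Idx4 N) (T : Hil N →L[ℂ] Hil N) :
    (formValues k T).Nonempty :=
  ⟨_, 0, 0, by simp, by simp, rfl⟩

theorem sform_add {N : ℕ} (k : Idx4 N) (S T : Hil N →L[ℂ] Hil N) (ψ φ : Sch N) :
    sform k (S + T) ψ φ = sform k S ψ φ + sform k T ψ φ := by
  simp [sform, inner_add_right]

theorem sform_smul {N : ℕ} (k : Idx4 N) (c : ℂ) (T : Hil N →L[ℂ] Hil N) (ψ φ : Sch N) :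
    sform k (c • T) ψ φ = c * sform k T ψ φ := by
  simp [sform, inner_smul_right]

/-- The Schwartz operators, as a subspace of the bounded operators: all suprema are finite. -/
def schwartzOps (N : ℕ) : Submodule ℂ (Hil N →L[ℂ] Hil N) where
  carrier := {T | ∀ k : Idx4 N, BddAbove (formValues k T)}
  zero_mem' k := ⟨0, by rintro r ⟨ψ, φ, -, -, rfl⟩; simp [sform]⟩
  add_mem' {S T} hS hT k := by
    obtain ⟨a, ha⟩ := hS k
    obtain ⟨b, hb⟩ := hT k
    refine ⟨a + b, ?_⟩
    rintro r ⟨ψ, φ, hψ, hφ, rfl⟩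
    rw [sform_add]
    exact (norm_add_le _ _).trans (add_le_add (ha ⟨ψ, φ, hψ, hφ, rfl⟩) (hb ⟨ψ, φ, hψ, hφ, rfl⟩))
  smul_mem' c T hT k := by
    obtain ⟨a, ha⟩ := hT k
    refine ⟨‖c‖ * a, ?_⟩
    rintro r ⟨ψ, φ, hψ, hφ, rfl⟩
    rw [sform_smul, norm_mul]
    exact mul_le_mul_of_nonneg_left (ha ⟨ψ, φ, hψ, hφ, rfl⟩) (norm_nonneg c)

/-- The space `𝔖(ℋ)` of Schwartz operators. It is a type of its own, so that it carries the
topology of the seminorms below and not the operator norm topology. -/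
def SchwartzOp (N : ℕ) : Type := schwartzOps N

instance (N : ℕ) : AddCommGroup (SchwartzOp N) := inferInstanceAs (AddCommGroup (schwartzOps N))

instance (N : ℕ) : Module ℂ (SchwartzOp N) := inferInstanceAs (Module ℂ (schwartzOps N))

/-- The bounded operator underlying a Schwartz operator. -/
def SchwartzOp.op {N : ℕ} : SchwartzOp N →ₗ[ℂ] (Hil N →L[ℂ] Hil N) := (schwartzOps N).subtype

theorem SchwartzOp.bddAbove {N : ℕ} (T : SchwartzOp N) (k : Idx4 N) :
    BddAbove (formValues k T.op) :=
  T.2 k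

/-- The seminorm `‖T‖_{α,α',β,β'}`, the supremum of `formValues`. -/
def opSeminorm {N : ℕ} (k : Idx4 N) : Seminorm ℂ (SchwartzOp N) :=
  Seminorm.ofSMulLE (fun T => sSup (formValues k T.op))
    (by
      refine le_antisymm (csSup_le (formValues_nonempty k _) ?_) (Real.sSup_nonneg ?_)
      · rintro r ⟨ψ, φ, -, -, rfl⟩
        simp [sform]
      · rintro r ⟨ψ, φ, -, -, rfl⟩
        exact norm_nonneg _)
    (by
      intro S T
      refine csSup_le (formValues_nonempty k _) ?_
      rintro r ⟨ψ, φ, hψ, hφ, rfl⟩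
      rw [map_add, sform_add]
      exact (norm_add_le _ _).trans (add_le_add (le_csSup (S.bddAbove k) ⟨ψ, φ, hψ, hφ, rfl⟩)
        (le_csSup (T.bddAbove k) ⟨ψ, φ, hψ, hφ, rfl⟩)))
    (by
      intro c T
      refine csSup_le (formValues_nonempty k _) ?_
      rintro r ⟨ψ, φ, hψ, hφ, rfl⟩
      rw [map_smul, sform_smul, norm_mul]
      exact mul_le_mul_of_nonneg_left (le_csSup (T.bddAbove k) ⟨ψ, φ, hψ, hφ, rfl⟩)
        (norm_nonneg c))

/-- The family of all the seminorms `‖·‖_{α,α',β,β'}`. -/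
def opSeminormFamily (N : ℕ) : SeminormFamily ℂ (SchwartzOp N) (Idx4 N) := fun k => opSeminorm k

/-- The locally convex topology of `𝔖(ℋ)`, defined by the seminorms. -/
instance (N : ℕ) : TopologicalSpace (SchwartzOp N) :=
  (opSeminormFamily N).moduleFilterBasis.topology

/-- The space `𝔖'(ℋ)` of tempered distributions: the continuous linear functionals on `𝔖(ℋ)`. -/
abbrev Distr (N : ℕ) : Type := SchwartzOp N →L[ℂ] ℂ

/-! ### Polynomially bounded operators -/

/-- A linear map of the Schwartz functions, as an unbounded operator with domain the Schwartz
functions. -/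
def onSchwartz {N : ℕ} (L : Sch N →L[ℂ] Sch N) : Hil N →ₗ.[ℂ] Hil N where
  domain := LinearMap.range (emb N).toLinearMap
  toFun := (emb N).toLinearMap ∘ₗ L.toLinearMap ∘ₗ
    (LinearEquiv.ofInjective (emb N).toLinearMap (injective_toLp 2 volume)).symm.toLinearMap

/-- `H_tot = ½ ∑ᵢ (Q_i² + P_i²)` on Schwartz functions. -/
def hamS (N : ℕ) : Sch N →L[ℂ] Sch N := (1 / 2 : ℂ) • ∑ i : Fin N, (opQ i ^ 2 + opP i ^ 2)

/-- `L` is symmetric on the Schwartz functions. -/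
def IsSym {N : ℕ} (L : Sch N →L[ℂ] Sch N) : Prop :=
  ∀ ψ φ : Sch N, inner ℂ (emb N ψ) (emb N (L φ)) = inner ℂ (emb N (L ψ)) (emb N φ)

theorem isSym_opQ {N : ℕ} (i : Fin N) : IsSym (opQ i) := by
  intro ψ φ
  simp only [emb, toLpCLM_apply, inner_toL2_toL2_eq, opQ_apply]
  refine integral_congr_ae (.of_forall fun t => ?_)
  simp
  ring

theorem isSym_opP {N : ℕ} (i : Fin N) : IsSym (opP i) := by
  intro ψ φ
  have h := integral_bilinear_lineDerivOp_right_eq_neg_left (μ := volume) ψ φ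
    ((ContinuousLinearMap.mul ℝ ℂ).comp (Complex.conjCLE : ℂ →L[ℝ] ℂ))
    (EuclideanSpace.single i 1)
  simp only [ContinuousLinearMap.comp_apply, ContinuousLinearMap.mul_apply'] at h
  simp only [emb, toLpCLM_apply, inner_toL2_toL2_eq, opP_apply, ← lineDerivOp_apply]
  calc _ = -Complex.I * ∫ t, (Complex.conjCLE : ℂ →L[ℝ] ℂ) (ψ t) *
        (LineDeriv.lineDerivOp (EuclideanSpace.single i (1 : ℝ)) φ : Sch N) t := by
        rw [← integral_const_mul]
        refine integral_congr_ae (.of_forall fun t => ?_)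
        simp
        ring
    _ = _ := by
        rw [h, ← integral_neg, ← integral_const_mul]
        refine integral_congr_ae (.of_forall fun t => ?_)
        simp
        ring

theorem IsSym.pow {N : ℕ} {L : Sch N →L[ℂ] Sch N} (h : IsSym L) (m : ℕ) : IsSym (L ^ m) := by
  induction m with
  | zero => intro ψ φ; simp
  | succ m ih =>
    intro ψ φ
    rw [pow_succ, mul_apply_eq_comp, ih, h, ← mul_apply_eq_comp,
      ← pow_succ', ← pow_succ]

theorem isSym_hamS (N : ℕ) : IsSym (hamS N) := by
  intro ψ φ
  have h (i : Fin N) := congrArg₂ (· + ·) ((isSym_opQ i).pow 2 ψ φ) ((isSym_opP i).pow 2 ψ φ)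
  simp only [hamS, smul_apply, sum_apply, map_smul,
    map_sum, map_add, add_apply, inner_smul_left, inner_smul_right,
    inner_sum, sum_inner, inner_add_left, inner_add_right] at h ⊢
  rw [Finset.sum_congr rfl fun i _ => h i]
  simp only [one_div, map_inv₀, map_ofNat]

theorem IsSym.isClosable {N : ℕ} {L : Sch N →L[ℂ] Sch N} (h : IsSym L) :
    (onSchwartz L).IsClosable := by
  have hd : Dense ((onSchwartz L).domain : Set (Hil N)) := by
    have : DenseRange (emb N) := denseRange_toLpCLM (by norm_num)
    exact this
  have hf : (onSchwartz L).IsFormalAdjoint (onSchwartz L) := by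
    rintro ⟨_, ψ, rfl⟩ ⟨_, φ, rfl⟩
    have e (χ : Sch N) : onSchwartz L ⟨(emb N).toLinearMap χ, χ, rfl⟩ = emb N (L χ) := by
      have : (LinearEquiv.ofInjective (emb N).toLinearMap (injective_toLp 2 volume)).symm
          ⟨(emb N).toLinearMap χ, χ, rfl⟩ = χ := by
        rw [LinearEquiv.symm_apply_eq]; rfl
      change emb N (L (_ : Sch N)) = _
      exact congrArg (fun z => emb N (L z)) this
    rw [e, e]
    exact (h ψ φ).symm
  exact (LinearPMap.adjoint_isClosed hd).isClosable.leIsClosable (hf.le_adjoint hd)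

/-- The powers of `H_tot` on Schwartz functions are closable, so `hamPow` below is a closure. -/
theorem isClosable_hamS_pow (N m : ℕ) : (onSchwartz (hamS N ^ m)).IsClosable :=
  ((isSym_hamS N).pow m).isClosable

/-- The selfadjoint operator `H_tot^m`. The Schwartz functions (which contain the eigenbasis of
Hermite functions) are a core for each power of `H_tot`, so `H_tot^m` is the closure of its
restriction to them. -/
def hamPow (N m : ℕ) : Hil N →ₗ.[ℂ] Hil N := (onSchwartz (hamS N ^ m)).closure

/-- `A` is relatively bounded with respect to `K`: `dom K ⊆ dom A`, and
`‖A φ‖ ≤ a ‖K φ‖ + b ‖φ‖` on `dom K`, with positive constants `a`, `b`. -/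
def RelBounded {N : ℕ} (A K : Hil N →ₗ.[ℂ] Hil N) : Prop :=
  ∃ h : K.domain ≤ A.domain, ∃ a b : ℝ, 0 < a ∧ 0 < b ∧
    ∀ φ : K.domain, ‖A (Submodule.inclusion h φ)‖ ≤ a * ‖K φ‖ + b * ‖(φ : Hil N)‖

/-- Densely defined polynomially bounded operators: both `A` (bounded from the right) and the
adjoint of `A` (bounded from the left) are relatively bounded with respect to a power of
`H_tot`. -/
structure IsPolyBounded {N : ℕ} (A : Hil N →ₗ.[ℂ] Hil N) : Prop where
  dense : Dense (A.domain : Set (Hil N))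
  right : ∃ m : ℕ, RelBounded A (hamPow N m)
  left : ∃ m : ℕ, RelBounded A.adjoint (hamPow N m)

/-- `B` is a trace class operator with trace `t`: for every orthonormal basis `(b_i)` the family
`⟨b_i | B b_i⟩` is (absolutely) summable with sum `t`. -/
def HasTrace {N : ℕ} (B : Hil N →L[ℂ] Hil N) (t : ℂ) : Prop :=
  ∀ (ι : Type) (b : HilbertBasis ι ℂ (Hil N)), HasSum (fun i => inner ℂ (b i) (B (b i))) t

/-- `Φ = Φ_A`: for every Schwartz operator `T`, the product `A T` is everywhere defined and trace
class, and `Φ(T) = tr[A T]`. -/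
def IsOpDistr {N : ℕ} (A : Hil N →ₗ.[ℂ] Hil N) (Φ : Distr N) : Prop :=
  ∀ T : SchwartzOp N, ∃ B : Hil N →L[ℂ] Hil N,
    (∀ φ : Hil N, (T.op φ, B φ) ∈ A.graph) ∧ HasTrace B (Φ T)

/-! ### Weyl operators and derivatives -/

/-- `(W(q,p) ψ)(t) = e^{-i q·p/2} e^{i p·t} ψ(t - q)`. -/
def weylFun {N : ℕ} (x : Phase N) (ψ : Conf N → ℂ) (t : Conf N) : ℂ :=
  Complex.exp (((-(inner ℝ x.1 x.2 / 2) : ℝ) : ℂ) * Complex.I) *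
    Complex.exp (((inner ℝ x.2 t : ℝ) : ℂ) * Complex.I) * ψ (t - x.1)

theorem norm_weylFun {N : ℕ} (x : Phase N) (ψ : Conf N → ℂ) (t : Conf N) :
    ‖weylFun x ψ t‖ = ‖ψ (t - x.1)‖ := by
  simp only [weylFun, norm_mul, Complex.norm_exp_ofReal_mul_I, one_mul]

theorem memLp_comp_sub {N : ℕ} (q : Conf N) (ψ : Hil N) :
    MemLp (fun t => ψ (t - q)) 2 (volume : Measure (Conf N)) :=
  (Lp.memLp ψ).comp_measurePreserving (measurePreserving_sub_right volume q)

theorem memLp_weylFun {N : ℕ} (x : Phase N) (ψ : Hil N) :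
    MemLp (weylFun x ψ) 2 (volume : Measure (Conf N)) := by
  refine (memLp_comp_sub x.1 ψ).of_le ?_ (.of_forall fun t => (norm_weylFun x ψ t).le)
  have h : Continuous fun t : Conf N =>
      Complex.exp (((-(inner ℝ x.1 x.2 / 2) : ℝ) : ℂ) * Complex.I) *
        Complex.exp (((inner ℝ x.2 t : ℝ) : ℂ) * Complex.I) := by
    fun_prop
  exact h.aestronglyMeasurable.mul (memLp_comp_sub x.1 ψ).aestronglyMeasurable

/-- The Weyl operator `W(x)` on the Hilbert space. -/
def weyl {N : ℕ} (x : Phase N) : Hil N →ₗᵢ[ℂ] Hil N where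
  toFun ψ := (memLp_weylFun x ψ).toLp _
  map_add' ψ φ := by
    rw [← MemLp.toLp_add]
    refine MemLp.toLp_congr _ _ ?_
    filter_upwards [(measurePreserving_sub_right volume x.1).quasiMeasurePreserving.ae
      (Lp.coeFn_add ψ φ)] with t ht
    simp only [weylFun, Pi.add_apply] at ht ⊢
    rw [ht]
    ring
  map_smul' c ψ := by
    rw [RingHom.id_apply, ← MemLp.toLp_const_smul]
    refine MemLp.toLp_congr _ _ ?_
    filter_upwards [(measurePreserving_sub_right volume x.1).quasiMeasurePreserving.ae
      (Lp.coeFn_smul c ψ)] with t ht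
    simp only [weylFun, Pi.smul_apply, smul_eq_mul] at ht ⊢
    rw [ht]
    ring
  norm_map' ψ := by
    change ‖(memLp_weylFun x ψ).toLp _‖ = ‖ψ‖
    rw [Lp.norm_toLp, eLpNorm_congr_norm_ae (.of_forall (norm_weylFun x ψ)), Lp.norm_def]
    exact congrArg ENNReal.toReal (eLpNorm_comp_measurePreserving (Lp.aestronglyMeasurable ψ)
      (measurePreserving_sub_right volume x.1))

/-- The function `y ↦ ⟨φ | W(y) T W(-y) ψ⟩` on phase space; `W(-y) = W(y)*`. -/
def translate {N : ℕ} (T : SchwartzOp N) (φ ψ : Hil N) (y : Phase N) : ℂ :=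
  inner ℂ φ (weyl y (T.op (weyl (-y) ψ)))

/-- Multi-indices of length `2N`: the entries `inl i` belong to `q_i`, the entries `inr i` to
`p_i`. -/
abbrev MIdx (N : ℕ) : Type := Fin N ⊕ Fin N → ℕ

/-- `|α| = ∑ α_i`. -/
def MIdx.order {N : ℕ} (α : MIdx N) : ℕ := ∑ i, α i

/-- The finite set of all multi-indices with `|α| ≤ m`. -/
def multiIdx (N m : ℕ) : Finset (MIdx N) :=
  (Fintype.piFinset fun _ => Finset.range (m + 1)).filter fun α => α.order ≤ m

/-- The coordinate directions in phase space. -/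
def dir {N : ℕ} : Fin N ⊕ Fin N → Phase N
  | .inl i => (EuclideanSpace.single i 1, 0)
  | .inr i => (0, EuclideanSpace.single i 1)

/-- The partial derivative of a function on phase space in a coordinate direction. -/
def pderiv {N : ℕ} (j : Fin N ⊕ Fin N) : Function.End (Phase N → ℂ) :=
  fun F y => lineDeriv ℝ F y (dir j)

/-- The derivative `D^α = ∂^{|α|} / ∂q^α ∂p^α` of functions on phase space. -/
def funDeriv {N : ℕ} (α : MIdx N) : Function.End (Phase N → ℂ) :=
  (List.ofFn fun i => pderiv (.inl i) ^ α (.inl i)).prod *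
    (List.ofFn fun i => pderiv (.inr i) ^ α (.inr i)).prod

/-- `S = D^α T` for Schwartz operators: all functions `y ↦ ⟨φ | W(y) T W(-y) ψ⟩` are smooth, and
`⟨φ | S ψ⟩ = (-1)^{|α|} D^α ⟨φ | W(y) T W(-y) ψ⟩` at `y = 0`. -/
def IsOpDeriv {N : ℕ} (α : MIdx N) (T S : SchwartzOp N) : Prop :=
  ∀ φ ψ : Hil N, ContDiff ℝ (⊤ : ℕ∞) (translate T φ ψ) ∧
    inner ℂ φ (S.op ψ) = (-1) ^ α.order * funDeriv α (translate T φ ψ) 0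

/-- `Ψ = D^α Φ` for distributions: every Schwartz operator `T` has a derivative `D^α T`, and
`Ψ(T) = (-1)^{|α|} Φ(D^α T)`. -/
def IsDistrDeriv {N : ℕ} (α : MIdx N) (Φ Ψ : Distr N) : Prop :=
  ∀ T : SchwartzOp N, ∃ S : SchwartzOp N, IsOpDeriv α T S ∧ Ψ T = (-1) ^ α.order * Φ S

end QDist

end

open MeasureTheory SchwartzMap

noncomputable section

namespace QDist

/-! ### Ordered products of powers of commuting elements -/

/-! Everything is computed in the orthonormal basis of Hermite functions h_n, with weight w(n) = 1 +
E_n, where E_n is the oscillator energy. A Schwartz operator T has matrix elements T_{nm} that decay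
faster than every power of w(n) w(m), and T is the sum of T_{nm} |h_n⟩⟨h_m| in the topology of
Schwartz operators (`hasSum_matUnit`). By continuity the coefficients a_{nm} = Φ(|h_n⟩⟨h_m|) of a
distribution grow at most like C w(n)^K w(m)^K (`coeffBdd_coef`), and Φ(T) = ∑ T_{nm} a_{nm}
(`eq_matDistr`).

The matrix (a_{nm}) alone need not give a polynomially bounded operator: one index can run far ahead
of the other, so that neither A nor A* is controlled by a power of H. The index set is therefore cut
in three, with a large exponent c.

Where w(n) ≤ w(m)^c and w(m) ≤ w(n)^c, each weight is dominated by a power of the other. For large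
k, dividing the coefficients by 1 + E^k on either side makes them summable. The operator A they
define is then B(1 + H^k) with B bounded, and (1 + H^k)⁻¹A extends to a bounded operator as well.
These two facts give the relative bounds for A and A* (`isPolyBounded_mulInv`, `isRep_matDistr`).

Where w(n)^c < w(m), write T_{nm} = w(m)^{-a} ⟨h_n | T (1+H)^a h_m⟩. Now H = -½ ∑ K_j², where the
K_j = -iP_j, iQ_j generate the Weyl operators, and T K_j = D_j T + K_j T, where D_j is the
derivative of T in the j-th direction. Hence (1+H)^a moves to the left vector at the cost of
derivatives of T (`Moves.hamOne_pow`): T_{nm} is w(m)^{-a} times a finite sum of terms ⟨Y_i h_n |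
(D^{α_i} T) h_m⟩, where ‖Y_i h_n‖ is bounded by a fixed power of w(n). Since a is fixed before c, a
large c lets one spare factor w(m)^{-1} absorb all growth in n. The resulting series define trace
class operators, and this part of Φ is a finite sum of derivatives of bounded operators
(`IsForm.exists_mem_regular`). The region w(m)^c < w(n) is the mirror image.

What has to be built for this: completeness of the Hermite functions, polynomial growth of monomials
in Q and P on them, and the identification of the derivative of y ↦ W(y) T W(-y) with the
commutator. The last point rests on a second order Taylor estimate for Weyl operators on Schwartz
functions, summed over the Hermite expansion of T (`exists_translate_taylor`). -/

/-- The ordered product `x_1^{α_1} ⋯ x_n^{α_n}`. -/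
def mprod {M : Type*} [Monoid M] {n : ℕ} (x : Fin n → M) (α : Fin n → ℕ) : M :=
  (List.ofFn fun i => x i ^ α i).prod

theorem mprod_zero {M : Type*} [Monoid M] {n : ℕ} (x : Fin n → M) : mprod x 0 = 1 := by
  simp [mprod, List.ofFn_const]

theorem mprod_succ {M : Type*} [Monoid M] {n : ℕ} (x : Fin (n + 1) → M) (α : Fin (n + 1) → ℕ) :
    mprod x α = x 0 ^ α 0 * mprod (fun i => x i.succ) (fun i => α i.succ) := by
  simp [mprod, List.ofFn_succ]

theorem commute_mprod {M : Type*} [Monoid M] {n : ℕ} {x : Fin n → M} {y : M}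
    (h : ∀ i, Commute y (x i)) (α : Fin n → ℕ) : Commute y (mprod x α) := by
  refine Commute.list_prod_right _ _ fun z hz => ?_
  obtain ⟨i, rfl⟩ := (List.mem_ofFn' _ _).1 hz
  exact (h i).pow_right _

theorem mprod_add_single {M : Type*} [Monoid M] {n : ℕ} {x : Fin n → M}
    (h : ∀ i j, Commute (x i) (x j)) (α : Fin n → ℕ) (i : Fin n) :
    mprod x (α + Pi.single i 1) = x i * mprod x α := by
  induction n with
  | zero => exact i.elim0
  | succ n ih =>
    rw [mprod_succ, mprod_succ]
    refine Fin.cases ?_ (fun i => ?_) i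
    · have : (fun j : Fin n => (α + Pi.single 0 1 : Fin (n + 1) → ℕ) j.succ) = fun j => α j.succ := by
        ext j; simp
      rw [this]
      simp [pow_succ', mul_assoc]
    · have : (fun j : Fin n => (α + Pi.single i.succ 1 : Fin (n + 1) → ℕ) j.succ) =
          (fun j => α j.succ) + Pi.single i 1 := by
        ext j
        simp [Pi.single_apply, Fin.succ_inj]
      rw [this, ih (fun i j => h _ _)]
      simp only [Pi.add_apply, Pi.single_apply, (Fin.succ_ne_zero i).symm, if_false, add_zero]
      rw [← mul_assoc, ← mul_assoc, ((h 0 i.succ).pow_left _).eq]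

theorem sub_add_single {n : ℕ} {α : Fin n → ℕ} {i : Fin n} (h : 0 < α i) :
    α - Pi.single i 1 + Pi.single i 1 = α := by
  ext k
  by_cases hk : k = i
  · subst hk; simp; omega
  · simp [hk]

/-- Induction on multi-indices, one entry at a time. -/
theorem multiIndex_induction {n : ℕ} {P : (Fin n → ℕ) → Prop} (h0 : P 0)
    (hs : ∀ α i, P α → P (α + Pi.single i 1)) (α : Fin n → ℕ) : P α := by
  obtain ⟨k, hk⟩ : ∃ k, ∑ i, α i = k := ⟨_, rfl⟩
  induction k generalizing α with
  | zero =>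
    have : α = 0 := by
      ext i
      simpa using (Finset.sum_eq_zero_iff.1 hk) i (Finset.mem_univ i)
    exact this ▸ h0
  | succ k ih =>
    obtain ⟨i, hi⟩ : ∃ i, α i ≠ 0 := by
      by_contra! h
      simp [h] at hk
    have e : α = (α - Pi.single i 1) + Pi.single i 1 := (sub_add_single (Nat.pos_of_ne_zero hi)).symm
    rw [e]
    refine hs _ _ (ih _ ?_)
    rw [e] at hk
    simp only [Pi.add_apply, Finset.sum_add_distrib, Finset.sum_pi_single', Finset.mem_univ,
      if_true] at hk
    omega

/-- If `y x_i = x_i y + δ_{ij} c`, then `y x^α = x^α y + c α_j x^{α - e_j}`. -/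
theorem mul_mprod_of_commutator {A : Type*} [Ring A] [Algebra ℂ A] {n : ℕ} {x : Fin n → A}
    (h : ∀ i j, Commute (x i) (x j)) {y : A} {c : ℂ} {j : Fin n}
    (hy : ∀ i, y * x i = x i * y + if i = j then algebraMap ℂ A c else 0) (α : Fin n → ℕ) :
    y * mprod x α = mprod x α * y + (c * α j) • mprod x (α - Pi.single j 1) := by
  induction α using multiIndex_induction with
  | h0 => simp [mprod_zero]
  | hs α i ih =>
    rw [mprod_add_single h, ← mul_assoc, hy, add_mul, mul_assoc, ih, mul_add, ← mul_assoc,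
      add_assoc]
    congr 1
    by_cases hij : i = j
    · subst hij
      simp only [if_true, add_tsub_cancel_right, Pi.add_apply, Pi.single_eq_same, mul_smul_comm,
        ← Algebra.smul_def]
      -- If α_i = 0 the truncated exponent α - e_i is meaningless, but its coefficient vanishes.
      rcases Nat.eq_zero_or_pos (α i) with h0 | h0
      · simp [h0]
      · rw [← mprod_add_single h, sub_add_single h0, ← add_smul]
        push_cast
        ring_nf
    · have e : α + Pi.single i 1 - Pi.single j 1 = α - Pi.single j 1 + Pi.single i 1 := by
        ext k
        by_cases hk : k = i
        · subst hk; simp [hij]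
        · by_cases hk' : k = j
          · subst hk'; simp [hk]
          · simp [hk, hk']
      have e2 : (α + Pi.single i 1 : Fin n → ℕ) j = α j := by
        simp [Ne.symm hij]
      rw [e, mprod_add_single h, e2]
      simp [hij]

theorem powQ_eq {N : ℕ} (α : Fin N → ℕ) : powQ α = mprod opQ α := rfl

theorem powP_eq {N : ℕ} (β : Fin N → ℕ) : powP β = mprod opP β := rfl

/-! ### Canonical commutation relations -/

theorem opQ_commute {N : ℕ} (i j : Fin N) : Commute (opQ i : Sch N →L[ℂ] Sch N) (opQ j) := by
  ext ψ t
  simp only [mul_apply_eq_comp, opQ_apply]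
  ring

theorem fderiv_lineDerivOp {N : ℕ} (v : Conf N) (ψ : Sch N) (t : Conf N) :
    fderiv ℝ (LineDeriv.lineDerivOp v ψ : Sch N) t = (fderiv ℝ (fderiv ℝ ψ) t).flip v := by
  have e : ((LineDeriv.lineDerivOp v ψ : Sch N) : Conf N → ℂ) = fun x => fderiv ℝ ψ x v := by
    ext x
    exact lineDerivOp_apply_eq_fderiv v ψ x
  have hd : DifferentiableAt ℝ (fderiv ℝ ψ) t :=
    ((ψ.smooth 2).fderiv_right (m := 1) (by norm_num)).differentiable (by simp) t
  rw [e]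
  ext w
  rw [fderiv_clm_apply hd (by fun_prop)]
  simp

theorem opP_commute {N : ℕ} (i j : Fin N) : Commute (opP i : Sch N →L[ℂ] Sch N) (opP j) := by
  ext ψ t
  have h (u v : Conf N) : (LineDeriv.lineDerivOp u (LineDeriv.lineDerivOp v ψ : Sch N) : Sch N) t
      = fderiv ℝ (fderiv ℝ ψ) t u v := by
    rw [lineDerivOp_apply_eq_fderiv, fderiv_lineDerivOp]
    simp
  have hs : IsSymmSndFDerivAt ℝ ψ t :=
    ((ψ.smooth 2).contDiffAt).isSymmSndFDerivAt (by simp)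
  simp only [opP, mul_apply_eq_comp, smul_apply,
    LineDeriv.lineDerivOpCLM_apply, map_smul, h]
  rw [hs.eq]

theorem opQ_mul_opP {N : ℕ} (j i : Fin N) :
    (opQ j * opP i : Sch N →L[ℂ] Sch N) = opP i * opQ j +
      if i = j then algebraMap ℂ _ Complex.I else 0 := by
  ext ψ t
  have hl : HasFDerivAt (fun t : Conf N => ((t j : ℝ) : ℂ))
      (Complex.ofRealCLM ∘L EuclideanSpace.proj (𝕜 := ℝ) j) t :=
    (Complex.ofRealCLM ∘L EuclideanSpace.proj (𝕜 := ℝ) j).hasFDerivAt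
  have h1 : lineDeriv ℝ (opQ j ψ) t (EuclideanSpace.single i 1) =
      (t j : ℂ) * lineDeriv ℝ ψ t (EuclideanSpace.single i 1) + (if i = j then 1 else 0) * ψ t := by
    have hm : HasFDerivAt (opQ j ψ) _ t :=
      (hl.mul (ψ.hasFDerivAt t)).congr_of_eventuallyEq (.of_forall (opQ_apply j ψ))
    rw [(hm.hasLineDerivAt _).lineDeriv, ((ψ.hasFDerivAt t).hasLineDerivAt _).lineDeriv]
    by_cases hij : j = i <;> simp [hij, eq_comm (a := i), mul_comm]
  rw [mul_apply_eq_comp, opQ_apply, opP_apply, add_apply, add_apply, mul_apply_eq_comp, opP_apply,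
    h1]
  split_ifs
  · simp [Algebra.algebraMap_eq_smul_one]
    ring
  · simp
    ring

/-- The antisymmetric generators `K` of the Weyl operators: `-i P_i` and `i Q_i`. -/
def gen {N : ℕ} : Fin N ⊕ Fin N → (Sch N →L[ℂ] Sch N)
  | .inl i => (-Complex.I) • opP i
  | .inr i => Complex.I • opQ i

/-- Only the form of the commutator matters: a purely imaginary scalar cancels between the two sides
of a sesquilinear form, so the derivations built from the generators commute although the generators
do not. -/
theorem gen_commutator {N : ℕ} (i j : Fin N ⊕ Fin N) :
    ∃ c : ℝ, (gen i * gen j : Sch N →L[ℂ] Sch N) = gen j * gen i + algebraMap ℂ _ (c * Complex.I) := by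
  rcases i with i | i <;> rcases j with j | j
  · exact ⟨0, by simp [gen, (opP_commute i j).eq]⟩
  · refine ⟨if i = j then -1 else 0, ?_⟩
    simp only [gen, smul_mul_smul_comm, opQ_mul_opP]
    split_ifs <;> simp [Algebra.algebraMap_eq_smul_one]
  · refine ⟨if j = i then 1 else 0, ?_⟩
    simp only [gen, smul_mul_smul_comm, opQ_mul_opP]
    split_ifs <;> simp [Algebra.algebraMap_eq_smul_one]
  · exact ⟨0, by simp [gen, (opQ_commute i j).eq]⟩

/-! ### The Gaussian -/

theorem exists_pow_mul_exp_neg_le (k : ℕ) :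
    ∃ C : ℝ, ∀ r : ℝ, 0 ≤ r → (1 + r) ^ k * Real.exp (-(r ^ 2 / 2)) ≤ C := by
  -- The constant comes from (1+r)^k ≤ k! e^{1+r} and 1 + r - r²/2 ≤ 3/2, the latter being (r-1)² ≥
  -- 0.
  refine ⟨k.factorial * Real.exp (3 / 2), fun r hr => ?_⟩
  have h1 : (1 + r) ^ k ≤ k.factorial * Real.exp (1 + r) := by
    have := Real.pow_div_factorial_le_exp (1 + r) (by positivity) k
    rwa [div_le_iff₀ (by positivity), mul_comm] at this
  calc _ ≤ k.factorial * Real.exp (1 + r) * Real.exp (-(r ^ 2 / 2)) := by gcongr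
    _ = k.factorial * Real.exp (1 + r + -(r ^ 2 / 2)) := by rw [mul_assoc, ← Real.exp_add]
    _ ≤ _ := by
      gcongr
      nlinarith [sq_nonneg (r - 1)]

/-- The n-th derivative of e^u, with u of temperate growth, is e^u times something of polynomial
growth (Faà di Bruno), and e^u beats every polynomial. -/
theorem gaussian_decay {E : Type*} [NormedAddCommGroup E] [InnerProductSpace ℝ E] (k n : ℕ) :
    ∃ C : ℝ, ∀ x : E, ‖x‖ ^ k * ‖iteratedFDeriv ℝ n (fun x : E => Real.exp (-(‖x‖ ^ 2 / 2))) x‖ ≤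
      C := by
  have hu : (fun x : E => -(‖x‖ ^ 2 / 2)).HasTemperateGrowth := by
    have h := (Function.HasTemperateGrowth.const (E := E) (-1 / 2 : ℝ)).mul
      (Function.hasTemperateGrowth_norm_sq (H := E))
    have e : (fun x : E => -(‖x‖ ^ 2 / 2)) = (fun _ => (-1 / 2 : ℝ)) * fun x : E => ‖x‖ ^ 2 := by
      funext x
      simp only [Pi.mul_apply]
      ring
    rw [e]
    exact h
  obtain ⟨l, C, hC, hb⟩ := hu.norm_iteratedFDeriv_le_uniform n
  obtain ⟨M, hM⟩ := exists_pow_mul_exp_neg_le (k + l * n)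
  refine ⟨n.factorial * (1 + C) ^ n * M, fun x => ?_⟩
  have h := norm_iteratedFDeriv_comp_le (𝕜 := ℝ) (g := Real.exp)
    (f := fun x : E => -(‖x‖ ^ 2 / 2)) (N := n) (n := n) Real.contDiff_exp (hu.1.of_le (mod_cast le_top))
    le_rfl x (C := Real.exp (-(‖x‖ ^ 2 / 2))) (D := (1 + C) * (1 + ‖x‖) ^ l) ?_ ?_
  · change ‖x‖ ^ k * ‖iteratedFDeriv ℝ n (Real.exp ∘ fun x : E => -(‖x‖ ^ 2 / 2)) x‖ ≤ _
    calc _ ≤ (1 + ‖x‖) ^ k * (n.factorial * Real.exp (-(‖x‖ ^ 2 / 2)) *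
          ((1 + C) * (1 + ‖x‖) ^ l) ^ n) := by
          gcongr
          linarith
      _ = n.factorial * (1 + C) ^ n * ((1 + ‖x‖) ^ (k + l * n) * Real.exp (-(‖x‖ ^ 2 / 2))) := by
          rw [pow_add, pow_mul, mul_pow]
          ring
      _ ≤ _ := by
          gcongr
          exact hM _ (norm_nonneg x)
  · intro i _
    rw [norm_iteratedFDeriv_eq_norm_iteratedDeriv, iteratedDeriv_eq_iterate, Real.iter_deriv_exp,
      Real.norm_of_nonneg (Real.exp_pos _).le]
  · intro i hi hin
    refine (hb i hin x).trans ?_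
    have h1 : (1 : ℝ) ≤ (1 + ‖x‖) ^ l := one_le_pow₀ (by simp)
    calc C * (1 + ‖x‖) ^ l ≤ (1 + C) * (1 + ‖x‖) ^ l := by gcongr; linarith
      _ ≤ _ := le_self_pow₀ (by nlinarith) (by omega)

/-- The real Gaussian `e^{-|t|²/2}`. -/
def gaussR (N : ℕ) : 𝓢(Conf N, ℝ) where
  toFun x := Real.exp (-(‖x‖ ^ 2 / 2))
  smooth' := by
    have : ContDiff ℝ (⊤ : ℕ∞) fun x : Conf N => ‖x‖ ^ 2 := contDiff_norm_sq ℝ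
    fun_prop
  decay' k n := gaussian_decay k n

/-- The Gaussian `e^{-|t|²/2}`, the ground state of the harmonic oscillator. -/
def gauss (N : ℕ) : Sch N := (gaussR N).postcompCLM Complex.ofRealCLM

theorem gauss_apply {N : ℕ} (t : Conf N) : gauss N t = (Real.exp (-(‖t‖ ^ 2 / 2)) : ℝ) := rfl

/-! ### Ladder operators -/

/-- The lowering operator `Q_i + i P_i`. -/
def lower {N : ℕ} (i : Fin N) : Sch N →L[ℂ] Sch N := opQ i + Complex.I • opP i

/-- The raising operator `Q_i - i P_i`. -/
def raise {N : ℕ} (i : Fin N) : Sch N →L[ℂ] Sch N := opQ i - Complex.I • opP i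

theorem lower_gauss {N : ℕ} (i : Fin N) : lower i (gauss N) = 0 := by
  ext t
  have h1 : HasFDerivAt (fun x : Conf N => Real.exp (-(‖x‖ ^ 2 / 2)))
      (Real.exp (-(‖t‖ ^ 2 / 2)) • -((1 / 2 : ℝ) • ((2 : ℕ) • innerSL ℝ t))) t := by
    have h := ((hasStrictFDerivAt_norm_sq t).hasFDerivAt.const_mul (1 / 2 : ℝ)).neg.exp
    simp only [Pi.neg_apply, one_div_mul_eq_div] at h
    exact h
  have h2 : HasFDerivAt (gauss N) _ t := Complex.ofRealCLM.hasFDerivAt.comp t h1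
  simp only [lower, add_apply, smul_apply, opQ_apply, opP_apply,
    (h2.hasLineDerivAt _).lineDeriv, gauss_apply]
  simp [EuclideanSpace.inner_single_right]
  ring_nf
  simp

theorem raise_commute {N : ℕ} (i j : Fin N) :
    Commute (raise i : Sch N →L[ℂ] Sch N) (raise j) := by
  have e : (opQ i * opP j : Sch N →L[ℂ] Sch N) + opP i * opQ j = opP j * opQ i + opQ j * opP i := by
    rw [opQ_mul_opP, opQ_mul_opP]
    by_cases h : i = j <;> simp [h, eq_comm (a := j), add_comm]
  simp only [Commute, SemiconjBy, raise, sub_mul, mul_sub, smul_mul_assoc, mul_smul_comm,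
    (opQ_commute i j).eq, (opP_commute i j).eq]
  linear_combination (norm := module) (-Complex.I) • e

theorem lower_mul_raise {N : ℕ} (j i : Fin N) : (lower j * raise i : Sch N →L[ℂ] Sch N) =
    raise i * lower j + if i = j then algebraMap ℂ _ 2 else 0 := by
  have e1 := opQ_mul_opP (N := N) j i
  have e2 := opQ_mul_opP (N := N) i j
  simp only [lower, raise, sub_mul, mul_sub, add_mul, mul_add, smul_mul_assoc, mul_smul_comm,
    (opQ_commute j i).eq, (opP_commute j i).eq, e1, e2]
  by_cases h : i = j
  · subst h
    simp only [if_true, Algebra.algebraMap_eq_smul_one]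
    match_scalars <;> ring_nf
    norm_num [Complex.I_sq]
  · simp only [h, Ne.symm h, if_false]
    module

theorem raise_mul_lower {N : ℕ} (i : Fin N) : (raise i * lower i : Sch N →L[ℂ] Sch N) =
    opQ i ^ 2 + opP i ^ 2 - 1 := by
  have e1 := opQ_mul_opP (N := N) i i
  simp only [lower, raise, sub_mul, mul_add, smul_mul_assoc, mul_smul_comm,
    e1, if_true, Algebra.algebraMap_eq_smul_one, pow_two]
  match_scalars <;> ring_nf <;> simp

theorem inner_lower {N : ℕ} (i : Fin N) (ψ φ : Sch N) :
    inner ℂ (emb N ψ) (emb N (lower i φ)) = inner ℂ (emb N (raise i ψ)) (emb N φ) := by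
  simp only [lower, raise, add_apply, sub_apply, smul_apply, map_add, map_sub,
    map_smul, inner_add_right, inner_sub_left, inner_smul_right, inner_smul_left, isSym_opQ i ψ φ,
    isSym_opP i ψ φ]
  simp

theorem opQ_eq {N : ℕ} (i : Fin N) :
    (opQ i : Sch N →L[ℂ] Sch N) = (1 / 2 : ℂ) • (lower i + raise i) := by
  simp only [lower, raise]
  module

theorem opP_eq {N : ℕ} (i : Fin N) :
    (opP i : Sch N →L[ℂ] Sch N) = (-Complex.I / 2) • (lower i - raise i) := by
  simp only [lower, raise]
  match_scalars <;> ring_nf; simp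

/-! ### Hermite functions -/

/-- The Hermite function `∏ᵢ (Q_i - i P_i)^{n_i} e^{-|t|²/2}`, not normalized. -/
def herm {N : ℕ} (n : Fin N → ℕ) : Sch N := mprod raise n (gauss N)

theorem herm_zero {N : ℕ} : herm (0 : Fin N → ℕ) = gauss N := by
  simp [herm, mprod_zero]

theorem raise_herm {N : ℕ} (n : Fin N → ℕ) (i : Fin N) :
    raise i (herm n) = herm (n + Pi.single i 1) := by
  rw [herm, herm, mprod_add_single raise_commute]
  rfl

/-- Commuting the lowering operator through the raising operators leaves a term acting on the
Gaussian, which it annihilates. For n_i = 0 the truncated index is harmless, since the coefficient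
is zero. -/
theorem lower_herm {N : ℕ} (n : Fin N → ℕ) (i : Fin N) :
    lower i (herm n) = (2 * n i : ℂ) • herm (n - Pi.single i 1) := by
  have h := congrArg (fun L => L (gauss N))
    (mul_mprod_of_commutator raise_commute (fun k => lower_mul_raise i k) n)
  simpa [mul_apply_eq_comp, lower_gauss, herm] using h

theorem inner_herm_add {N : ℕ} (n m : Fin N → ℕ) (i : Fin N) :
    inner ℂ (emb N (herm (n + Pi.single i 1))) (emb N (herm m)) =
      2 * m i * inner ℂ (emb N (herm n)) (emb N (herm (m - Pi.single i 1))) := by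
  rw [← raise_herm, ← inner_lower, lower_herm, map_smul, inner_smul_right]

/-- The energy `∑ᵢ (n_i + 1/2)`. -/
def energy {N : ℕ} (n : Fin N → ℕ) : ℝ := ∑ i, ((n i : ℝ) + 1 / 2)

theorem hamS_herm {N : ℕ} (n : Fin N → ℕ) : hamS N (herm n) = (energy n : ℂ) • herm n := by
  have h (i : Fin N) : (opQ i ^ 2 + opP i ^ 2) (herm n) = (2 * n i + 1 : ℂ) • herm n := by
    have e : (opQ i ^ 2 + opP i ^ 2 : Sch N →L[ℂ] Sch N) = raise i * lower i + 1 := by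
      rw [raise_mul_lower]; abel
    rw [e, add_apply, mul_apply_eq_comp, lower_herm, map_smul, raise_herm, add_smul]
    rcases Nat.eq_zero_or_pos (n i) with h0 | h0
    · simp [h0]
    · simp [sub_add_single h0]
  simp only [hamS, smul_apply, sum_apply, h, ← Finset.sum_smul, smul_smul, energy]
  push_cast
  rw [Finset.mul_sum]
  congr 1
  refine Finset.sum_congr rfl fun i _ => ?_
  ring

/-- Each raising operator on the left becomes a lowering operator on the right, so an inner product
reduces step by step to one in which a Gaussian meets a lowering operator. -/
theorem inner_herm_of_ne {N : ℕ} {n m : Fin N → ℕ} (h : n ≠ m) :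
    inner ℂ (emb N (herm n)) (emb N (herm m)) = 0 := by
  induction n using multiIndex_induction generalizing m with
  | h0 =>
    obtain ⟨i, hi⟩ : ∃ i, m i ≠ 0 := by
      by_contra! hm
      exact h (funext fun i => (hm i).symm)
    have e : m = m - Pi.single i 1 + Pi.single i 1 := (sub_add_single (Nat.pos_of_ne_zero hi)).symm
    rw [← inner_conj_symm, e, inner_herm_add]
    simp
  | hs n i ih =>
    rw [inner_herm_add]
    by_cases hi : m i = 0
    · simp [hi]
    · rw [ih, mul_zero]
      rintro rfl
      refine h ?_
      ext k
      by_cases hk : k = i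
      · subst hk; simp; omega
      · simp [hk]

theorem norm_sq_herm_add {N : ℕ} (n : Fin N → ℕ) (i : Fin N) :
    ‖emb N (herm (n + Pi.single i 1))‖ ^ 2 = 2 * (n i + 1) * ‖emb N (herm n)‖ ^ 2 := by
  have h := inner_herm_add n (n + Pi.single i 1) i
  simp only [add_tsub_cancel_right, inner_self_eq_norm_sq_to_K] at h
  simp at h
  exact_mod_cast h

theorem emb_injective (N : ℕ) : Function.Injective (emb N) := injective_toLp 2 volume

theorem norm_herm_pos {N : ℕ} (n : Fin N → ℕ) : 0 < ‖emb N (herm n)‖ := by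
  induction n using multiIndex_induction with
  | h0 =>
    rw [norm_pos_iff, herm_zero]
    intro h
    have h1 : gauss N = 0 := emb_injective N (by rw [h, map_zero])
    have h2 := congrArg (fun ψ : Sch N => ψ 0) h1
    simp [gauss_apply] at h2
  | hs n i ih =>
    have h := norm_sq_herm_add n i
    have : 0 < ‖emb N (herm (n + Pi.single i 1))‖ ^ 2 := by rw [h]; positivity
    refine (norm_nonneg _).lt_of_ne fun h0 => ?_
    rw [← h0] at this
    simp at this

/-- The normalized Hermite functions. -/
def hermN {N : ℕ} (n : Fin N → ℕ) : Sch N := ((‖emb N (herm n)‖⁻¹ : ℝ) : ℂ) • herm n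

theorem orthonormal_hermN (N : ℕ) :
    Orthonormal ℂ fun n : Fin N → ℕ => emb N (hermN n) := by
  refine ⟨fun n => ?_, fun n m h => ?_⟩
  · have := (norm_herm_pos n).ne'
    change ‖emb N (hermN n)‖ = 1
    simp [hermN, norm_smul, this]
  · change inner ℂ (emb N (hermN n)) (emb N (hermN m)) = 0
    simp only [hermN, map_smul, inner_smul_left, inner_smul_right, inner_herm_of_ne h, mul_zero]

theorem hamS_hermN {N : ℕ} (n : Fin N → ℕ) : hamS N (hermN n) = (energy n : ℂ) • hermN n := by
  rw [hermN, map_smul, hamS_herm, smul_comm]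

theorem raise_hermN {N : ℕ} (n : Fin N → ℕ) (i : Fin N) :
    raise i (hermN n) = ((√(2 * (n i + 1)) : ℝ) : ℂ) • hermN (n + Pi.single i 1) := by
  have h := norm_sq_herm_add n i
  have h1 := norm_herm_pos n
  have h2 := norm_herm_pos (n + Pi.single i 1)
  have h3 : √(2 * (n i + 1)) = ‖emb N (herm (n + Pi.single i 1))‖ / ‖emb N (herm n)‖ := by
    rw [Real.sqrt_eq_iff_mul_self_eq (by positivity) (by positivity)]
    field_simp
    linarith
  rw [hermN, hermN, map_smul, raise_herm, smul_smul, h3]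
  congr 1
  rw [← Complex.ofReal_mul, Complex.ofReal_inj]
  field_simp

theorem lower_hermN {N : ℕ} (n : Fin N → ℕ) (i : Fin N) :
    lower i (hermN n) = ((√(2 * n i) : ℝ) : ℂ) • hermN (n - Pi.single i 1) := by
  rcases Nat.eq_zero_or_pos (n i) with h0 | h0
  · rw [hermN, map_smul, lower_herm]
    simp [h0]
  · obtain ⟨m, rfl⟩ : ∃ m : Fin N → ℕ, n = m + (Pi.single i 1 : Fin N → ℕ) :=
      ⟨_, (sub_add_single h0).symm⟩
    have h := norm_sq_herm_add m i
    have h1 := norm_herm_pos m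
    have h2 := norm_herm_pos (m + Pi.single i 1)
    have h3 : √(2 * ((m + Pi.single i 1 : Fin N → ℕ) i : ℕ)) =
        ‖emb N (herm (m + Pi.single i 1))‖ / ‖emb N (herm m)‖ := by
      rw [Real.sqrt_eq_iff_mul_self_eq (by positivity) (by positivity)]
      field_simp
      simp
      linarith
    rw [h3, hermN, hermN, map_smul, lower_herm, smul_smul, smul_smul, add_tsub_cancel_right]
    congr 1
    have e : ((2 * ((m + Pi.single i 1 : Fin N → ℕ) i : ℕ) : ℂ)) =
        ((2 * (m i + 1) : ℝ) : ℂ) := by simp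
    rw [e, ← Complex.ofReal_mul, ← Complex.ofReal_mul, Complex.ofReal_inj]
    field_simp
    linarith

/-! ### Completeness of the Hermite functions -/

/-- Hence polynomials times the Gaussian lie in the span of the Hermite functions, which is what the
completeness proof uses. -/
theorem opQ_mem_span_herm {N : ℕ} (i : Fin N) {ψ : Sch N}
    (h : ψ ∈ Submodule.span ℂ (Set.range (herm (N := N)))) :
    opQ i ψ ∈ Submodule.span ℂ (Set.range (herm (N := N))) := by
  induction h using Submodule.span_induction with
  | mem x hx =>
    obtain ⟨n, rfl⟩ := hx
    rw [opQ_eq, smul_apply, add_apply, lower_herm, raise_herm]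
    exact Submodule.smul_mem _ _ (add_mem
      (Submodule.smul_mem _ _ (Submodule.subset_span ⟨_, rfl⟩)) (Submodule.subset_span ⟨_, rfl⟩))
  | zero => simp
  | add x y _ _ hx hy => rw [map_add]; exact add_mem hx hy
  | smul a x _ hx => rw [map_smul]; exact Submodule.smul_mem _ _ hx

/-- Multiplication by the linear form `⟨p, t⟩`. -/
def mulLin {N : ℕ} (p : Conf N) : Sch N →L[ℂ] Sch N := ∑ i, (p i : ℂ) • opQ i

theorem mulLin_apply {N : ℕ} (p : Conf N) (ψ : Sch N) (t : Conf N) :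
    mulLin p ψ t = (inner ℝ p t : ℝ) * ψ t := by
  simp only [mulLin, sum_apply, smul_apply, opQ_apply, PiLp.inner_apply]
  push_cast
  rw [Finset.sum_mul]
  refine Finset.sum_congr rfl fun i _ => ?_
  simp
  ring

theorem mulLin_pow_apply {N : ℕ} (p : Conf N) (k : ℕ) (ψ : Sch N) (t : Conf N) :
    (mulLin p ^ k) ψ t = ((inner ℝ p t : ℝ) : ℂ) ^ k * ψ t := by
  induction k with
  | zero => simp
  | succ k ih => rw [pow_succ', mul_apply_eq_comp, mulLin_apply, ih]; ring

theorem mulLin_pow_gauss_mem {N : ℕ} (p : Conf N) (k : ℕ) :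
    (mulLin p ^ k) (gauss N) ∈ Submodule.span ℂ (Set.range (herm (N := N))) := by
  induction k with
  | zero => exact Submodule.subset_span ⟨0, by simp [herm_zero]⟩
  | succ k ih =>
    rw [pow_succ', mul_apply_eq_comp, mulLin, sum_apply]
    exact Submodule.sum_mem _ fun i _ => Submodule.smul_mem _ _ (opQ_mem_span_herm i ih)

theorem inner_emb_eq_integral {N : ℕ} (ψ : Sch N) (f : Hil N) :
    inner ℂ (emb N ψ) f = ∫ t, (starRingEnd ℂ) (ψ t) * f t := by
  rw [L2.inner_def]
  refine integral_congr_ae ?_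
  filter_upwards [ψ.coeFn_toLp 2 volume] with t ht
  have : (emb N ψ : Conf N → ℂ) t = ψ t := ht
  rw [this]
  simp [mul_comm]

theorem exp_inner_mul_gauss {N : ℕ} (p t : Conf N) :
    Real.exp (inner ℝ p t) * Real.exp (-(‖t‖ ^ 2 / 2)) =
      Real.exp (‖p‖ ^ 2 / 2) * Real.exp (-(‖t - p‖ ^ 2 / 2)) := by
  rw [← Real.exp_add, ← Real.exp_add, norm_sub_sq_real, real_inner_comm p t]
  congr 1
  ring

/-- Completing the square turns e^{±p·t} times the Gaussian into a multiple of a translated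
Gaussian, and a Gaussian times an L² function is integrable. This is the dominating function for the
exponential series below. -/
theorem integrable_exp_inner_mul {N : ℕ} (p : Conf N) (f : Hil N) :
    Integrable fun t => Real.exp |inner ℝ p t| * ‖gauss N t * f t‖ := by
  have h (q : Conf N) : Integrable fun t => ‖gauss N (t - q)‖ * ‖f t‖ := by
    have h1 : MemLp (fun t => gauss N (t - q)) 2 volume := by
      have := (compSubConstCLM ℂ q (gauss N)).memLp 2 volume
      rwa [show (compSubConstCLM ℂ q (gauss N) : Conf N → ℂ) = fun t => gauss N (t - q) from
        funext fun t => compSubConstCLM_apply ..] at this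
    exact MemLp.integrable_mul h1.norm (Lp.memLp f).norm
  refine (((h p).add (h (-p))).const_mul (Real.exp (‖p‖ ^ 2 / 2))).mono' ?_ ?_
  · refine Continuous.aestronglyMeasurable (by fun_prop) |>.mul ?_
    exact (((gauss N).continuous.aestronglyMeasurable).mul (Lp.aestronglyMeasurable f)).norm
  · refine .of_forall fun t => ?_
    have h1 : Real.exp |inner ℝ p t| ≤ Real.exp (inner ℝ p t) + Real.exp (inner ℝ (-p) t) := by
      rw [inner_neg_left]
      rcases abs_cases (inner ℝ p t) with h | h <;> rw [h.1]
      · linarith [Real.exp_pos (-inner ℝ p t)]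
      · linarith [Real.exp_pos (inner ℝ p t)]
    have h2 (q : Conf N) : Real.exp (inner ℝ q t) * ‖gauss N t‖ =
        Real.exp (‖q‖ ^ 2 / 2) * ‖gauss N (t - q)‖ := by
      simp only [gauss_apply, Complex.norm_real, Real.norm_of_nonneg (Real.exp_pos _).le,
        exp_inner_mul_gauss]
    rw [Real.norm_of_nonneg (by positivity), norm_mul, ← mul_assoc]
    simp only [Pi.add_apply]
    calc _ ≤ ((Real.exp (inner ℝ p t) + Real.exp (inner ℝ (-p) t)) * ‖gauss N t‖) * ‖f t‖ := by
          gcongr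
      _ = _ := by
          rw [add_mul, h2, h2, norm_neg]
          ring

/-- Expanding e^{ip·t} in a power series, every term pairs f with a polynomial times the Gaussian,
hence gives zero. So the Fourier transform of Gaussian times f vanishes. -/
theorem integral_exp_mul_gauss_eq_zero {N : ℕ} {f : Hil N}
    (h : ∀ n : Fin N → ℕ, inner ℂ (emb N (herm n)) f = 0) (p : Conf N) :
    ∫ t, Complex.exp ((inner ℝ p t : ℝ) * Complex.I) * (gauss N t * f t) = 0 := by
  have hspan (ψ : Sch N) (hψ : ψ ∈ Submodule.span ℂ (Set.range (herm (N := N)))) :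
      inner ℂ (emb N ψ) f = 0 := by
    induction hψ using Submodule.span_induction with
    | mem x hx => obtain ⟨n, rfl⟩ := hx; exact h n
    | zero => simp
    | add x y _ _ hx hy => rw [map_add, inner_add_left, hx, hy, add_zero]
    | smul a x _ hx => rw [map_smul, inner_smul_left, hx, mul_zero]
  have hk (k : ℕ) : ∫ t, (((inner ℝ p t : ℝ) : ℂ) * Complex.I) ^ k / k.factorial *
      (gauss N t * f t) = 0 := by
    have h1 := hspan _ (mulLin_pow_gauss_mem p k)
    rw [inner_emb_eq_integral] at h1
    calc _ = ∫ t, (Complex.I ^ k / k.factorial) *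
          ((starRingEnd ℂ) ((mulLin p ^ k) (gauss N) t) * f t) := by
          refine integral_congr_ae (.of_forall fun t => ?_)
          simp only [mulLin_pow_apply, gauss_apply, map_mul, map_pow, Complex.conj_ofReal]
          ring
      _ = 0 := by rw [integral_const_mul, h1, mul_zero]
  have hs : HasSum (fun k : ℕ => ∫ t, (((inner ℝ p t : ℝ) : ℂ) * Complex.I) ^ k / k.factorial *
      (gauss N t * f t)) (∫ t, Complex.exp ((inner ℝ p t : ℝ) * Complex.I) * (gauss N t * f t)) := by
    have hexp (x : ℝ) : HasSum (fun k : ℕ => x ^ k / k.factorial) (Real.exp x) := by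
      rw [Real.exp_eq_exp_ℝ]
      exact NormedSpace.expSeries_div_hasSum_exp x
    refine hasSum_integral_of_dominated_convergence
      (fun k t => |inner ℝ p t| ^ k / k.factorial * ‖gauss N t * f t‖) (fun k => ?_) (fun k => ?_)
      ?_ ?_ ?_
    · refine AEStronglyMeasurable.mul (Continuous.aestronglyMeasurable (by fun_prop)) ?_
      exact (gauss N).continuous.aestronglyMeasurable.mul (Lp.aestronglyMeasurable f)
    · refine .of_forall fun t => le_of_eq ?_
      simp
    · exact .of_forall fun t => (hexp _).summable.mul_right _
    · have e : (fun t => ∑' k : ℕ, |inner ℝ p t| ^ k / k.factorial * ‖gauss N t * f t‖) =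
          fun t => Real.exp |inner ℝ p t| * ‖gauss N t * f t‖ := by
        funext t
        rw [tsum_mul_right, (hexp _).tsum_eq]
      rw [e]
      exact integrable_exp_inner_mul p f
    · refine .of_forall fun t => HasSum.mul_right _ ?_
      rw [Complex.exp_eq_exp_ℂ]
      exact NormedSpace.expSeries_div_hasSum_exp _
  simp only [hk] at hs
  exact hs.unique hasSum_zero |>.symm ▸ rfl

/-- A function u in L¹ with zero Fourier transform integrates to zero against all test functions, so
u = 0 almost everywhere; here u is f times the nowhere vanishing Gaussian. -/
theorem eq_zero_of_inner_herm {N : ℕ} {f : Hil N}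
    (h : ∀ n : Fin N → ℕ, inner ℂ (emb N (herm n)) f = 0) : f = 0 := by
  set u : Conf N → ℂ := fun t => gauss N t * f t with hu
  have hui : Integrable u := by
    have h1 : MemLp (gauss N) 2 volume := (gauss N).memLp 2
    exact MemLp.integrable_mul h1 (Lp.memLp f)
  have hF (w : Conf N) : FourierTransform.fourier u w = 0 := by
    rw [Real.fourier_eq']
    have := integral_exp_mul_gauss_eq_zero h ((-2 * Real.pi) • w)
    simp only [inner_smul_left] at this
    simp only [smul_eq_mul]
    rw [← this]
    refine integral_congr_ae (.of_forall fun t => ?_)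
    simp [real_inner_comm, hu]
  have hS (χ : Sch N) : ∫ t, u t * χ t = 0 := by
    -- Multiplication formula ∫ û v = ∫ u v̂, applied to v, the inverse Fourier transform of χ.
    have e := VectorFourier.integral_fourierIntegral_smul_eq_flip (L := innerₗ (Conf N))
      Real.continuous_fourierChar continuous_inner hui
      ((FourierTransformInv.fourierInv χ : Sch N).integrable (μ := volume))
    have e2 (w : Conf N) : VectorFourier.fourierIntegral Real.fourierChar volume (innerₗ (Conf N)) u
      w = 0 := hF w
    simp only [e2, zero_smul, integral_zero, flip_innerₗ] at e
    rw [e]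
    have e3 := fourier_coe (FourierTransformInv.fourierInv χ : Sch N)
    rw [FourierTransform.fourier_fourierInv_eq] at e3
    exact integral_congr_ae (.of_forall fun t => by rw [e3]; rfl)
  have hu0 : ∀ᵐ t, u t = 0 := by
    refine ae_eq_zero_of_integral_contDiff_smul_eq_zero hui.locallyIntegrable fun g hg hgc => ?_
    have hc : HasCompactSupport fun t => (g t : ℂ) := hgc.comp_left Complex.ofReal_zero
    have hd : ContDiff ℝ (⊤ : ℕ∞) fun t => (g t : ℂ) := Complex.ofRealCLM.contDiff.comp hg
    rw [← hS (hc.toSchwartzMap hd)]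
    refine integral_congr_ae (.of_forall fun t => ?_)
    simp [mul_comm]
  rw [Lp.eq_zero_iff_ae_eq_zero]
  filter_upwards [hu0] with t ht
  simpa [hu, gauss_apply] using ht

/-- The Hilbert basis of Hermite functions. -/
def hermBasis (N : ℕ) : HilbertBasis (Fin N → ℕ) ℂ (Hil N) :=
  HilbertBasis.mkOfOrthogonalEqBot (orthonormal_hermN N) (by
    rw [Submodule.eq_bot_iff]
    intro f hf
    refine eq_zero_of_inner_herm fun n => ?_
    have h1 := Submodule.mem_orthogonal _ f |>.1 hf _ (Submodule.subset_span ⟨n, rfl⟩)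
    simp only [hermN, map_smul, inner_smul_left, mul_eq_zero] at h1
    refine h1.resolve_left ?_
    simp [(norm_herm_pos n).ne'])

theorem hermBasis_apply {N : ℕ} (n : Fin N → ℕ) : hermBasis N n = emb N (hermN n) := by
  simp [hermBasis]

/-! ### Polynomially bounded families of Schwartz functions -/

/-- The weight `1 + E_n`, where `E_n` is the `n`-th energy. -/
def wt {N : ℕ} (n : Fin N → ℕ) : ℝ := energy n + 1

theorem energy_nonneg {N : ℕ} (n : Fin N → ℕ) : 0 ≤ energy n :=
  Finset.sum_nonneg fun i _ => by positivity

theorem one_le_wt {N : ℕ} (n : Fin N → ℕ) : 1 ≤ wt n := by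
  have := energy_nonneg n
  unfold wt; linarith

theorem wt_pos {N : ℕ} (n : Fin N → ℕ) : 0 < wt n := zero_lt_one.trans_le (one_le_wt n)

theorem coe_le_wt {N : ℕ} (n : Fin N → ℕ) (i : Fin N) : (n i : ℝ) + 1 ≤ wt n := by
  have h : (n i : ℝ) + 1 / 2 ≤ energy n :=
    Finset.single_le_sum (f := fun i => (n i : ℝ) + 1 / 2) (fun j _ => by positivity)
      (Finset.mem_univ i)
  unfold wt; linarith

theorem wt_add_single {N : ℕ} (n : Fin N → ℕ) (i : Fin N) :
    wt (n + Pi.single i 1) = wt n + 1 := by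
  have h : ∀ j : Fin N, (((n + Pi.single i 1 : Fin N → ℕ) j : ℕ) : ℝ) + 1 / 2 =
      ((n j : ℝ) + 1 / 2) + (Pi.single i (1 : ℝ) : Fin N → ℝ) j := fun j => by
    by_cases hj : j = i
    · subst hj; simp; ring
    · simp [hj]
  simp only [wt, energy, h, Finset.sum_add_distrib, Finset.sum_pi_single', Finset.mem_univ,
    if_true]

theorem wt_sub_single_le {N : ℕ} (n : Fin N → ℕ) (i : Fin N) :
    wt (n - Pi.single i 1) ≤ wt n := by
  unfold wt energy
  gcongr with j
  simp

/-- The families `n ↦ ψ_n` of finite sums of terms `c(n) h_{σ(n)}`, where `c` is polynomially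
bounded and the energy of `σ(n)` exceeds that of `n` by at most a constant. -/
inductive Tame {N : ℕ} : ((Fin N → ℕ) → Sch N) → Prop
  | base (c : (Fin N → ℕ) → ℂ) (σ : (Fin N → ℕ) → Fin N → ℕ) (C D : ℝ) (k : ℕ)
      (hc : ∀ n, ‖c n‖ ≤ C * wt n ^ k) (hσ : ∀ n, wt (σ n) ≤ wt n + D) :
      Tame fun n => c n • hermN (σ n)
  | add {f g : (Fin N → ℕ) → Sch N} : Tame f → Tame g → Tame fun n => f n + g n

theorem Tame.exists_norm_le {N : ℕ} {f : (Fin N → ℕ) → Sch N} (h : Tame f) :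
    ∃ (C : ℝ) (k : ℕ), ∀ n, ‖emb N (f n)‖ ≤ C * wt n ^ k := by
  induction h with
  | base c σ C D k hc hσ =>
    refine ⟨C, k, fun n => ?_⟩
    have : ‖emb N (hermN (σ n))‖ = 1 := (orthonormal_hermN N).1 _
    rw [map_smul, norm_smul, this, mul_one]
    exact hc n
  | @add f g _ _ hf hg =>
    obtain ⟨C, k, hC⟩ := hf
    obtain ⟨D, l, hD⟩ := hg
    refine ⟨|C| + |D|, k + l, fun n => ?_⟩
    have h1 : wt n ^ k ≤ wt n ^ (k + l) := pow_le_pow_right₀ (one_le_wt n) (by omega)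
    have h2 : wt n ^ l ≤ wt n ^ (k + l) := pow_le_pow_right₀ (one_le_wt n) (by omega)
    rw [map_add, add_mul]
    refine (norm_add_le _ _).trans (add_le_add ((hC n).trans ?_) ((hD n).trans ?_))
    · exact mul_le_mul (le_abs_self C) h1 (pow_nonneg (wt_pos n).le _) (abs_nonneg C)
    · exact mul_le_mul (le_abs_self D) h2 (pow_nonneg (wt_pos n).le _) (abs_nonneg D)

theorem tame_hermN (N : ℕ) : Tame fun n : Fin N → ℕ => hermN n := by
  have h := Tame.base (N := N) (fun _ => 1) id 1 0 0 (fun n => by simp) (fun n => by simp)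
  simpa using h

theorem sqrt_le_self_of_one_le {x y : ℝ} (hxy : x ≤ y) (hy : 1 ≤ y) : √x ≤ y := by
  rw [Real.sqrt_le_left (by linarith)]
  nlinarith

/-- A family obtained from a tame one by an operator which is like a ladder operator is tame. -/
theorem Tame.map_of_ladder {N : ℕ} {L : Sch N →L[ℂ] Sch N} {d : (Fin N → ℕ) → ℂ}
    {τ : (Fin N → ℕ) → Fin N → ℕ} (hL : ∀ n, L (hermN n) = d n • hermN (τ n))
    (hd : ∀ n, ‖d n‖ ≤ 2 * wt n) (hτ : ∀ n, wt (τ n) ≤ wt n + 1)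
    {f : (Fin N → ℕ) → Sch N} (h : Tame f) : Tame fun n => L (f n) := by
  induction h with
  | base c σ C D k hc hσ =>
    have e : (fun n => L (c n • hermN (σ n))) = fun n => (c n * d (σ n)) • hermN (τ (σ n)) := by
      funext n
      rw [map_smul, hL, smul_smul]
    rw [e]
    -- The new factor is at most 2 w(σ(n)) ≤ 2(1+|D|) w(n), since w ≥ 1: one more power of the
    -- weight, and the energy shift grows by one.
    refine .base _ (fun n => τ (σ n)) (|C| * (2 * (1 + |D|))) (D + 1) (k + 1) (fun n => ?_)
      (fun n => ?_)
    · rw [norm_mul, pow_succ]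
      have h1 := hc n
      have h2 := hd (σ n)
      have h3 := hσ n
      have h4 := one_le_wt n
      have h5 : C * wt n ^ k ≤ |C| * wt n ^ k :=
        mul_le_mul_of_nonneg_right (le_abs_self C) (pow_nonneg (wt_pos n).le _)
      have h6 : wt (σ n) ≤ (1 + |D|) * wt n := by
        have := le_abs_self D
        nlinarith [abs_nonneg D]
      calc ‖c n‖ * ‖d (σ n)‖ ≤ (|C| * wt n ^ k) * (2 * ((1 + |D|) * wt n)) := by
            refine mul_le_mul (h1.trans h5) (h2.trans (by linarith)) (norm_nonneg _) ?_
            exact mul_nonneg (abs_nonneg _) (pow_nonneg (wt_pos n).le _)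
        _ = _ := by ring
    · linarith [hτ (σ n), hσ n]
  | add _ _ hf hg => simpa only [map_add] using hf.add hg

theorem Tame.raise {N : ℕ} (i : Fin N) {f : (Fin N → ℕ) → Sch N} (h : Tame f) :
    Tame fun n => QDist.raise i (f n) := by
  refine h.map_of_ladder (fun n => raise_hermN n i) (fun n => ?_) (fun n => (wt_add_single n i).le)
  rw [Complex.norm_real, Real.norm_of_nonneg (Real.sqrt_nonneg _)]
  have := coe_le_wt n i
  have := one_le_wt n
  exact sqrt_le_self_of_one_le (by linarith) (by linarith)

theorem Tame.lower {N : ℕ} (i : Fin N) {f : (Fin N → ℕ) → Sch N} (h : Tame f) :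
    Tame fun n => QDist.lower i (f n) := by
  refine h.map_of_ladder (fun n => lower_hermN n i) (fun n => ?_)
    (fun n => (wt_sub_single_le n i).trans (by linarith))
  rw [Complex.norm_real, Real.norm_of_nonneg (Real.sqrt_nonneg _)]
  have := coe_le_wt n i
  have := one_le_wt n
  exact sqrt_le_self_of_one_le (by linarith) (by linarith)

theorem Tame.smul {N : ℕ} (a : ℂ) {f : (Fin N → ℕ) → Sch N} (h : Tame f) :
    Tame fun n => a • f n := by
  induction h with
  | base c σ C D k hc hσ =>
    simp only [smul_smul]
    refine .base _ σ (‖a‖ * C) D k (fun n => ?_) hσ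
    rw [norm_mul, mul_assoc]
    exact mul_le_mul_of_nonneg_left (hc n) (norm_nonneg a)
  | add _ _ hf hg => simpa only [smul_add] using hf.add hg

/-! ### Operators with a polynomially bounded adjoint -/

/-- `Y` is a formal adjoint of `X` on the Schwartz functions. -/
def IsAdj {N : ℕ} (X Y : Sch N →L[ℂ] Sch N) : Prop :=
  ∀ ψ φ : Sch N, inner ℂ (emb N ψ) (emb N (X φ)) = inner ℂ (emb N (Y ψ)) (emb N φ)

/-- `X` has a formal adjoint, and both preserve tame families. -/
def IsNice {N : ℕ} (X : Sch N →L[ℂ] Sch N) : Prop :=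
  (∀ f, Tame f → Tame fun n => X (f n)) ∧
    ∃ Y, IsAdj X Y ∧ ∀ f, Tame f → Tame fun n => Y (f n)

theorem IsNice.one {N : ℕ} : IsNice (1 : Sch N →L[ℂ] Sch N) :=
  ⟨fun _ h => h, 1, fun _ _ => rfl, fun _ h => h⟩

theorem IsNice.mul {N : ℕ} {X Y : Sch N →L[ℂ] Sch N} (hX : IsNice X) (hY : IsNice Y) :
    IsNice (X * Y) := by
  obtain ⟨hX, X', aX, hX'⟩ := hX
  obtain ⟨hY, Y', aY, hY'⟩ := hY
  refine ⟨fun f h => hX _ (hY _ h), Y' * X', fun ψ φ => ?_, fun f h => hY' _ (hX' _ h)⟩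
  rw [mul_apply_eq_comp, aX, aY, mul_apply_eq_comp]

theorem IsNice.add {N : ℕ} {X Y : Sch N →L[ℂ] Sch N} (hX : IsNice X) (hY : IsNice Y) :
    IsNice (X + Y) := by
  obtain ⟨hX, X', aX, hX'⟩ := hX
  obtain ⟨hY, Y', aY, hY'⟩ := hY
  refine ⟨fun f h => (hX _ h).add (hY _ h), X' + Y', fun ψ φ => ?_,
    fun f h => (hX' _ h).add (hY' _ h)⟩
  simp only [add_apply, map_add, inner_add_left, inner_add_right, aX ψ φ, aY ψ φ]

theorem IsNice.smul {N : ℕ} {X : Sch N →L[ℂ] Sch N} (a : ℂ) (hX : IsNice X) :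
    IsNice (a • X) := by
  obtain ⟨hX, X', aX, hX'⟩ := hX
  refine ⟨fun f h => (hX _ h).smul a, (starRingEnd ℂ a) • X', fun ψ φ => ?_,
    fun f h => (hX' _ h).smul _⟩
  simp only [smul_apply, map_smul, inner_smul_left, inner_smul_right, aX ψ φ, Complex.conj_conj]

theorem IsNice.pow {N : ℕ} {X : Sch N →L[ℂ] Sch N} (hX : IsNice X) (k : ℕ) : IsNice (X ^ k) := by
  induction k with
  | zero => exact .one
  | succ k ih => rw [pow_succ]; exact ih.mul hX

theorem IsNice.sum {N : ℕ} {ι : Type*} (s : Finset ι) {X : ι → Sch N →L[ℂ] Sch N}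
    (hX : ∀ i ∈ s, IsNice (X i)) : IsNice (∑ i ∈ s, X i) := by
  classical
  induction s using Finset.induction_on with
  | empty => simpa using IsNice.one.smul (N := N) 0
  | insert i s hi ih =>
    rw [Finset.sum_insert hi]
    exact (hX i (by simp)).add (ih fun j hj => hX j (by simp [hj]))

theorem isNice_opQ {N : ℕ} (i : Fin N) : IsNice (opQ i) := by
  have h (f) (hf : Tame f) : Tame fun n => opQ i (f n) := by
    simpa only [opQ_eq, smul_apply, add_apply] using ((hf.lower i).add (hf.raise i)).smul (1 / 2)
  exact ⟨h, _, isSym_opQ i, h⟩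

theorem isNice_opP {N : ℕ} (i : Fin N) : IsNice (opP i) := by
  have h (f) (hf : Tame f) : Tame fun n => opP i (f n) := by
    have := ((hf.lower i).add ((hf.raise i).smul (-1))).smul (-Complex.I / 2)
    simpa only [opP_eq, smul_apply, sub_apply, neg_smul, one_smul, ← sub_eq_add_neg] using this
  exact ⟨h, _, isSym_opP i, h⟩

theorem IsNice.mprod {N k : ℕ} {x : Fin k → Sch N →L[ℂ] Sch N} (h : ∀ i, IsNice (x i))
    (α : Fin k → ℕ) : IsNice (mprod x α) := by
  induction k with
  | zero => simpa [QDist.mprod] using IsNice.one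
  | succ k ih =>
    rw [mprod_succ]
    exact ((h 0).pow _).mul (ih (fun i => h _) _)

theorem isNice_gen {N : ℕ} (j : Fin N ⊕ Fin N) : IsNice (gen (N := N) j) := by
  rcases j with j | j
  · exact (isNice_opP j).smul _
  · exact (isNice_opQ j).smul _

theorem isNice_hamS (N : ℕ) : IsNice (hamS N) :=
  (IsNice.sum _ fun i _ => ((isNice_opQ i).pow 2).add ((isNice_opP i).pow 2)).smul _

theorem IsNice.exists_norm_le {N : ℕ} {X : Sch N →L[ℂ] Sch N} (h : IsNice X) :
    ∃ (C : ℝ) (k : ℕ), ∀ n, ‖emb N (X (hermN n))‖ ≤ C * wt n ^ k :=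
  (h.1 _ (tame_hermN N)).exists_norm_le

/-! ### Nuclear series -/

/-- The operator `∑ₖ |f_k⟩⟨g_k|`. -/
def nuc {N : ℕ} {κ : Type*} (f g : κ → Hil N) : Hil N →L[ℂ] Hil N :=
  ∑' k, InnerProductSpace.rankOne ℂ (f k) (g k)

theorem hasSum_nuc {N : ℕ} {κ : Type*} {f g : κ → Hil N} (h : Summable fun k => ‖f k‖ * ‖g k‖) :
    HasSum (fun k => InnerProductSpace.rankOne ℂ (f k) (g k)) (nuc f g) :=
  (Summable.of_norm (by simpa using h)).hasSum

theorem hasSum_nuc_apply {N : ℕ} {κ : Type*} {f g : κ → Hil N}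
    (h : Summable fun k => ‖f k‖ * ‖g k‖) (ψ : Hil N) :
    HasSum (fun k => inner ℂ (g k) ψ • f k) (nuc f g ψ) := by
  have := (ContinuousLinearMap.apply ℂ (Hil N) ψ).hasSum (hasSum_nuc h)
  simpa using this

theorem hasSum_inner_nuc {N : ℕ} {κ : Type*} {f g : κ → Hil N}
    (h : Summable fun k => ‖f k‖ * ‖g k‖) (φ ψ : Hil N) :
    HasSum (fun k => inner ℂ φ (f k) * inner ℂ (g k) ψ) (inner ℂ φ (nuc f g ψ)) := by
  have := (innerSL ℂ φ).hasSum (hasSum_nuc_apply h ψ)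
  simpa [mul_comm] using this

theorem comp_nuc {N : ℕ} {κ : Type*} {f g : κ → Hil N} (h : Summable fun k => ‖f k‖ * ‖g k‖)
    (L : Hil N →L[ℂ] Hil N) : L * nuc f g = nuc (fun k => L (f k)) g := by
  ext1 ψ
  have h' : Summable fun k => ‖L (f k)‖ * ‖g k‖ := by
    refine (h.mul_left ‖L‖).of_nonneg_of_le (fun k => by positivity) fun k => ?_
    rw [← mul_assoc]
    gcongr
    exact L.le_opNorm _
  have h1 := L.hasSum (hasSum_nuc_apply h ψ)
  simp only [map_smul] at h1
  exact h1.unique (hasSum_nuc_apply h' ψ)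

theorem nuc_comp {N : ℕ} {κ : Type*} {f g : κ → Hil N} (h : Summable fun k => ‖f k‖ * ‖g k‖)
    {L L' : Hil N →L[ℂ] Hil N} (hL : ∀ φ ψ, inner ℂ (L' φ) ψ = inner ℂ φ (L ψ)) :
    nuc f g * L = nuc f (fun k => L' (g k)) := by
  ext1 ψ
  have h' : Summable fun k => ‖f k‖ * ‖L' (g k)‖ := by
    refine (h.mul_left ‖L'‖).of_nonneg_of_le (fun k => by positivity) fun k => ?_
    rw [mul_left_comm]
    gcongr
    exact L'.le_opNorm _
  have h1 := hasSum_nuc_apply h (L ψ)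
  simp only [← hL] at h1
  exact h1.unique (hasSum_nuc_apply h' ψ)

/-- Cauchy–Schwarz followed by Bessel's inequality for each factor. -/
theorem sum_norm_inner_mul_inner_le {N : ℕ} {ι : Type*} (b : HilbertBasis ι ℂ (Hil N))
    (x y : Hil N) (s : Finset ι) :
    ∑ i ∈ s, ‖inner ℂ (b i) x * inner ℂ y (b i)‖ ≤ ‖x‖ * ‖y‖ := by
  have h (z : Hil N) : √(∑ i ∈ s, ‖inner ℂ (b i) z‖ ^ 2) ≤ ‖z‖ := by
    rw [Real.sqrt_le_left (norm_nonneg z)]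
    exact b.orthonormal.sum_inner_products_le z
  simp only [norm_mul, norm_inner_symm y]
  exact (Real.sum_mul_le_sqrt_mul_sqrt s _ _).trans
    (mul_le_mul (h x) (h y) (Real.sqrt_nonneg _) (norm_nonneg _))

/-- The double family ⟨b_i|f_k⟩⟨g_k|b_i⟩ is absolutely summable. Summing over i first gives
⟨g_k|f_k⟩ by Parseval, so the value does not depend on the basis; summing over k first gives the
diagonal elements. -/
theorem hasTrace_nuc {N : ℕ} {κ : Type*} {f g : κ → Hil N}
    (h : Summable fun k => ‖f k‖ * ‖g k‖) :
    HasTrace (nuc f g) (∑' k, inner ℂ (g k) (f k)) := by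
  intro ι b
  have hs : Summable fun p : κ × ι => inner ℂ (b p.2) (f p.1) * inner ℂ (g p.1) (b p.2) := by
    refine Summable.of_norm ((summable_prod_of_nonneg fun p => norm_nonneg _).2 ⟨fun k => ?_, ?_⟩)
    · exact summable_of_sum_le (fun i => norm_nonneg _)
        (fun s => sum_norm_inner_mul_inner_le b (f k) (g k) s)
    · exact h.of_nonneg_of_le (fun k => tsum_nonneg fun i => norm_nonneg _) fun k =>
        Real.tsum_le_of_sum_le (fun i => norm_nonneg _)
          (fun s => sum_norm_inner_mul_inner_le b (f k) (g k) s)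
  have h1 : ∑' p : κ × ι, inner ℂ (b p.2) (f p.1) * inner ℂ (g p.1) (b p.2) =
      ∑' k, inner ℂ (g k) (f k) := by
    rw [hs.tsum_prod]
    refine tsum_congr fun k => ?_
    simp_rw [mul_comm]
    exact (b.hasSum_inner_mul_inner (g k) (f k)).tsum_eq
  have h2 := ((Equiv.prodComm ι κ).hasSum_iff.2 hs.hasSum).prod_fiberwise
    fun i => hasSum_inner_nuc h (b i) (b i)
  rwa [h1] at h2

/-! ### Summability of powers of the weight -/

theorem summable_prod_pow_inv (N : ℕ) :
    Summable fun n : Fin N → ℕ => ∏ i, (((n i : ℝ) + 1) ^ 2)⁻¹ := by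
  have h1 : Summable fun k : ℕ => (((k : ℝ) + 1) ^ 2)⁻¹ := by
    have := (summable_nat_add_iff 1).2 (Real.summable_nat_pow_inv.2 (one_lt_two))
    simpa using this
  induction N with
  | zero => exact (hasSum_fintype _).summable
  | succ N ih =>
    have h2 := Summable.mul_of_nonneg h1 ih (fun k => by positivity) (fun n => by positivity)
    rw [← (Fin.consEquiv fun _ : Fin (N + 1) => ℕ).summable_iff]
    refine h2.congr fun p => ?_
    simp [Fin.prod_univ_succ, Fin.consEquiv, mul_comm]

/-- The exponent for which the powers of the weight are summable. -/
theorem summable_wt (N : ℕ) : Summable fun n : Fin N → ℕ => (wt n ^ (2 * N))⁻¹ := by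
  refine (summable_prod_pow_inv N).of_nonneg_of_le
    (fun n => inv_nonneg.2 (pow_nonneg (wt_pos n).le _)) fun n => ?_
  rw [Finset.prod_inv_distrib]
  refine inv_anti₀ (Finset.prod_pos fun i _ => by positivity) ?_
  calc ∏ i, ((n i : ℝ) + 1) ^ 2 ≤ ∏ _i : Fin N, wt n ^ 2 := by
        gcongr with i
        exact coe_le_wt n i
    _ = wt n ^ (2 * N) := by simp [pow_mul]

theorem summable_wt_prod (N : ℕ) : Summable fun p : (Fin N → ℕ) × (Fin N → ℕ) =>
    (wt p.1 ^ (2 * N))⁻¹ * (wt p.2 ^ (2 * N))⁻¹ :=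
  Summable.mul_of_nonneg (summable_wt N) (summable_wt N)
    (fun n => inv_nonneg.2 (pow_nonneg (wt_pos n).le _))
    (fun n => inv_nonneg.2 (pow_nonneg (wt_pos n).le _))

/-! ### Normally ordered polynomials in position and momentum -/

/-- The span of the operators `P^β Q^α`. -/
def normalOrd (N : ℕ) : Submodule ℂ (Sch N →L[ℂ] Sch N) :=
  Submodule.span ℂ (Set.range fun p : (Fin N → ℕ) × (Fin N → ℕ) => powP p.2 * powQ p.1)

theorem one_mem_normalOrd (N : ℕ) : (1 : Sch N →L[ℂ] Sch N) ∈ normalOrd N :=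
  Submodule.subset_span ⟨(0, 0), by simp [powP_eq, powQ_eq, mprod_zero]⟩

theorem mul_mem_normalOrd {N : ℕ} {L X : Sch N →L[ℂ] Sch N}
    (h : ∀ α β, L * (powP β * powQ α) ∈ normalOrd N) (hX : X ∈ normalOrd N) :
    L * X ∈ normalOrd N := by
  induction hX using Submodule.span_induction with
  | mem x hx => obtain ⟨p, rfl⟩ := hx; exact h _ _
  | zero => simp
  | add x y _ _ hx hy => rw [mul_add]; exact add_mem hx hy
  | smul a x _ hx => rw [mul_smul_comm]; exact Submodule.smul_mem _ _ hx

theorem opP_mul_mem_normalOrd {N : ℕ} (i : Fin N) {X : Sch N →L[ℂ] Sch N}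
    (hX : X ∈ normalOrd N) : opP i * X ∈ normalOrd N := by
  refine mul_mem_normalOrd (fun α β => ?_) hX
  rw [powP_eq, ← mul_assoc, ← mprod_add_single opP_commute]
  exact Submodule.subset_span ⟨(α, β + Pi.single i 1), rfl⟩

/-- The defining seminorms only see monomials P^β Q^α, so other products must be reordered. Moving
Q_i to the right past P^β costs a multiple of P^{β - e_i}, which is again normally ordered. -/
theorem opQ_mul_mem_normalOrd {N : ℕ} (i : Fin N) {X : Sch N →L[ℂ] Sch N}
    (hX : X ∈ normalOrd N) : opQ i * X ∈ normalOrd N := by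
  refine mul_mem_normalOrd (fun α β => ?_) hX
  rw [powP_eq, powQ_eq, ← mul_assoc, mul_mprod_of_commutator opP_commute (fun k => opQ_mul_opP i k),
    add_mul, mul_assoc, ← mprod_add_single opQ_commute, smul_mul_assoc]
  exact add_mem (Submodule.subset_span ⟨(α + Pi.single i 1, β), rfl⟩)
    (Submodule.smul_mem _ _ (Submodule.subset_span ⟨(α, β - Pi.single i 1), rfl⟩))

theorem gen_mul_mem_normalOrd {N : ℕ} (j : Fin N ⊕ Fin N) {X : Sch N →L[ℂ] Sch N}
    (hX : X ∈ normalOrd N) : gen j * X ∈ normalOrd N := by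
  rcases j with j | j
  · rw [gen, smul_mul_assoc]
    exact Submodule.smul_mem _ _ (opP_mul_mem_normalOrd j hX)
  · rw [gen, smul_mul_assoc]
    exact Submodule.smul_mem _ _ (opQ_mul_mem_normalOrd j hX)

/-- The operator `1 + H` on Schwartz functions. -/
def hamOne (N : ℕ) : Sch N →L[ℂ] Sch N := hamS N + 1

theorem hamS_eq_gen (N : ℕ) : hamS N = (-1 / 2 : ℂ) • ∑ j, gen j * gen j := by
  simp only [hamS, Fintype.sum_sum_type, gen, smul_mul_smul_comm, ← Finset.smul_sum,
    Finset.sum_add_distrib, pow_two]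
  match_scalars <;> norm_num

theorem hamOne_mul_mem_normalOrd {N : ℕ} {X : Sch N →L[ℂ] Sch N}
    (hX : X ∈ normalOrd N) : hamOne N * X ∈ normalOrd N := by
  rw [hamOne, add_mul, one_mul, hamS_eq_gen, smul_mul_assoc, Finset.sum_mul]
  refine add_mem (Submodule.smul_mem _ _ (Submodule.sum_mem _ fun j _ => ?_)) hX
  rw [mul_assoc]
  exact gen_mul_mem_normalOrd j (gen_mul_mem_normalOrd j hX)

theorem hamOne_pow_mem_normalOrd (N k : ℕ) : hamOne N ^ k ∈ normalOrd N := by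
  induction k with
  | zero => exact one_mem_normalOrd N
  | succ k ih => rw [pow_succ']; exact hamOne_mul_mem_normalOrd ih

theorem hamOne_hermN {N : ℕ} (n : Fin N → ℕ) : hamOne N (hermN n) = (wt n : ℂ) • hermN n := by
  rw [hamOne, add_apply, hamS_hermN, wt]
  push_cast
  rw [add_smul, one_smul]
  rfl

theorem hamOne_pow_hermN {N : ℕ} (k : ℕ) (n : Fin N → ℕ) :
    (hamOne N ^ k) (hermN n) = ((wt n : ℂ) ^ k) • hermN n := by
  induction k with
  | zero => simp
  | succ k ih => rw [pow_succ', mul_apply_eq_comp, ih, map_smul, hamOne_hermN, smul_smul, pow_succ]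

/-! ### Seminorms of Schwartz operators -/

theorem withSeminorms_op (N : ℕ) : WithSeminorms (opSeminormFamily N) := ⟨rfl⟩

instance (N : ℕ) : IsTopologicalAddGroup (SchwartzOp N) := (withSeminorms_op N).topologicalAddGroup

/-- Homogeneity removes the normalization of ψ and φ in the supremum; this needs `emb` to be
injective. -/
theorem norm_sform_le {N : ℕ} (k : Idx4 N) (T : SchwartzOp N) (ψ φ : Sch N) :
    ‖sform k T.op ψ φ‖ ≤ opSeminorm k T * (‖emb N ψ‖ * ‖emb N φ‖) := by
  by_cases hψ : ψ = 0
  · simp [hψ, sform]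
  by_cases hφ : φ = 0
  · simp [hφ, sform]
  have h1 : 0 < ‖emb N ψ‖ := norm_pos_iff.2 ((map_ne_zero_iff _ (emb_injective N)).2 hψ)
  have h2 : 0 < ‖emb N φ‖ := norm_pos_iff.2 ((map_ne_zero_iff _ (emb_injective N)).2 hφ)
  have h := le_csSup (T.bddAbove k) ⟨((‖emb N ψ‖⁻¹ : ℝ) : ℂ) • ψ, ((‖emb N φ‖⁻¹ : ℝ) : ℂ) • φ,
    by simp [norm_smul, h1.ne'], by simp [norm_smul, h2.ne'], rfl⟩
  have e : ‖sform k T.op (((‖emb N ψ‖⁻¹ : ℝ) : ℂ) • ψ) (((‖emb N φ‖⁻¹ : ℝ) : ℂ) • φ)‖ =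
      ‖emb N ψ‖⁻¹ * (‖emb N φ‖⁻¹ * ‖sform k T.op ψ φ‖) := by
    simp [sform, inner_smul_left, inner_smul_right]
    ring
  rw [e] at h
  change _ ≤ opSeminorm k T at h
  rw [inv_mul_le_iff₀ h1, inv_mul_le_iff₀ h2] at h
  linarith

/-- Every form `⟨X ψ | T Y φ⟩` with normally ordered polynomials `X`, `Y` is bounded by a continuous
seminorm of the Schwartz operator `T`. -/
theorem exists_form_bound {N : ℕ} {X Y : Sch N →L[ℂ] Sch N} (hX : X ∈ normalOrd N)
    (hY : Y ∈ normalOrd N) : ∃ q : Seminorm ℂ (SchwartzOp N), Continuous q ∧ ∀ T ψ φ,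
      ‖inner ℂ (emb N (X ψ)) (T.op (emb N (Y φ)))‖ ≤ q T * (‖emb N ψ‖ * ‖emb N φ‖) := by
  induction hX using Submodule.span_induction with
  | mem x hx =>
    obtain ⟨⟨α, β⟩, rfl⟩ := hx
    induction hY using Submodule.span_induction with
    | mem y hy =>
      obtain ⟨⟨α', β'⟩, rfl⟩ := hy
      exact ⟨opSeminorm (α, β, α', β'), (withSeminorms_op N).continuous_seminorm _,
        fun T ψ φ => norm_sform_le (α, β, α', β') T ψ φ⟩
    | zero => exact ⟨0, continuous_zero, fun T ψ φ => by simp⟩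
    | add x y _ _ hx hy =>
      obtain ⟨q, hq, hx⟩ := hx
      obtain ⟨r, hr, hy⟩ := hy
      refine ⟨q + r, hq.add hr, fun T ψ φ => ?_⟩
      rw [add_apply, map_add, map_add, inner_add_right, add_apply, add_mul]
      exact (norm_add_le _ _).trans (add_le_add (hx T ψ φ) (hy T ψ φ))
    | smul a x _ hx =>
      obtain ⟨q, hq, hx⟩ := hx
      refine ⟨‖a‖₊ • q, hq.const_smul _, fun T ψ φ => ?_⟩
      rw [smul_apply, map_smul, map_smul, inner_smul_right, norm_mul, smul_apply,
        NNReal.smul_def, smul_eq_mul, mul_assoc]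
      exact mul_le_mul_of_nonneg_left (hx T ψ φ) (norm_nonneg a)
  | zero => exact ⟨0, continuous_zero, fun T ψ φ => by simp⟩
  | add x y _ _ hx hy =>
    obtain ⟨q, hq, hx⟩ := hx
    obtain ⟨r, hr, hy⟩ := hy
    refine ⟨q + r, hq.add hr, fun T ψ φ => ?_⟩
    rw [add_apply, map_add, inner_add_left, add_apply, add_mul]
    exact (norm_add_le _ _).trans (add_le_add (hx T ψ φ) (hy T ψ φ))
  | smul a x _ hx =>
    obtain ⟨q, hq, hx⟩ := hx
    refine ⟨‖a‖₊ • q, hq.const_smul _, fun T ψ φ => ?_⟩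
    rw [smul_apply, map_smul, inner_smul_left, norm_mul, smul_apply,
      NNReal.smul_def, smul_eq_mul, mul_assoc, RCLike.norm_conj]
    exact mul_le_mul_of_nonneg_left (hx T ψ φ) (norm_nonneg a)

/-- The matrix elements of a Schwartz operator in the Hermite basis. -/
def mat {N : ℕ} (T : SchwartzOp N) (n m : Fin N → ℕ) : ℂ :=
  inner ℂ (emb N (hermN n)) (T.op (emb N (hermN m)))

theorem norm_emb_hermN {N : ℕ} (n : Fin N → ℕ) : ‖emb N (hermN n)‖ = 1 :=
  (orthonormal_hermN N).1 n

theorem mat_add {N : ℕ} (S T : SchwartzOp N) (n m : Fin N → ℕ) :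
    mat (S + T) n m = mat S n m + mat T n m := by
  simp [mat, inner_add_right]

theorem mat_smul {N : ℕ} (c : ℂ) (T : SchwartzOp N) (n m : Fin N → ℕ) :
    mat (c • T) n m = c * mat T n m := by
  simp [mat, inner_smul_right]

/-- The matrix elements of Schwartz operators decay rapidly. -/
theorem exists_mat_bound (N k : ℕ) : ∃ q : Seminorm ℂ (SchwartzOp N), Continuous q ∧
    ∀ T n m, ‖mat T n m‖ ≤ q T * ((wt n ^ k)⁻¹ * (wt m ^ k)⁻¹) := by
  -- Applying (1+H)^k to h_n multiplies it by w(n)^k, so the form with (1+H)^k on both sides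
  -- controls w(n)^k w(m)^k |T_{nm}|.
  obtain ⟨q, hq, h⟩ := exists_form_bound (hamOne_pow_mem_normalOrd N k)
    (hamOne_pow_mem_normalOrd N k)
  refine ⟨q, hq, fun T n m => ?_⟩
  have h1 := h T (hermN n) (hermN m)
  have hn := pow_pos (wt_pos n) k
  have hm := pow_pos (wt_pos m) k
  simp only [hamOne_pow_hermN, map_smul, inner_smul_left, inner_smul_right, norm_mul,
    norm_emb_hermN, mul_one, RCLike.norm_conj, norm_pow, Complex.norm_real,
    Real.norm_of_nonneg (wt_pos _).le] at h1
  rw [← mul_assoc, ← div_eq_mul_inv, ← div_eq_mul_inv, le_div_iff₀ hm, le_div_iff₀ hn]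
  rw [mat]
  linarith

/-! ### Expansion of Schwartz operators in the Hermite basis -/

/-- The function `F` of multi-indices is bounded by a power of the weight. -/
def PolyBdd {N : ℕ} (F : (Fin N → ℕ) → ℝ) : Prop :=
  ∃ (C : ℝ) (k : ℕ), 0 ≤ C ∧ ∀ n, F n ≤ C * wt n ^ k

theorem polyBdd_one (N : ℕ) : PolyBdd fun _ : Fin N → ℕ => 1 :=
  ⟨1, 0, zero_le_one, fun n => by simp⟩

theorem IsNice.polyBdd {N : ℕ} {X : Sch N →L[ℂ] Sch N} (h : IsNice X) :
    PolyBdd fun n => ‖emb N (X (hermN n))‖ := by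
  obtain ⟨C, k, hC⟩ := h.exists_norm_le
  refine ⟨|C|, k, abs_nonneg C, fun n => (hC n).trans ?_⟩
  exact mul_le_mul_of_nonneg_right (le_abs_self C) (pow_nonneg (wt_pos n).le _)

theorem PolyBdd.exists_mat_bound {N : ℕ} {F G : (Fin N → ℕ) → ℝ} (hF : PolyBdd F)
    (hG : PolyBdd G) (hG0 : ∀ n, 0 ≤ G n) (l : ℕ) :
    ∃ q : Seminorm ℂ (SchwartzOp N), Continuous q ∧
    ∀ T n m, ‖mat T n m‖ * (F n * G m) ≤ q T * ((wt n ^ l)⁻¹ * (wt m ^ l)⁻¹) := by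
  obtain ⟨C, k, hC0, hC⟩ := hF
  obtain ⟨D, k', hD0, hD⟩ := hG
  -- The exponent k + k' + l pays for the growth of F or of G and leaves l powers of each weight.
  obtain ⟨q, hq, h⟩ := QDist.exists_mat_bound N (k + k' + l)
  refine ⟨(C * D).toNNReal • q, hq.const_smul _, fun T n m => ?_⟩
  have hn := wt_pos n
  have hm := wt_pos m
  rw [smul_apply, NNReal.smul_def, smul_eq_mul, Real.coe_toNNReal _ (by positivity)]
  have h0 : 0 ≤ q T := apply_nonneg q T
  have h1 : (wt n ^ (k + k' + l))⁻¹ ≤ (wt n ^ k)⁻¹ * (wt n ^ l)⁻¹ := by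
    rw [← mul_inv, ← pow_add]
    exact inv_anti₀ (by positivity) (pow_le_pow_right₀ (one_le_wt n) (by omega))
  have h2 : (wt m ^ (k + k' + l))⁻¹ ≤ (wt m ^ k')⁻¹ * (wt m ^ l)⁻¹ := by
    rw [← mul_inv, ← pow_add]
    exact inv_anti₀ (by positivity) (pow_le_pow_right₀ (one_le_wt m) (by omega))
  calc ‖mat T n m‖ * (F n * G m)
      ≤ (q T * ((wt n ^ (k + k' + l))⁻¹ * (wt m ^ (k + k' + l))⁻¹)) *
        ((C * wt n ^ k) * (D * wt m ^ k')) := by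
        refine mul_le_mul_of_nonneg (h T n m)
          (mul_le_mul (hC n) (hD m) (hG0 m) (by positivity)) (norm_nonneg _) (by positivity)
    _ ≤ (q T * (((wt n ^ k)⁻¹ * (wt n ^ l)⁻¹) * ((wt m ^ k')⁻¹ * (wt m ^ l)⁻¹))) *
        ((C * wt n ^ k) * (D * wt m ^ k')) := by gcongr
    _ = _ := by field_simp

theorem PolyBdd.summable_mat {N : ℕ} {F G : (Fin N → ℕ) → ℝ} (hF : PolyBdd F)
    (hG : PolyBdd G) (hF0 : ∀ n, 0 ≤ F n) (hG0 : ∀ n, 0 ≤ G n) (T : SchwartzOp N) :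
    Summable fun p : (Fin N → ℕ) × (Fin N → ℕ) => ‖mat T p.1 p.2‖ * (F p.1 * G p.2) := by
  obtain ⟨q, -, h⟩ := hF.exists_mat_bound hG hG0 (2 * N)
  exact ((summable_wt_prod N).mul_left (q T)).of_nonneg_of_le
    (fun p => mul_nonneg (norm_nonneg _) (mul_nonneg (hF0 _) (hG0 _))) fun p => h T p.1 p.2

theorem summable_nuc_mat {N : ℕ} {X Y : Sch N →L[ℂ] Sch N} (hX : IsNice X) (hY : IsNice Y)
    (T : SchwartzOp N) : Summable fun p : (Fin N → ℕ) × (Fin N → ℕ) =>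
      ‖mat T p.1 p.2 • emb N (X (hermN p.1))‖ * ‖emb N (Y (hermN p.2))‖ := by
  simpa only [norm_smul, mul_assoc] using
    hX.polyBdd.summable_mat hY.polyBdd (fun n => norm_nonneg _) (fun n => norm_nonneg _) T

/-- The operator `∑ T_{nm} |X h_n⟩⟨Y h_m|`, which extends `X T Y*`. -/
def sandwich {N : ℕ} (X Y : Sch N →L[ℂ] Sch N) (T : SchwartzOp N) : Hil N →L[ℂ] Hil N :=
  nuc (fun p : (Fin N → ℕ) × (Fin N → ℕ) => mat T p.1 p.2 • emb N (X (hermN p.1)))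
    (fun p => emb N (Y (hermN p.2)))

/-- Both sides are bounded and have the same matrix in the Hermite basis. Thus every Schwartz
operator is nuclear, and statements about it reduce to absolutely convergent series. -/
theorem op_eq_sandwich {N : ℕ} (T : SchwartzOp N) : T.op = sandwich 1 1 T := by
  have hb (n : Fin N → ℕ) : emb N (hermN n) = hermBasis N n := (hermBasis_apply n).symm
  have hd : Dense ((Submodule.span ℂ (Set.range (hermBasis N))) : Set (Hil N)) := by
    rw [Submodule.dense_iff_topologicalClosure_eq_top]
    exact (hermBasis N).dense_span
  refine ContinuousLinearMap.ext_on (s := Set.range (hermBasis N)) hd ?_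
  rintro _ ⟨m, rfl⟩
  refine (hermBasis N).repr.injective (lp.ext (funext fun n => ?_))
  rw [HilbertBasis.repr_apply_apply, HilbertBasis.repr_apply_apply]
  have h := hasSum_inner_nuc (summable_nuc_mat .one .one T) (hermBasis N n) (hermBasis N m)
  refine HasSum.unique ?_ h
  have hon := (orthonormal_iff_ite.1 (hermBasis N).orthonormal)
  have e : (fun p : (Fin N → ℕ) × (Fin N → ℕ) =>
      inner ℂ (hermBasis N n) (mat T p.1 p.2 • emb N ((1 : Sch N →L[ℂ] Sch N) (hermN p.1))) *
      inner ℂ (emb N ((1 : Sch N →L[ℂ] Sch N) (hermN p.2))) (hermBasis N m)) =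
      fun p => if p = (n, m) then mat T n m else 0 := by
    funext p
    simp only [one_apply_eq_self, hb, inner_smul_right, hon]
    by_cases h1 : n = p.1 <;> by_cases h2 : p.2 = m
    · subst h1; subst h2; simp
    all_goals
      simp [h1, h2, Prod.ext_iff, eq_comm (a := p.1)]
  rw [e]
  have := hasSum_ite_eq (n, m) (mat T n m)
  convert this using 1
  rw [mat, hb, hb]

theorem IsAdj.symm {N : ℕ} {X Y : Sch N →L[ℂ] Sch N} (h : IsAdj X Y) : IsAdj Y X := by
  intro ψ φ
  rw [← inner_conj_symm, ← h, inner_conj_symm]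

/-- The forms of `X T Y*`. -/
theorem inner_sandwich {N : ℕ} {X Y X' Y' : Sch N →L[ℂ] Sch N} (hX : IsNice X) (hY : IsNice Y)
    (aX : IsAdj X X') (aY : IsAdj Y Y') (T : SchwartzOp N) (ψ φ : Sch N) :
    inner ℂ (emb N ψ) (sandwich X Y T (emb N φ)) =
      inner ℂ (emb N (X' ψ)) (T.op (emb N (Y' φ))) := by
  have h1 := hasSum_inner_nuc (summable_nuc_mat hX hY T) (emb N ψ) (emb N φ)
  have h2 := hasSum_inner_nuc (summable_nuc_mat .one .one T) (emb N (X' ψ)) (emb N (Y' φ))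
  rw [op_eq_sandwich]
  refine h1.unique (h2.congr_fun fun p => ?_)
  simp only [inner_smul_right, one_apply_eq_self, aX ψ, aY.symm (hermN p.2) φ]

/-! ### Construction of Schwartz operators -/

theorem IsNice.of_mem_normalOrd {N : ℕ} {X : Sch N →L[ℂ] Sch N} (hX : X ∈ normalOrd N) :
    IsNice X := by
  induction hX using Submodule.span_induction with
  | mem x hx => obtain ⟨p, rfl⟩ := hx; exact (IsNice.mprod isNice_opP _).mul (.mprod isNice_opQ _)
  | zero => simpa using IsNice.one.smul (N := N) 0
  | add x y _ _ hx hy => exact hx.add hy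
  | smul a x _ hx => exact hx.smul a

theorem mem_schwartzOps_of_forms {N : ℕ} {S : Hil N →L[ℂ] Hil N}
    (h : ∀ X ∈ normalOrd N, ∀ Y ∈ normalOrd N, ∃ C : ℝ, ∀ ψ φ,
      ‖inner ℂ (emb N (X ψ)) (S (emb N (Y φ)))‖ ≤ C * (‖emb N ψ‖ * ‖emb N φ‖)) :
    S ∈ schwartzOps N := by
  intro k
  obtain ⟨C, hC⟩ := h _ (Submodule.subset_span ⟨(k.1, k.2.1), rfl⟩) _
    (Submodule.subset_span ⟨(k.2.2.1, k.2.2.2), rfl⟩)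
  refine ⟨|C|, ?_⟩
  rintro r ⟨ψ, φ, hψ, hφ, rfl⟩
  refine (hC ψ φ).trans ?_
  calc C * (‖emb N ψ‖ * ‖emb N φ‖) ≤ |C| * (1 * 1) := by
        refine mul_le_mul (le_abs_self C) ?_ (by positivity) (abs_nonneg C)
        exact mul_le_mul hψ hφ (norm_nonneg _) zero_le_one
    _ = |C| := by ring

theorem opSeminorm_le {N : ℕ} (k : Idx4 N) (T : SchwartzOp N) {C : ℝ} (hC : 0 ≤ C)
    (h : ∀ ψ φ, ‖sform k T.op ψ φ‖ ≤ C * (‖emb N ψ‖ * ‖emb N φ‖)) : opSeminorm k T ≤ C := by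
  refine csSup_le (formValues_nonempty k _) ?_
  rintro r ⟨ψ, φ, hψ, hφ, rfl⟩
  refine (h ψ φ).trans ?_
  calc C * (‖emb N ψ‖ * ‖emb N φ‖) ≤ C * (1 * 1) := by gcongr
    _ = C := by ring

theorem denseRange_emb (N : ℕ) : DenseRange (emb N) := denseRange_toLpCLM (by norm_num)

theorem SchwartzOp.ext_forms {N : ℕ} {S T : SchwartzOp N}
    (h : ∀ ψ φ, inner ℂ (emb N ψ) (S.op (emb N φ)) = inner ℂ (emb N ψ) (T.op (emb N φ))) :
    S = T := by
  refine Subtype.ext (ContinuousLinearMap.ext fun x => ?_)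
  change S.op x = T.op x
  refine congrFun ((denseRange_emb N).equalizer S.op.continuous T.op.continuous
    (funext fun φ => ?_)) x
  refine ext_inner_left ℂ fun y => ?_
  exact congrFun ((denseRange_emb N).equalizer (g := fun y => inner ℂ y (S.op (emb N φ)))
    (h := fun y => inner ℂ y (T.op (emb N φ))) (by fun_prop) (by fun_prop)
    (funext fun ψ => h ψ φ)) y

/-! ### Derivations of Schwartz operators -/

theorem isAdj_gen {N : ℕ} (j : Fin N ⊕ Fin N) : IsAdj (gen (N := N) j) (-gen j) := by
  intro ψ φ
  rcases j with j | j
  · simp only [gen, smul_apply, neg_apply, map_smul, map_neg, inner_smul_right, inner_neg_left,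
      inner_smul_left, isSym_opP j ψ φ]
    simp
  · simp only [gen, smul_apply, neg_apply, map_smul, map_neg, inner_smul_right, inner_neg_left,
      inner_smul_left, isSym_opQ j ψ φ]
    simp

/-- The bounded extension of `T K_j - K_j T`. -/
def derivOp {N : ℕ} (j : Fin N ⊕ Fin N) (T : SchwartzOp N) : Hil N →L[ℂ] Hil N :=
  -(sandwich (gen j) 1 T + sandwich 1 (gen j) T)

theorem isAdj_one (N : ℕ) : IsAdj (1 : Sch N →L[ℂ] Sch N) 1 := fun _ _ => rfl

/-- The generators are antisymmetric, so moving one to the left vector changes the sign and both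
terms appear with a plus. -/
theorem inner_derivOp {N : ℕ} (j : Fin N ⊕ Fin N) (T : SchwartzOp N) (ψ φ : Sch N) :
    inner ℂ (emb N ψ) (derivOp j T (emb N φ)) =
      inner ℂ (emb N (gen j ψ)) (T.op (emb N φ)) +
      inner ℂ (emb N ψ) (T.op (emb N (gen j φ))) := by
  simp only [derivOp, neg_apply, add_apply, inner_neg_right, inner_add_right,
    inner_sandwich (isNice_gen j) .one (isAdj_gen j) (isAdj_one N),
    inner_sandwich .one (isNice_gen j) (isAdj_one N) (isAdj_gen j), one_apply_eq_self, map_neg,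
    inner_neg_left]
  ring

/-- The extra generator is absorbed into X or Y, which stay normally ordered. This yields both that
the derivative is a Schwartz operator and that differentiation is continuous. -/
theorem exists_derivOp_bound {N : ℕ} (j : Fin N ⊕ Fin N) {X Y : Sch N →L[ℂ] Sch N}
    (hX : X ∈ normalOrd N) (hY : Y ∈ normalOrd N) :
    ∃ q : Seminorm ℂ (SchwartzOp N), Continuous q ∧ ∀ T ψ φ,
      ‖inner ℂ (emb N (X ψ)) (derivOp j T (emb N (Y φ)))‖ ≤ q T * (‖emb N ψ‖ * ‖emb N φ‖) := by
  obtain ⟨q, hq, h1⟩ := exists_form_bound (gen_mul_mem_normalOrd j hX) hY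
  obtain ⟨r, hr, h2⟩ := exists_form_bound hX (gen_mul_mem_normalOrd j hY)
  refine ⟨q + r, hq.add hr, fun T ψ φ => ?_⟩
  rw [inner_derivOp, add_apply, add_mul]
  exact (norm_add_le _ _).trans (add_le_add (h1 T ψ φ) (h2 T ψ φ))

/-- A bounded operator in `schwartzOps N` as a Schwartz operator. -/
def SchwartzOp.ofMem {N : ℕ} {S : Hil N →L[ℂ] Hil N} (h : S ∈ schwartzOps N) : SchwartzOp N := ⟨S, h⟩

theorem SchwartzOp.ofMem_op {N : ℕ} {S : Hil N →L[ℂ] Hil N} (h : S ∈ schwartzOps N) :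
    (ofMem h).op = S := rfl

theorem derivOp_mem {N : ℕ} (j : Fin N ⊕ Fin N) (T : SchwartzOp N) : derivOp j T ∈ schwartzOps N :=
  mem_schwartzOps_of_forms fun _ hX _ hY =>
    let ⟨q, _, h⟩ := exists_derivOp_bound j hX hY
    ⟨q T, h T⟩

/-- The derivation `T ↦ T K_j - K_j T` of the Schwartz operators. -/
def opDLin {N : ℕ} (j : Fin N ⊕ Fin N) : SchwartzOp N →ₗ[ℂ] SchwartzOp N where
  toFun T := .ofMem (derivOp_mem j T)
  map_add' S T := by
    refine SchwartzOp.ext_forms fun ψ φ => ?_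
    simp only [map_add, SchwartzOp.ofMem_op, inner_derivOp, add_apply, inner_add_right]
    ring
  map_smul' c T := by
    refine SchwartzOp.ext_forms fun ψ φ => ?_
    simp only [map_smul, SchwartzOp.ofMem_op, inner_derivOp, smul_apply, inner_smul_right,
      RingHom.id_apply]
    ring

/-- The derivation `T ↦ T K_j - K_j T` as a continuous linear map. -/
def opD {N : ℕ} (j : Fin N ⊕ Fin N) : SchwartzOp N →L[ℂ] SchwartzOp N where
  toLinearMap := opDLin j
  cont := by
    refine WithSeminorms.continuous_of_continuous_comp (withSeminorms_op N) _ fun k => ?_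
    obtain ⟨q, hq, h⟩ := exists_derivOp_bound (N := N) j
      (Submodule.subset_span ⟨(k.1, k.2.1), rfl⟩) (Submodule.subset_span ⟨(k.2.2.1, k.2.2.2), rfl⟩)
    refine Seminorm.continuous_of_le hq fun T => ?_
    exact opSeminorm_le k _ (apply_nonneg q T) (h T)

theorem opD_op {N : ℕ} (j : Fin N ⊕ Fin N) (T : SchwartzOp N) : (opD j T).op = derivOp j T := rfl

theorem inner_opD {N : ℕ} (j : Fin N ⊕ Fin N) (T : SchwartzOp N) (ψ φ : Sch N) :
    inner ℂ (emb N ψ) ((opD j T).op (emb N φ)) =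
      inner ℂ (emb N (gen j ψ)) (T.op (emb N φ)) +
      inner ℂ (emb N ψ) (T.op (emb N (gen j φ))) :=
  inner_derivOp j T ψ φ

/-- The commutator of the derivations is the derivation given by the commutator of the generators, a
scalar ic. Conjugate linearity in the left slot makes its two contributions cancel. -/
theorem opD_commute {N : ℕ} (i j : Fin N ⊕ Fin N) : Commute (opD (N := N) i) (opD j) := by
  refine ContinuousLinearMap.ext fun T => SchwartzOp.ext_forms fun ψ φ => ?_
  obtain ⟨c, hc⟩ := gen_commutator (N := N) i j
  have h (χ : Sch N) : gen i (gen j χ) = gen j (gen i χ) + (c * Complex.I) • χ := by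
    simpa [Algebra.algebraMap_eq_smul_one] using congrArg (fun L => L χ) hc
  simp only [mul_apply_eq_comp, inner_opD, h, map_add, map_smul, inner_add_left, inner_add_right,
    inner_smul_left, inner_smul_right, map_mul, Complex.conj_ofReal, Complex.conj_I]
  ring

/-- The derivation `D^α` of the Schwartz operators. -/
def opDPow {N : ℕ} (α : MIdx N) : SchwartzOp N →L[ℂ] SchwartzOp N :=
  mprod (fun i => opD (.inl i)) (fun i => α (.inl i)) *
    mprod (fun i => opD (.inr i)) (fun i => α (.inr i))

theorem opDPow_zero (N : ℕ) : opDPow (0 : MIdx N) = 1 := by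
  have h1 : (fun i => (0 : MIdx N) (.inl i)) = 0 := rfl
  have h2 : (fun i => (0 : MIdx N) (.inr i)) = 0 := rfl
  rw [opDPow, h1, h2, mprod_zero, mprod_zero, one_mul]

theorem opDPow_add_single {N : ℕ} (α : MIdx N) (j : Fin N ⊕ Fin N) :
    opDPow (α + Pi.single j 1) = opD j * opDPow α := by
  rcases j with j | j
  · have h1 : (fun i => (α + Pi.single (.inl j) 1 : MIdx N) (.inl i)) =
        (fun i => α (.inl i)) + Pi.single j 1 := by
      funext i
      by_cases h : i = j
      · subst h; simp
      · simp [h]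
    have h2 : (fun i => (α + Pi.single (.inl j) 1 : MIdx N) (.inr i)) = fun i => α (.inr i) := by
      funext i; simp
    rw [opDPow, h1, h2, mprod_add_single fun _ _ => opD_commute _ _, mul_assoc, opDPow]
  · have h1 : (fun i => (α + Pi.single (.inr j) 1 : MIdx N) (.inr i)) =
        (fun i => α (.inr i)) + Pi.single j 1 := by
      funext i
      by_cases h : i = j
      · subst h; simp
      · simp [h]
    have h2 : (fun i => (α + Pi.single (.inr j) 1 : MIdx N) (.inl i)) = fun i => α (.inl i) := by
      funext i; simp
    -- A momentum direction has to pass through the whole block of position directions.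
    rw [opDPow, h1, h2, mprod_add_single fun _ _ => opD_commute _ _, ← mul_assoc, opDPow,
      ← mul_assoc, (commute_mprod (fun i => opD_commute (.inr j) (.inl i)) _).eq]

/-! ### Weyl operators on Schwartz functions -/

/-- The coordinates of phase space. -/
def coord {N : ℕ} : Fin N ⊕ Fin N → (Phase N →L[ℝ] ℝ)
  | .inl i => EuclideanSpace.proj (𝕜 := ℝ) i ∘L ContinuousLinearMap.fst ℝ (Conf N) (Conf N)
  | .inr i => EuclideanSpace.proj (𝕜 := ℝ) i ∘L ContinuousLinearMap.snd ℝ (Conf N) (Conf N)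

theorem coord_inl {N : ℕ} (i : Fin N) (v : Phase N) : coord (.inl i) v = v.1 i := rfl

theorem coord_inr {N : ℕ} (i : Fin N) (v : Phase N) : coord (.inr i) v = v.2 i := rfl

theorem abs_coord_le {N : ℕ} (j : Fin N ⊕ Fin N) (v : Phase N) : |coord j v| ≤ ‖v‖ := by
  rcases j with j | j
  · exact (PiLp.norm_apply_le v.1 j).trans (norm_fst_le v)
  · exact (PiLp.norm_apply_le v.2 j).trans (norm_snd_le v)

/-- The generator `i (p·Q - q·P)` of the Weyl operators in the direction `(q, p)`. -/
def genDir {N : ℕ} (v : Phase N) : Sch N →L[ℂ] Sch N := ∑ j, (coord j v : ℂ) • gen j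

theorem genDir_smul {N : ℕ} (s : ℝ) (v : Phase N) : genDir (s • v) = (s : ℂ) • genDir v := by
  simp only [genDir, map_smul, smul_eq_mul, Complex.ofReal_mul, Finset.smul_sum, smul_smul]

theorem genDir_apply {N : ℕ} (v : Phase N) (χ : Sch N) (x : Conf N) :
    genDir v χ x = -fderiv ℝ χ x v.1 + (inner ℝ v.2 x : ℝ) * Complex.I * χ x := by
  have h1 : v.1 = ∑ i, v.1 i • EuclideanSpace.single i (1 : ℝ) := by
    ext k
    simp [Finset.sum_apply, Pi.single_apply]
  have h2 : fderiv ℝ χ x v.1 = ∑ i, (v.1 i : ℂ) * fderiv ℝ χ x (EuclideanSpace.single i 1) := by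
    conv_lhs => rw [h1]
    simp
  rw [h2]
  simp only [genDir, Fintype.sum_sum_type, add_apply, sum_apply, smul_apply, gen, opP_apply,
    opQ_apply, coord_inl, coord_inr, PiLp.inner_apply, ← lineDerivOp_apply, lineDerivOp_apply_eq_fderiv]
  rw [← Finset.sum_neg_distrib]
  push_cast
  rw [Finset.sum_mul, Finset.sum_mul]
  refine congrArg₂ (· + ·) (Finset.sum_congr rfl fun i _ => ?_) (Finset.sum_congr rfl fun i _ => ?_)
  · simp only [smul_eq_mul]
    linear_combination ((v.1 i : ℂ) * fderiv ℝ χ x (EuclideanSpace.single i 1)) * Complex.I_mul_I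
  · simp
    ring

/-- The flow equation d/ds W(sv) χ = W(sv) K_v χ, pointwise in t. The quadratic phase s² q·p/2
supplies the term by which multiplication by p·t differs from multiplication by p·(t - sq). -/
theorem hasDerivAt_weylFun {N : ℕ} (v : Phase N) (χ : Sch N) (t : Conf N) (s : ℝ) :
    HasDerivAt (fun s : ℝ => weylFun (s • v) χ t) (weylFun (s • v) (genDir v χ) t) s := by
  have h1 : HasDerivAt (fun s : ℝ => t - s • v.1) (-v.1) s := by
    simpa using ((hasDerivAt_id s).smul_const v.1).const_sub t
  have h2 : HasDerivAt (fun s : ℝ => χ (t - s • v.1)) (fderiv ℝ χ (t - s • v.1) (-v.1)) s :=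
    (χ.hasFDerivAt _).comp_hasDerivAt s h1
  have h0 : HasDerivAt (fun s : ℝ => -(s ^ 2 * inner ℝ v.1 v.2 / 2) + s * inner ℝ v.2 t)
      (-(s * inner ℝ v.1 v.2) + inner ℝ v.2 t) s := by
    have := ((((hasDerivAt_pow 2 s).mul_const (inner ℝ v.1 v.2)).div_const 2).neg).add
      ((hasDerivAt_id s).mul_const (inner ℝ v.2 t))
    convert! this using 1
    simp
    ring
  have h3 := (h0.ofReal_comp.mul_const Complex.I).cexp
  have e (f : Conf N → ℂ) (s : ℝ) : weylFun (s • v) f t = Complex.exp (((-(s ^ 2 * inner ℝ v.1 v.2 / 2) +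
      s * inner ℝ v.2 t : ℝ) : ℂ) * Complex.I) * f (t - s • v.1) := by
    simp only [weylFun, Prod.smul_fst, Prod.smul_snd, inner_smul_left, inner_smul_right,
      ← Complex.exp_add, ← add_mul, ← Complex.ofReal_add]
    congr 5
    simp
    ring
  simp only [e]
  convert! h3.mul h2 using 1
  rw [genDir_apply, inner_sub_right, inner_smul_right, real_inner_comm v.1 v.2, map_neg]
  push_cast
  ring

theorem coeFn_emb {N : ℕ} (χ : Sch N) : (emb N χ : Conf N → ℂ) =ᵐ[volume] χ :=
  χ.coeFn_toLp 2 volume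

theorem weylFun_congr_ae {N : ℕ} (v : Phase N) {f g : Conf N → ℂ} (h : f =ᵐ[volume] g) :
    weylFun v f =ᵐ[volume] weylFun v g := by
  filter_upwards [(measurePreserving_sub_right volume v.1).quasiMeasurePreserving.ae h] with t ht
  rw [weylFun, weylFun, ht]

theorem coeFn_weyl {N : ℕ} (v : Phase N) (f : Hil N) :
    (weyl v f : Conf N → ℂ) =ᵐ[volume] weylFun v f :=
  (memLp_weylFun v f).coeFn_toLp

theorem coeFn_weyl_emb {N : ℕ} (v : Phase N) (χ : Sch N) :
    (weyl v (emb N χ) : Conf N → ℂ) =ᵐ[volume] weylFun v χ :=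
  (coeFn_weyl v _).trans (weylFun_congr_ae v (coeFn_emb χ))

/-- If the derivatives of `s ↦ u(s, ·)` have `L²`-norm at most `M` for `0 ≤ s ≤ 1`, then so does the
difference `u(1, ·) - u(0, ·)`. -/
theorem eLpNorm_sub_le_of_hasDerivAt {N : ℕ} {u d : ℝ → Conf N → ℂ}
    (hu : ∀ s t, HasDerivAt (fun s => u s t) (d s t) s)
    (hd : Continuous fun p : ℝ × Conf N => d p.1 p.2) {M : ENNReal}
    (hM : ∀ s ∈ Set.Ioc (0 : ℝ) 1, eLpNorm (d s) 2 volume ≤ M) :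
    eLpNorm (fun t => u 1 t - u 0 t) 2 volume ≤ M := by
  have hsq {α : Type} [MeasurableSpace α] (μ : Measure α) (f : α → ℂ) :
      eLpNorm f 2 μ ^ (2 : ℝ) = ∫⁻ x, ‖f x‖ₑ ^ (2 : ℝ) ∂μ :=
    eLpNorm_nnreal_pow_eq_lintegral (p := 2) (by norm_num)
  have hprob : IsProbabilityMeasure (volume.restrict (Set.Ioc (0 : ℝ) 1)) := ⟨by simp⟩
  -- Fundamental theorem of calculus in s, then the comparison of L¹ and L² norms on the probability
  -- space (0,1]. Tonelli afterwards exchanges s and t.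
  have hpt (t : Conf N) : ‖u 1 t - u 0 t‖ₑ ^ (2 : ℝ) ≤
      ∫⁻ s in Set.Ioc (0 : ℝ) 1, ‖d s t‖ₑ ^ (2 : ℝ) := by
    have hc : Continuous fun s => d s t := by fun_prop
    have h1 : u 1 t - u 0 t = ∫ s in Set.Ioc (0 : ℝ) 1, d s t := by
      rw [← intervalIntegral.integral_of_le zero_le_one]
      exact (intervalIntegral.integral_eq_sub_of_hasDerivAt (fun s _ => hu s t)
        (hc.intervalIntegrable _ _)).symm
    rw [← hsq]
    gcongr
    calc ‖u 1 t - u 0 t‖ₑ ≤ ∫⁻ s in Set.Ioc (0 : ℝ) 1, ‖d s t‖ₑ := by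
          rw [h1]; exact enorm_integral_le_lintegral_enorm _
      _ = eLpNorm (fun s => d s t) 1 (volume.restrict (Set.Ioc (0 : ℝ) 1)) :=
          eLpNorm_one_eq_lintegral_enorm.symm
      _ ≤ _ := eLpNorm_le_eLpNorm_of_exponent_le (by norm_num) hc.aestronglyMeasurable
  have h2 : eLpNorm (fun t => u 1 t - u 0 t) 2 volume ^ (2 : ℝ) ≤ M ^ (2 : ℝ) := by
    rw [hsq]
    calc _ ≤ ∫⁻ t, ∫⁻ s in Set.Ioc (0 : ℝ) 1, ‖d s t‖ₑ ^ (2 : ℝ) := lintegral_mono hpt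
      _ = ∫⁻ s in Set.Ioc (0 : ℝ) 1, ∫⁻ t, ‖d s t‖ₑ ^ (2 : ℝ) := by
          refine lintegral_lintegral_swap ?_
          refine Measurable.aemeasurable ?_
          have : Continuous fun p : Conf N × ℝ => d p.2 p.1 := by fun_prop
          exact (this.measurable.enorm).pow_const _
      _ ≤ ∫⁻ _s in Set.Ioc (0 : ℝ) 1, M ^ (2 : ℝ) := by
          refine setLIntegral_mono measurable_const fun s hs => ?_
          rw [← hsq]
          gcongr
          exact hM s hs
      _ = M ^ (2 : ℝ) := by simp
  exact (ENNReal.rpow_le_rpow_iff (by norm_num)).1 h2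

theorem continuous_weylFun {N : ℕ} (v : Phase N) (χ : Sch N) :
    Continuous fun p : ℝ × Conf N => weylFun (p.1 • v) χ p.2 := by
  have := χ.continuous
  unfold weylFun
  fun_prop

/-- The derivative of W(sv)χ is W(sv) K_v χ, whose norm does not depend on s because W(sv) is
isometric. -/
theorem norm_weyl_sub_le {N : ℕ} (v : Phase N) (χ : Sch N) :
    ‖weyl v (emb N χ) - emb N χ‖ ≤ ‖emb N (genDir v χ)‖ := by
  have h := eLpNorm_sub_le_of_hasDerivAt (u := fun s t => weylFun (s • v) χ t)
    (fun s t => hasDerivAt_weylFun v χ t s) (continuous_weylFun v _)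
    (M := ‖emb N (genDir v χ)‖ₑ) fun s _ => le_of_eq (by
      rw [← (weyl (s • v)).enorm_map, Lp.enorm_def]
      exact eLpNorm_congr_ae (coeFn_weyl_emb _ _).symm)
  rw [← enorm_le_iff_norm_le, Lp.enorm_def]
  refine le_trans (le_of_eq (eLpNorm_congr_ae ?_)) h
  filter_upwards [Lp.coeFn_sub (weyl v (emb N χ)) (emb N χ), coeFn_weyl_emb v χ, coeFn_emb χ]
    with t h1 h2 h3
  rw [h1, Pi.sub_apply, h2, h3]
  simp [weylFun]

/-- The derivative in s of W(sv)χ - s K_v χ is W(sv) K_v χ - K_v χ, to which the first order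
estimate applies with K_v χ in place of χ. -/
theorem norm_weyl_sub_sub_le {N : ℕ} (v : Phase N) (χ : Sch N) :
    ‖weyl v (emb N χ) - emb N χ - emb N (genDir v χ)‖ ≤ ‖emb N (genDir v (genDir v χ))‖ := by
  have hd (s : ℝ) (t : Conf N) : HasDerivAt (fun s : ℝ => weylFun (s • v) χ t - s * genDir v χ t)
      (weylFun (s • v) (genDir v χ) t - genDir v χ t) s := by
    have := ((hasDerivAt_id s).ofReal_comp).mul_const (genDir v χ t)
    simpa using! (hasDerivAt_weylFun v χ t s).sub this
  have h := eLpNorm_sub_le_of_hasDerivAt hd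
    ((continuous_weylFun v _).sub ((genDir v χ).continuous.comp continuous_snd))
    (M := ‖emb N (genDir v (genDir v χ))‖ₑ) fun s hs => (by
      have h1 : ‖weyl (s • v) (emb N (genDir v χ)) - emb N (genDir v χ)‖ ≤
          ‖emb N (genDir v (genDir v χ))‖ := by
        refine (norm_weyl_sub_le _ _).trans ?_
        rw [genDir_smul, smul_apply, map_smul, norm_smul, Complex.norm_real,
          Real.norm_of_nonneg hs.1.le]
        exact mul_le_of_le_one_left (norm_nonneg _) hs.2
      rw [← enorm_le_iff_norm_le, Lp.enorm_def] at h1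
      refine le_trans (le_of_eq (eLpNorm_congr_ae ?_)) h1
      filter_upwards [Lp.coeFn_sub (weyl (s • v) (emb N (genDir v χ))) (emb N (genDir v χ)),
        coeFn_weyl_emb (s • v) (genDir v χ), coeFn_emb (genDir v χ)] with t h1 h2 h3
      rw [h1, Pi.sub_apply, h2, h3])
  rw [← enorm_le_iff_norm_le, Lp.enorm_def]
  refine le_trans (le_of_eq (eLpNorm_congr_ae ?_)) h
  filter_upwards [Lp.coeFn_sub (weyl v (emb N χ) - emb N χ) (emb N (genDir v χ)),
    Lp.coeFn_sub (weyl v (emb N χ)) (emb N χ), coeFn_weyl_emb v χ, coeFn_emb χ,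
    coeFn_emb (genDir v χ)] with t h0 h1 h2 h3 h4
  rw [h0, Pi.sub_apply, h1, Pi.sub_apply, h2, h3, h4]
  simp [weylFun]
  ring

/-! ### Weyl relations -/

theorem weyl_weyl {N : ℕ} (x y : Phase N) (ψ : Hil N) : weyl x (weyl y ψ) =
    Complex.exp (((inner ℝ y.1 x.2 - inner ℝ x.1 y.2) / 2 : ℝ) * Complex.I) • weyl (x + y) ψ := by
  refine Lp.ext ?_
  filter_upwards [(coeFn_weyl x (weyl y ψ)).trans (weylFun_congr_ae x (coeFn_weyl y ψ)),
    Lp.coeFn_smul (Complex.exp (((inner ℝ y.1 x.2 - inner ℝ x.1 y.2) / 2 : ℝ) * Complex.I))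
      (weyl (x + y) ψ), coeFn_weyl (x + y) ψ] with t h1 h2 h3
  rw [h1, h2, Pi.smul_apply, h3]
  simp only [weylFun, smul_eq_mul, ← mul_assoc, ← Complex.exp_add, ← add_mul, ← Complex.ofReal_add,
    Prod.fst_add, Prod.snd_add, inner_add_left, inner_add_right, inner_sub_right, sub_sub]
  congr 4
  rw [real_inner_comm y.2 x.1]
  ring

theorem weyl_zero {N : ℕ} (ψ : Hil N) : weyl 0 ψ = ψ := by
  refine Lp.ext ?_
  filter_upwards [coeFn_weyl 0 ψ] with t h
  rw [h]
  simp [weylFun]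

theorem weyl_weyl_neg {N : ℕ} (y : Phase N) (ψ : Hil N) : weyl y (weyl (-y) ψ) = ψ := by
  rw [weyl_weyl, add_neg_cancel, weyl_zero]
  simp

theorem inner_weyl_right {N : ℕ} (y : Phase N) (φ ψ : Hil N) :
    inner ℂ φ (weyl y ψ) = inner ℂ (weyl (-y) φ) ψ := by
  rw [← (weyl y).inner_map_map (weyl (-y) φ), weyl_weyl_neg]

/-- The Weyl phases on the two sides of T are conjugate and cancel. Differentiation at y thus
reduces to differentiation at 0 with the vectors shifted by W(-y). -/
theorem translate_add {N : ℕ} (T : SchwartzOp N) (φ ψ : Hil N) (y v : Phase N) :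
    translate T φ ψ (y + v) = translate T (weyl (-y) φ) (weyl (-y) ψ) v := by
  rw [translate, translate, inner_weyl_right v, weyl_weyl, weyl_weyl, inner_weyl_right (y + v),
    map_smul, inner_smul_left, inner_smul_right, ← mul_assoc, ← Complex.exp_conj,
    ← Complex.exp_add]
  have h (r : ℝ) : (starRingEnd ℂ) (r * Complex.I) + r * Complex.I = 0 := by
    rw [map_mul, Complex.conj_ofReal, Complex.conj_I]
    ring
  rw [h, Complex.exp_zero, one_mul, neg_add_rev]

/-! ### Differentiability of translates -/

theorem translate_zero {N : ℕ} (T : SchwartzOp N) (φ ψ : Hil N) :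
    translate T φ ψ 0 = inner ℂ φ (T.op ψ) := by
  rw [translate, neg_zero, weyl_zero, weyl_zero]

/-- A polynomial bound of the Hermite functions for all monomials of degree at most two in the
generators. -/
def genBound {N : ℕ} (n : Fin N → ℕ) : ℝ :=
  1 + ∑ j, ‖emb N (gen j (hermN n))‖ + ∑ i, ∑ j, ‖emb N (gen i (gen j (hermN n)))‖

theorem PolyBdd.add {N : ℕ} {F G : (Fin N → ℕ) → ℝ} (hF : PolyBdd F) (hG : PolyBdd G) :
    PolyBdd fun n => F n + G n := by
  obtain ⟨C, k, hC0, hC⟩ := hF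
  obtain ⟨D, l, hD0, hD⟩ := hG
  refine ⟨C + D, k + l, by positivity, fun n => ?_⟩
  rw [add_mul]
  refine add_le_add ((hC n).trans ?_) ((hD n).trans ?_)
  all_goals
    gcongr
    · exact one_le_wt n
    · omega

theorem PolyBdd.sum {N : ℕ} {ι : Type*} (s : Finset ι) {F : ι → (Fin N → ℕ) → ℝ}
    (hF : ∀ i ∈ s, PolyBdd (F i)) : PolyBdd fun n => ∑ i ∈ s, F i n := by
  classical
  induction s using Finset.induction_on with
  | empty => exact ⟨0, 0, le_rfl, fun n => by simp⟩
  | insert i s hi ih =>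
    simp only [Finset.sum_insert hi]
    exact (hF i (by simp)).add (ih fun j hj => hF j (by simp [hj]))

theorem polyBdd_genBound (N : ℕ) : PolyBdd (genBound (N := N)) :=
  ((polyBdd_one N).add (.sum _ fun j _ => (isNice_gen j).polyBdd)).add
    (.sum _ fun i _ => .sum _ fun j _ => ((isNice_gen i).mul (isNice_gen j)).polyBdd)

theorem one_le_genBound {N : ℕ} (n : Fin N → ℕ) : 1 ≤ genBound n := by
  have h1 : 0 ≤ ∑ j, ‖emb N (gen j (hermN n))‖ := Finset.sum_nonneg fun _ _ => norm_nonneg _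
  have h2 : 0 ≤ ∑ i, ∑ j, ‖emb N (gen i (gen j (hermN n)))‖ :=
    Finset.sum_nonneg fun _ _ => Finset.sum_nonneg fun _ _ => norm_nonneg _
  unfold genBound; linarith

theorem norm_genDir_le {N : ℕ} (v : Phase N) (χ : Sch N) :
    ‖emb N (genDir v χ)‖ ≤ ‖v‖ * ∑ j, ‖emb N (gen j χ)‖ := by
  rw [genDir, sum_apply, map_sum, Finset.mul_sum]
  refine (norm_sum_le _ _).trans (Finset.sum_le_sum fun j _ => ?_)
  rw [smul_apply, map_smul, norm_smul, Complex.norm_real]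
  exact mul_le_mul_of_nonneg_right (abs_coord_le j v) (norm_nonneg _)

theorem norm_genDir_hermN_le {N : ℕ} (v : Phase N) (n : Fin N → ℕ) :
    ‖emb N (genDir v (hermN n))‖ ≤ ‖v‖ * genBound n := by
  refine (norm_genDir_le v _).trans (mul_le_mul_of_nonneg_left ?_ (norm_nonneg v))
  have h2 : 0 ≤ ∑ i, ∑ j, ‖emb N (gen i (gen j (hermN n)))‖ :=
    Finset.sum_nonneg fun _ _ => Finset.sum_nonneg fun _ _ => norm_nonneg _
  unfold genBound; linarith

theorem norm_genDir_genDir_hermN_le {N : ℕ} (v : Phase N) (n : Fin N → ℕ) :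
    ‖emb N (genDir v (genDir v (hermN n)))‖ ≤ ‖v‖ ^ 2 * genBound n := by
  have h1 (i : Fin N ⊕ Fin N) : ‖emb N (gen i (genDir v (hermN n)))‖ ≤
      ‖v‖ * ∑ j, ‖emb N (gen i (gen j (hermN n)))‖ := by
    simp only [genDir, sum_apply, map_sum, Finset.mul_sum]
    refine (norm_sum_le _ _).trans (Finset.sum_le_sum fun j _ => ?_)
    rw [smul_apply, map_smul, map_smul, norm_smul, Complex.norm_real]
    exact mul_le_mul_of_nonneg_right (abs_coord_le j v) (norm_nonneg _)
  have h2 : 0 ≤ ∑ j, ‖emb N (gen j (hermN n))‖ := Finset.sum_nonneg fun _ _ => norm_nonneg _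
  calc _ ≤ ‖v‖ * ∑ i, ‖emb N (gen i (genDir v (hermN n)))‖ := norm_genDir_le v _
    _ ≤ ‖v‖ * ∑ i, ‖v‖ * ∑ j, ‖emb N (gen i (gen j (hermN n)))‖ := by
        gcongr with i
        exact h1 i
    _ = ‖v‖ ^ 2 * ∑ i, ∑ j, ‖emb N (gen i (gen j (hermN n)))‖ := by rw [← Finset.mul_sum]; ring
    _ ≤ _ := by
        gcongr
        unfold genBound; linarith

theorem norm_inner_taylor_le {N : ℕ} {φ ψ a Wa Ka b Wb Kb : Hil N} {r A B : ℝ} (hr0 : 0 ≤ r)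
    (hr1 : r ≤ 1) (hA : 1 ≤ A) (hB : 1 ≤ B) (hb : ‖b‖ = 1) (hWa : ‖Wa‖ = 1)
    (hKa : ‖Ka‖ ≤ r * A) (hKb : ‖Kb‖ ≤ r * B) (hra : ‖Wa - a - Ka‖ ≤ r ^ 2 * A)
    (hrb : ‖Wb - b - Kb‖ ≤ r ^ 2 * B) :
    ‖inner ℂ φ Wa * inner ℂ Wb ψ - inner ℂ φ a * inner ℂ b ψ - inner ℂ φ Ka * inner ℂ b ψ -
      inner ℂ φ a * inner ℂ Kb ψ‖ ≤ r ^ 2 * (4 * (A * B)) * (‖φ‖ * ‖ψ‖) := by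
  -- With remainders r_a and r_b, the second order error of the product Wa ⊗ Wb splits as Wa ⊗ r_b +
  -- r_a ⊗ (b + Kb) + Ka ⊗ Kb; the three terms contribute 1, 2 and 2·½ or less to the factor 4.
  have e : inner ℂ φ Wa * inner ℂ Wb ψ - inner ℂ φ a * inner ℂ b ψ - inner ℂ φ Ka * inner ℂ b ψ -
      inner ℂ φ a * inner ℂ Kb ψ = inner ℂ φ Wa * inner ℂ (Wb - b - Kb) ψ +
        inner ℂ φ (Wa - a - Ka) * inner ℂ (b + Kb) ψ + inner ℂ φ Ka * inner ℂ Kb ψ := by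
    simp only [inner_sub_left, inner_sub_right, inner_add_left]
    ring
  have hp (x y : Hil N) : ‖inner ℂ φ x * inner ℂ y ψ‖ ≤ (‖x‖ * ‖y‖) * (‖φ‖ * ‖ψ‖) := by
    rw [norm_mul]
    calc _ ≤ (‖φ‖ * ‖x‖) * (‖y‖ * ‖ψ‖) := by
          gcongr
          · exact norm_inner_le_norm _ _
          · exact norm_inner_le_norm _ _
      _ = _ := by ring
  have hbK : ‖b + Kb‖ ≤ 2 * B := (norm_add_le _ _).trans (by nlinarith)
  rw [e]
  refine (norm_add_le _ _).trans ((add_le_add ((norm_add_le _ _).trans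
    (add_le_add (hp _ _) (hp _ _))) (hp _ _)).trans ?_)
  rw [← add_mul, ← add_mul]
  gcongr
  have h1 : ‖Wa‖ * ‖Wb - b - Kb‖ ≤ r ^ 2 * (A * B) := by
    rw [hWa, one_mul]
    refine hrb.trans ?_
    gcongr
    nlinarith
  have h2 : ‖Wa - a - Ka‖ * ‖b + Kb‖ ≤ (r ^ 2 * A) * (2 * B) := by gcongr
  have h3 : ‖Ka‖ * ‖Kb‖ ≤ (r * A) * (r * B) := by gcongr
  nlinarith

theorem hasSum_inner_op {N : ℕ} (T : SchwartzOp N) (φ ψ : Hil N) :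
    HasSum (fun p : (Fin N → ℕ) × (Fin N → ℕ) => mat T p.1 p.2 *
      (inner ℂ φ (emb N (hermN p.1)) * inner ℂ (emb N (hermN p.2)) ψ)) (inner ℂ φ (T.op ψ)) := by
  rw [op_eq_sandwich]
  have h := hasSum_inner_nuc (summable_nuc_mat .one .one T) φ ψ
  simpa only [sandwich, inner_smul_right, one_apply_eq_self, mul_assoc] using h

theorem hasSum_inner_opD {N : ℕ} (j : Fin N ⊕ Fin N) (T : SchwartzOp N) (φ ψ : Hil N) :
    HasSum (fun p : (Fin N → ℕ) × (Fin N → ℕ) => -(mat T p.1 p.2 *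
      (inner ℂ φ (emb N (gen j (hermN p.1))) * inner ℂ (emb N (hermN p.2)) ψ +
        inner ℂ φ (emb N (hermN p.1)) * inner ℂ (emb N (gen j (hermN p.2))) ψ)))
      (inner ℂ φ ((opD j T).op ψ)) := by
  have h1 := hasSum_inner_nuc (summable_nuc_mat (isNice_gen j) .one T) φ ψ
  have h2 := hasSum_inner_nuc (summable_nuc_mat .one (isNice_gen j) T) φ ψ
  have h := (h1.add h2).neg
  rw [opD_op, derivOp, neg_apply, add_apply, inner_neg_right, inner_add_right]
  refine h.congr_fun fun p => ?_
  simp only [inner_smul_right, one_apply_eq_self]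
  ring

theorem translate_eq_tsum {N : ℕ} (T : SchwartzOp N) (φ ψ : Hil N) (v : Phase N) :
    HasSum (fun p : (Fin N → ℕ) × (Fin N → ℕ) => mat T p.1 p.2 *
      (inner ℂ φ (weyl v (emb N (hermN p.1))) * inner ℂ (weyl v (emb N (hermN p.2))) ψ))
      (translate T φ ψ v) := by
  rw [translate, inner_weyl_right]
  refine (hasSum_inner_op T (weyl (-v) φ) (weyl (-v) ψ)).congr_fun fun p => ?_
  have h := inner_weyl_right (-v) (emb N (hermN p.2)) ψ
  rw [neg_neg] at h
  rw [inner_weyl_right v, h]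

/-- The Taylor estimate holds for each rank one term of the Hermite expansion with a constant of
polynomial growth, and the rapid decay of T_{nm} makes these constants summable. The bound sees φ
and ψ only through their norms, so it survives replacing them by W(-y)φ and W(-y)ψ. -/
theorem exists_translate_taylor {N : ℕ} (T : SchwartzOp N) : ∃ C : ℝ, ∀ (φ ψ : Hil N)
    (v : Phase N), ‖v‖ ≤ 1 → ‖translate T φ ψ v - inner ℂ φ (T.op ψ) +
      ∑ j, (coord j v : ℂ) * inner ℂ φ ((opD j T).op ψ)‖ ≤ C * (‖φ‖ * ‖ψ‖) * ‖v‖ ^ 2 := by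
  have hG0 (n : Fin N → ℕ) : 0 ≤ genBound n := zero_le_one.trans (one_le_genBound n)
  have hs := (polyBdd_genBound N).summable_mat (polyBdd_genBound N) hG0 hG0 T
  refine ⟨4 * ∑' p : (Fin N → ℕ) × (Fin N → ℕ), ‖mat T p.1 p.2‖ * (genBound p.1 * genBound p.2),
    fun φ ψ v hv => ?_⟩
  have h := ((translate_eq_tsum T φ ψ v).sub (hasSum_inner_op T φ ψ)).add
    (hasSum_sum (s := Finset.univ)
      fun j _ => (hasSum_inner_opD j T φ ψ).mul_left (coord j v : ℂ))
  rw [← h.tsum_eq]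
  have hs' := hs.mul_left (4 * (‖φ‖ * ‖ψ‖) * ‖v‖ ^ 2)
  refine (tsum_of_norm_bounded hs'.hasSum fun p => ?_).trans (le_of_eq ?_)
  · have e1 : ∑ j, (coord j v : ℂ) * -(mat T p.1 p.2 *
        (inner ℂ φ (emb N (gen j (hermN p.1))) * inner ℂ (emb N (hermN p.2)) ψ +
        inner ℂ φ (emb N (hermN p.1)) * inner ℂ (emb N (gen j (hermN p.2))) ψ)) =
        -(mat T p.1 p.2 *
        (inner ℂ φ (emb N (genDir v (hermN p.1))) * inner ℂ (emb N (hermN p.2)) ψ +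
        inner ℂ φ (emb N (hermN p.1)) * inner ℂ (emb N (genDir v (hermN p.2))) ψ)) := by
      simp only [genDir, sum_apply, smul_apply, map_sum, map_smul, inner_sum, sum_inner,
        inner_smul_left, inner_smul_right, Complex.conj_ofReal, Finset.sum_mul, Finset.mul_sum,
        ← Finset.sum_add_distrib, ← Finset.sum_neg_distrib]
      refine Finset.sum_congr rfl fun j _ => ?_
      ring
    rw [e1]
    have h2 := norm_inner_taylor_le (φ := φ) (ψ := ψ) (norm_nonneg v) hv (one_le_genBound p.1)
      (one_le_genBound p.2) (norm_emb_hermN p.2)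
      (((weyl v).norm_map (emb N (hermN p.1))).trans (norm_emb_hermN p.1))
      (norm_genDir_hermN_le v p.1) (norm_genDir_hermN_le v p.2)
      ((norm_weyl_sub_sub_le v _).trans (norm_genDir_genDir_hermN_le v p.1))
      ((norm_weyl_sub_sub_le v _).trans (norm_genDir_genDir_hermN_le v p.2))
    calc _ = ‖mat T p.1 p.2‖ * ‖inner ℂ φ (weyl v (emb N (hermN p.1))) *
          inner ℂ (weyl v (emb N (hermN p.2))) ψ -
          inner ℂ φ (emb N (hermN p.1)) * inner ℂ (emb N (hermN p.2)) ψ -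
          inner ℂ φ (emb N (genDir v (hermN p.1))) * inner ℂ (emb N (hermN p.2)) ψ -
          inner ℂ φ (emb N (hermN p.1)) * inner ℂ (emb N (genDir v (hermN p.2))) ψ‖ := by
          rw [← norm_mul]
          congr 1
          ring
      _ ≤ _ := by
          refine (mul_le_mul_of_nonneg_left h2 (norm_nonneg _)).trans (le_of_eq ?_)
          ring
  · rw [tsum_mul_left]
    ring

/-- The derivative of a translate. -/
def translateDeriv {N : ℕ} (T : SchwartzOp N) (φ ψ : Hil N) (y : Phase N) : Phase N →L[ℝ] ℂ :=
  ∑ j, (coord j).smulRight (-translate (opD j T) φ ψ y)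

theorem hasFDerivAt_translate {N : ℕ} (T : SchwartzOp N) (φ ψ : Hil N) (y : Phase N) :
    HasFDerivAt (translate T φ ψ) (translateDeriv T φ ψ y) y := by
  obtain ⟨C, hC⟩ := exists_translate_taylor T
  rw [hasFDerivAt_iff_isLittleO_nhds_zero]
  refine Asymptotics.IsBigO.trans_isLittleO (g := fun v : Phase N => ‖v‖ ^ 2) ?_
    (Asymptotics.isLittleO_norm_pow_id one_lt_two)
  refine Asymptotics.IsBigO.of_bound (C * (‖φ‖ * ‖ψ‖)) ?_
  filter_upwards [Metric.closedBall_mem_nhds (0 : Phase N) one_pos] with v hv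
  have h := hC (weyl (-y) φ) (weyl (-y) ψ) v (by simpa using hv)
  rw [LinearIsometry.norm_map, LinearIsometry.norm_map] at h
  rw [Real.norm_of_nonneg (by positivity)]
  refine le_trans (le_of_eq ?_) h
  congr 1
  have e (S : SchwartzOp N) : translate S φ ψ y = inner ℂ (weyl (-y) φ) (S.op (weyl (-y) ψ)) := by
    rw [← translate_zero, ← translate_add, add_zero]
  rw [translate_add, e]
  simp [translateDeriv, e, sub_eq_add_neg]
  exact add_comm _ _

/-- The partial derivatives of a translate of T are translates of other Schwartz operators, so
smoothness follows by induction on the order for all T at once. -/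
theorem contDiff_translate {N : ℕ} (T : SchwartzOp N) (φ ψ : Hil N) :
    ContDiff ℝ (⊤ : ℕ∞) (translate T φ ψ) := by
  refine contDiff_infty.2 fun k => ?_
  induction k generalizing T with
  | zero =>
    exact contDiff_zero.2 (continuous_iff_continuousAt.2 fun y =>
      (hasFDerivAt_translate T φ ψ y).continuousAt)
  | succ k ih =>
    push_cast
    refine contDiff_succ_iff_hasFDerivAt.2 ⟨translateDeriv T φ ψ, ?_,
      hasFDerivAt_translate T φ ψ⟩
    refine ContDiff.sum fun j _ => ?_
    exact contDiff_const.smulRight (ih _).neg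

theorem pderiv_translate {N : ℕ} (j : Fin N ⊕ Fin N) (T : SchwartzOp N) (φ ψ : Hil N) :
    pderiv j (translate T φ ψ) = translate ((-opD j) T) φ ψ := by
  funext y
  have h := ((hasFDerivAt_translate T φ ψ y).hasLineDerivAt (dir j)).lineDeriv
  rw [pderiv, h]
  have hc (i : Fin N ⊕ Fin N) : coord i (dir (N := N) j) = if i = j then 1 else 0 := by
    rcases i with i | i <;> rcases j with j | j <;> simp [dir, coord_inl, coord_inr]
  simp only [translateDeriv, sum_apply, ContinuousLinearMap.smulRight_apply, hc, ite_smul, one_smul,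
    zero_smul, Finset.sum_ite_eq', Finset.mem_univ, if_true]
  simp [translate, inner_neg_right]

theorem mprod_translate {N k : ℕ} {A : Fin k → Function.End (Phase N → ℂ)}
    {B : Fin k → SchwartzOp N →L[ℂ] SchwartzOp N} {φ ψ : Hil N}
    (h : ∀ i T, A i (translate T φ ψ) = translate (B i T) φ ψ) (α : Fin k → ℕ) (T : SchwartzOp N) :
    mprod A α (translate T φ ψ) = translate (mprod B α T) φ ψ := by
  have hp (i : Fin k) (l : ℕ) (T : SchwartzOp N) :
      (A i ^ l) (translate T φ ψ) = translate ((B i ^ l) T) φ ψ := by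
    induction l generalizing T with
    | zero => rfl
    | succ l ih =>
      rw [pow_succ, pow_succ, mul_apply_eq_comp, ← ih, ← h]
      rfl
  induction k with
  | zero => rfl
  | succ k ih =>
    rw [mprod_succ, mprod_succ, mul_apply_eq_comp, ← hp, ← ih (fun i => h _) _ fun i => hp _]
    rfl

theorem mprod_neg {A : Type*} [Ring A] {k : ℕ} (x : Fin k → A) (α : Fin k → ℕ) :
    mprod (fun i => -x i) α = (-1) ^ (∑ i, α i) * mprod x α := by
  induction k with
  | zero => simp [mprod]
  | succ k ih =>
    rw [mprod_succ, mprod_succ, ih, Fin.sum_univ_succ, neg_pow, pow_add, mul_assoc, mul_assoc,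
      ← mul_assoc (x 0 ^ α 0), ((Commute.neg_one_left (x 0 ^ α 0)).pow_left _).symm.eq, mul_assoc]

/-- Each partial derivative of W(y) T W(-y) produces K T - T K, the negative of `opD`. The resulting
sign (-1)^{|α|} is cancelled by the one in the definition of D^α T. -/
theorem isOpDeriv_opDPow {N : ℕ} (α : MIdx N) (T : SchwartzOp N) : IsOpDeriv α T (opDPow α T) := by
  refine fun φ ψ => ⟨contDiff_translate T φ ψ, ?_⟩
  have h : funDeriv α (translate T φ ψ) = translate
      ((mprod (fun i => -opD (.inl i)) (fun i => α (.inl i)) *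
        mprod (fun i => -opD (.inr i)) (fun i => α (.inr i)) :
        SchwartzOp N →L[ℂ] SchwartzOp N) T) φ ψ := by
    rw [mul_apply_eq_comp, ← mprod_translate fun i T => pderiv_translate (.inl i) T φ ψ,
      ← mprod_translate fun i T => pderiv_translate (.inr i) T φ ψ]
    rfl
  have e : (mprod (fun i => -opD (.inl i)) (fun i => α (.inl i)) *
        mprod (fun i => -opD (.inr i)) (fun i => α (.inr i)) :
        SchwartzOp N →L[ℂ] SchwartzOp N) = (-1) ^ α.order * opDPow α := by
    rw [mprod_neg, mprod_neg, opDPow, MIdx.order, Fintype.sum_sum_type, pow_add, mul_assoc,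
      mul_assoc, ← mul_assoc (mprod (fun i => opD (Sum.inl i)) _),
      ((Commute.neg_one_left (mprod _ _)).pow_left _).symm.eq, mul_assoc]
  rw [h, e, translate_zero]
  rcases Nat.even_or_odd α.order with he | ho
  · simp [he.neg_one_pow]
  · simp [ho.neg_one_pow]

/-! ### The resolvent-like operators `(1 + H^k)⁻¹` -/

/-- The operator `1 + H^k` on Schwartz functions. -/
def onePow (N k : ℕ) : Sch N →L[ℂ] Sch N := 1 + hamS N ^ k

/-- The eigenvalues of `(1 + H^k)⁻¹`. -/
def resVal {N : ℕ} (k : ℕ) (n : Fin N → ℕ) : ℝ := (1 + energy n ^ k)⁻¹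

theorem isNice_onePow (N k : ℕ) : IsNice (onePow N k) := IsNice.one.add ((isNice_hamS N).pow k)

theorem one_add_energy_pos {N : ℕ} (k : ℕ) (n : Fin N → ℕ) : 0 < 1 + energy n ^ k := by
  have := pow_nonneg (energy_nonneg n) k
  linarith

theorem resVal_pos {N : ℕ} (k : ℕ) (n : Fin N → ℕ) : 0 < resVal k n :=
  inv_pos.2 (one_add_energy_pos k n)

theorem resVal_le {N : ℕ} (k : ℕ) (n : Fin N → ℕ) : resVal k n ≤ 2 ^ k * (wt n ^ k)⁻¹ := by
  have h0 := energy_nonneg n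
  have hw := wt_pos n
  rw [resVal, ← div_eq_mul_inv, le_div_iff₀ (by positivity), inv_mul_le_iff₀ (one_add_energy_pos k n)]
  -- For E ≤ 1 the weight 1 + E is at most 2, for E ≥ 1 at most 2E; either way w^k ≤ 2^k (1 + E^k).
  rcases le_total (energy n) 1 with h | h
  · calc wt n ^ k ≤ 2 ^ k := by
          gcongr
          unfold wt; linarith
      _ ≤ _ := le_mul_of_one_le_left (by positivity) (by linarith [pow_nonneg h0 k])
  · calc wt n ^ k ≤ (energy n * 2) ^ k := by
          gcongr
          unfold wt; linarith
      _ = energy n ^ k * 2 ^ k := mul_pow _ _ _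
      _ ≤ _ := by gcongr; linarith

theorem hamS_pow_hermN {N : ℕ} (k : ℕ) (n : Fin N → ℕ) :
    (hamS N ^ k) (hermN n) = ((energy n : ℂ) ^ k) • hermN n := by
  induction k with
  | zero => simp
  | succ k ih => rw [pow_succ', mul_apply_eq_comp, ih, map_smul, hamS_hermN, smul_smul, pow_succ]

theorem onePow_hermN {N : ℕ} (k : ℕ) (n : Fin N → ℕ) :
    onePow N k (hermN n) = ((resVal k n)⁻¹ : ℂ) • hermN n := by
  rw [onePow, add_apply, hamS_pow_hermN, one_apply_eq_self, resVal]
  push_cast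
  rw [inv_inv, add_smul, one_smul]

theorem norm_resVal {N : ℕ} (k : ℕ) (n : Fin N → ℕ) : ‖(resVal k n : ℂ)‖ = resVal k n := by
  rw [Complex.norm_real, Real.norm_of_nonneg (resVal_pos k n).le]

theorem norm_smul_emb_hermN {N : ℕ} (c : ℂ) (n : Fin N → ℕ) : ‖c • emb N (hermN n)‖ = ‖c‖ := by
  rw [norm_smul, norm_emb_hermN, mul_one]

/-- The bounded operator `(1 + H^k)⁻¹`, for large `k`. -/
def resolv (N k : ℕ) : Hil N →L[ℂ] Hil N :=
  nuc (fun n : Fin N → ℕ => (resVal k n : ℂ) • emb N (hermN n)) (fun n => emb N (hermN n))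

theorem summable_resVal {N k : ℕ} (hk : 2 * N ≤ k) :
    Summable fun n : Fin N → ℕ => resVal k n := by
  refine ((summable_wt N).mul_left (2 ^ k)).of_nonneg_of_le (fun n => (resVal_pos k n).le) fun n => ?_
  refine (resVal_le k n).trans ?_
  have := wt_pos n
  gcongr
  exact one_le_wt n

theorem summable_resolv {N k : ℕ} (hk : 2 * N ≤ k) : Summable fun n : Fin N → ℕ =>
    ‖(resVal k n : ℂ) • emb N (hermN n)‖ * ‖emb N (hermN n)‖ := by
  refine (summable_resVal hk).congr fun n => ?_
  rw [norm_smul_emb_hermN, norm_emb_hermN, mul_one, norm_resVal]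

theorem ext_inner_hermN {N : ℕ} {x y : Hil N}
    (h : ∀ n, inner ℂ (emb N (hermN n)) x = inner ℂ (emb N (hermN n)) y) : x = y := by
  refine (hermBasis N).repr.injective (lp.ext (funext fun n => ?_))
  rw [HilbertBasis.repr_apply_apply, HilbertBasis.repr_apply_apply, hermBasis_apply]
  exact h n

theorem inner_hermN {N : ℕ} (n m : Fin N → ℕ) :
    inner ℂ (emb N (hermN n)) (emb N (hermN m)) = if n = m then 1 else 0 :=
  orthonormal_iff_ite.1 (orthonormal_hermN N) n m

theorem inner_resolv {N k : ℕ} (hk : 2 * N ≤ k) (n : Fin N → ℕ) (x : Hil N) :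
    inner ℂ (emb N (hermN n)) (resolv N k x) = resVal k n * inner ℂ (emb N (hermN n)) x := by
  refine (hasSum_inner_nuc (summable_resolv hk) (emb N (hermN n)) x).unique ?_
  refine (hasSum_ite_eq n (resVal k n * inner ℂ (emb N (hermN n)) x)).congr_fun fun m => ?_
  rw [inner_smul_right, inner_hermN]
  by_cases h : n = m
  · subst h; simp
  · simp [h, Ne.symm h]

theorem resolv_hermN {N k : ℕ} (hk : 2 * N ≤ k) (n : Fin N → ℕ) :
    resolv N k (emb N (hermN n)) = (resVal k n : ℂ) • emb N (hermN n) := by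
  refine ext_inner_hermN fun m => ?_
  rw [inner_resolv hk, inner_smul_right, inner_hermN]
  by_cases h : m = n
  · subst h; simp
  · simp [h]

theorem inner_resolv_left {N k : ℕ} (hk : 2 * N ≤ k) (x y : Hil N) :
    inner ℂ (resolv N k x) y = inner ℂ x (resolv N k y) := by
  have h1 := hasSum_inner_nuc (summable_resolv hk) x y
  have h2 := (hasSum_inner_nuc (summable_resolv hk) y x)
  have h3 := Complex.hasSum_conj'.2 h2
  rw [inner_conj_symm] at h3
  refine h3.unique (h1.congr_fun fun n => ?_)
  rw [map_mul, inner_conj_symm, inner_conj_symm, inner_smul_left, inner_smul_right,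
    Complex.conj_ofReal]
  ring

theorem resolv_injective {N k : ℕ} (hk : 2 * N ≤ k) : Function.Injective (resolv N k) := by
  intro x y h
  refine ext_inner_hermN fun n => ?_
  have h1 := inner_resolv hk n x
  rw [h, inner_resolv hk] at h1
  exact (mul_left_cancel₀ (Complex.ofReal_ne_zero.2 (resVal_pos k n).ne') h1).symm

theorem dense_range_resolv {N k : ℕ} (hk : 2 * N ≤ k) :
    Dense ((LinearMap.range (resolv N k).toLinearMap : Submodule ℂ (Hil N)) : Set (Hil N)) := by
  have hd : Dense ((Submodule.span ℂ (Set.range (hermBasis N))) : Set (Hil N)) := by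
    rw [Submodule.dense_iff_topologicalClosure_eq_top]
    exact (hermBasis N).dense_span
  refine hd.mono (Submodule.span_le.2 ?_)
  rintro _ ⟨n, rfl⟩
  refine ⟨((resVal k n : ℂ)⁻¹) • emb N (hermN n), ?_⟩
  change resolv N k _ = _
  rw [map_smul, resolv_hermN hk, smul_smul, hermBasis_apply,
    inv_mul_cancel₀ (Complex.ofReal_ne_zero.2 (resVal_pos k n).ne'), one_smul]

theorem resolv_emb_add {N k : ℕ} (hk : 2 * N ≤ k) (φ : Sch N) :
    resolv N k (emb N φ + emb N ((hamS N ^ k) φ)) = emb N φ := by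
  refine ext_inner_hermN fun n => ?_
  rw [inner_resolv hk, inner_add_right, (isSym_hamS N).pow k, hamS_pow_hermN, map_smul,
    inner_smul_left, map_pow, Complex.conj_ofReal, resVal]
  have := (one_add_energy_pos k n).ne'
  rw [← one_add_mul, ← mul_assoc]
  have e : ((1 + energy n ^ k)⁻¹ : ℝ) * (1 + (energy n : ℂ) ^ k) = 1 := by
    exact_mod_cast inv_mul_cancel₀ this
  rw [e, one_mul]

/-- On the domain of `H^k`, the operator `(1 + H^k)⁻¹` inverts `1 + H^k`. -/
theorem resolv_add_hamPow {N k : ℕ} (hk : 2 * N ≤ k) (x : (hamPow N k).domain) :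
    resolv N k ((x : Hil N) + hamPow N k x) = x := by
  have h1 : ((x : Hil N), hamPow N k x) ∈ (onSchwartz (hamS N ^ k)).graph.topologicalClosure := by
    rw [(isClosable_hamS_pow N k).graph_closure_eq_closure_graph]
    exact LinearPMap.mem_graph _ x
  -- The identity is a closed condition on points of the graph, so it passes from Schwartz functions
  -- to the closure that defines H^k.
  have hc : IsClosed {p : Hil N × Hil N | resolv N k (p.1 + p.2) = p.1} :=
    isClosed_eq (by fun_prop) (by fun_prop)
  refine closure_minimal ?_ hc h1
  rintro ⟨p, q⟩ hp
  obtain ⟨⟨y, φ, rfl⟩, rfl, rfl⟩ := (LinearPMap.mem_graph_iff _).1 hp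
  have e : onSchwartz (hamS N ^ k) ⟨(emb N).toLinearMap φ, φ, rfl⟩ = emb N ((hamS N ^ k) φ) := by
    have : (LinearEquiv.ofInjective (emb N).toLinearMap (injective_toLp 2 volume)).symm
        ⟨(emb N).toLinearMap φ, φ, rfl⟩ = φ := by
      rw [LinearEquiv.symm_apply_eq]; rfl
    exact congrArg (fun z => emb N ((hamS N ^ k) z)) this
  change resolv N k (emb N φ + onSchwartz (hamS N ^ k) ⟨(emb N).toLinearMap φ, φ, rfl⟩) = emb N φ
  rw [e, resolv_emb_add hk]

/-! ### Polynomially bounded operators of the form `B (1 + H^k)` -/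

/-- The operator `B (1 + H^k)` on the range of `(1 + H^k)⁻¹`. -/
def mulInv {N k : ℕ} (hk : 2 * N ≤ k) (B : Hil N →L[ℂ] Hil N) : Hil N →ₗ.[ℂ] Hil N where
  domain := LinearMap.range (resolv N k).toLinearMap
  toFun := B.toLinearMap ∘ₗ
    (LinearEquiv.ofInjective (resolv N k).toLinearMap (resolv_injective hk)).symm.toLinearMap

theorem mulInv_apply {N k : ℕ} (hk : 2 * N ≤ k) (B : Hil N →L[ℂ] Hil N) {x : (mulInv hk B).domain}
    {χ : Hil N} (h : resolv N k χ = x) : mulInv hk B x = B χ := by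
  have : (LinearEquiv.ofInjective (resolv N k).toLinearMap (resolv_injective hk)).symm x = χ :=
    (LinearEquiv.symm_apply_eq _).2 (Subtype.ext h.symm)
  exact congrArg B this

theorem norm_add_le_mul {N : ℕ} (B : Hil N →L[ℂ] Hil N) (x y : Hil N) :
    ‖B (x + y)‖ ≤ (‖B‖ + 1) * ‖y‖ + (‖B‖ + 1) * ‖x‖ := by
  calc ‖B (x + y)‖ ≤ ‖B‖ * ‖x + y‖ := B.le_opNorm _
    _ ≤ (‖B‖ + 1) * (‖x‖ + ‖y‖) := by
        gcongr
        · linarith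
        · exact norm_add_le _ _
    _ = _ := by ring

/-- Let R = (1+H^k)⁻¹ and A = B R⁻¹. For x in the domain of H^k, x = R(x + H^k x), so Ax = B(x + H^k
x). For y = Rχ, ⟨x, Ay⟩ = ⟨x + H^k x, R B χ⟩ = ⟨x + H^k x, B' y⟩, so A*x = B'*(x + H^k x).
Boundedness of B and B' gives both relative bounds. -/
theorem isPolyBounded_mulInv {N k : ℕ} (hk : 2 * N ≤ k) {B B' : Hil N →L[ℂ] Hil N}
    (hB : resolv N k * B = B' * resolv N k) : IsPolyBounded (mulInv hk B) := by
  have hdense : Dense ((mulInv hk B).domain : Set (Hil N)) := dense_range_resolv hk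
  have hadj (x : (hamPow N k).domain) (y : (mulInv hk B).domain) :
      inner ℂ (B'.adjoint (x + hamPow N k x)) (y : Hil N) = inner ℂ (x : Hil N) (mulInv hk B y) := by
    obtain ⟨χ, hχ⟩ := y.2
    have hχ : resolv N k χ = y := hχ
    have h1 : B' (resolv N k χ) = resolv N k (B χ) := congrArg (fun L => L χ) hB.symm
    rw [mulInv_apply hk B hχ, ← hχ, ContinuousLinearMap.adjoint_inner_left, h1,
      ← inner_resolv_left hk, resolv_add_hamPow hk]
  have hmem (x : (hamPow N k).domain) : (x : Hil N) ∈ (mulInv hk B).adjoint.domain :=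
    LinearPMap.mem_adjoint_domain_of_exists _ ⟨_, hadj x⟩
  have hval (x : (hamPow N k).domain) :
      (mulInv hk B).adjoint ⟨x, hmem x⟩ = B'.adjoint (x + hamPow N k x) :=
    LinearPMap.adjoint_apply_eq hdense _ (hadj x)
  refine ⟨hdense, ⟨k, fun x hx => ⟨_, resolv_add_hamPow hk ⟨x, hx⟩⟩, ‖B‖ + 1, ‖B‖ + 1,
    by positivity, by positivity, fun φ => ?_⟩, ⟨k, fun x hx => hmem ⟨x, hx⟩, ‖B'.adjoint‖ + 1,
    ‖B'.adjoint‖ + 1, by positivity, by positivity, fun φ => ?_⟩⟩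
  · rw [mulInv_apply hk B (resolv_add_hamPow hk φ)]
    exact norm_add_le_mul B _ _
  · exact (congrArg norm (hval φ)).trans_le (norm_add_le_mul _ _ _)

/-! ### Distributions given by polynomially bounded operators -/

/-- So T maps into the range of (1+H^k)⁻¹, and B(1+H^k) T is everywhere defined and bounded. -/
theorem resolv_mul_sandwich {N k : ℕ} (hk : 2 * N ≤ k) (T : SchwartzOp N) :
    resolv N k * sandwich (onePow N k) 1 T = T.op := by
  rw [op_eq_sandwich, sandwich, comp_nuc (summable_nuc_mat (isNice_onePow N k) .one T), sandwich]
  congr 1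
  funext p
  rw [onePow_hermN, map_smul, map_smul, map_smul, resolv_hermN hk, smul_smul (_ : ℂ)⁻¹,
    inv_mul_cancel₀ (Complex.ofReal_ne_zero.2 (resVal_pos k _).ne'), one_smul]
  rfl

/-- The distribution `Φ` is given by an operator `B (1 + H^k)` with bounded `B`, for which
`(1 + H^k)⁻¹ B (1 + H^k)` is bounded as well. -/
def IsRep {N : ℕ} (k : ℕ) (Φ : Distr N) : Prop :=
  ∃ B B' : Hil N →L[ℂ] Hil N, resolv N k * B = B' * resolv N k ∧
    ∀ T, HasTrace (B * sandwich (onePow N k) 1 T) (Φ T)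

theorem IsRep.exists_isOpDistr {N k : ℕ} (hk : 2 * N ≤ k) {Φ : Distr N} (h : IsRep k Φ) :
    ∃ A : Hil N →ₗ.[ℂ] Hil N, IsPolyBounded A ∧ IsOpDistr A Φ := by
  obtain ⟨B, B', hB, h⟩ := h
  refine ⟨mulInv hk B, isPolyBounded_mulInv hk hB, fun T => ⟨_, fun φ => ?_, h T⟩⟩
  have e : resolv N k (sandwich (onePow N k) 1 T φ) = T.op φ :=
    congrArg (fun L => L φ) (resolv_mul_sandwich hk T)
  rw [LinearPMap.mem_graph_iff]
  exact ⟨⟨T.op φ, _, e⟩, rfl, mulInv_apply hk B e⟩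

theorem IsRep.zero {N : ℕ} (k : ℕ) : IsRep k (0 : Distr N) :=
  ⟨0, 0, by simp, fun T ι b => by simp⟩

theorem IsRep.add {N k : ℕ} {Φ Ψ : Distr N} (hΦ : IsRep k Φ) (hΨ : IsRep k Ψ) :
    IsRep k (Φ + Ψ) := by
  obtain ⟨B, B', hB, h⟩ := hΦ
  obtain ⟨C, C', hC, h'⟩ := hΨ
  refine ⟨B + C, B' + C', by rw [mul_add, add_mul, hB, hC], fun T ι b => ?_⟩
  simpa [add_mul, inner_add_right] using (h T ι b).add (h' T ι b)

theorem IsRep.smul {N k : ℕ} {Φ : Distr N} (c : ℂ) (hΦ : IsRep k Φ) : IsRep k (c • Φ) := by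
  obtain ⟨B, B', hB, h⟩ := hΦ
  refine ⟨c • B, c • B', by rw [mul_smul_comm, smul_mul_assoc, hB], fun T ι b => ?_⟩
  simpa [inner_smul_right] using (h T ι b).mul_left c

/-- The coefficients `a` are polynomially bounded. -/
def CoeffBdd {N : ℕ} (a : (Fin N → ℕ) × (Fin N → ℕ) → ℂ) : Prop :=
  ∃ (C : ℝ) (k : ℕ), 0 ≤ C ∧ ∀ p, ‖a p‖ ≤ C * (wt p.1 ^ k * wt p.2 ^ k)

theorem CoeffBdd.exists_bound {N : ℕ} {a : (Fin N → ℕ) × (Fin N → ℕ) → ℂ} (ha : CoeffBdd a) :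
    ∃ q : Seminorm ℂ (SchwartzOp N), Continuous q ∧ ∀ T p,
      ‖mat T p.1 p.2 * a p‖ ≤ q T * ((wt p.1 ^ (2 * N))⁻¹ * (wt p.2 ^ (2 * N))⁻¹) := by
  obtain ⟨C, k, hC, h⟩ := ha
  have h1 : PolyBdd fun n : Fin N → ℕ => C * wt n ^ k := ⟨C, k, hC, fun n => le_rfl⟩
  have h2 : PolyBdd fun n : Fin N → ℕ => wt n ^ k := ⟨1, k, zero_le_one, fun n => by simp⟩
  obtain ⟨q, hq, hb⟩ := h1.exists_mat_bound h2 (fun n => pow_nonneg (wt_pos n).le _) (2 * N)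
  refine ⟨q, hq, fun T p => le_trans ?_ (hb T p.1 p.2)⟩
  rw [norm_mul, mul_assoc]
  exact mul_le_mul_of_nonneg_left (h p) (norm_nonneg _)

theorem CoeffBdd.summable {N : ℕ} {a : (Fin N → ℕ) × (Fin N → ℕ) → ℂ} (ha : CoeffBdd a)
    (T : SchwartzOp N) : Summable fun p => mat T p.1 p.2 * a p := by
  obtain ⟨q, -, h⟩ := ha.exists_bound
  exact Summable.of_norm_bounded ((summable_wt_prod N).mul_left (q T)) (h T)

/-- The functional `T ↦ ∑ T_{nm} a_{nm}`. -/
def matDistrLin {N : ℕ} {a : (Fin N → ℕ) × (Fin N → ℕ) → ℂ} (ha : CoeffBdd a) :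
    SchwartzOp N →ₗ[ℂ] ℂ where
  toFun T := ∑' p, mat T p.1 p.2 * a p
  map_add' S T := by
    simp only [mat_add, add_mul]
    exact (ha.summable S).tsum_add (ha.summable T)
  map_smul' c T := by
    simp only [mat_smul, mul_assoc, RingHom.id_apply, smul_eq_mul]
    exact tsum_mul_left

theorem continuous_matDistrLin {N : ℕ} {a : (Fin N → ℕ) × (Fin N → ℕ) → ℂ} (ha : CoeffBdd a) :
    Continuous (matDistrLin ha) := by
  obtain ⟨q, hq, h⟩ := ha.exists_bound
  have hs := summable_wt_prod N
  have h0 : 0 ≤ ∑' p : (Fin N → ℕ) × (Fin N → ℕ), (wt p.1 ^ (2 * N))⁻¹ * (wt p.2 ^ (2 * N))⁻¹ :=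
    tsum_nonneg fun p => mul_nonneg (inv_nonneg.2 (pow_nonneg (wt_pos _).le _))
      (inv_nonneg.2 (pow_nonneg (wt_pos _).le _))
  have hb (T : SchwartzOp N) : ‖matDistrLin ha T‖ ≤
      q T * ∑' p : (Fin N → ℕ) × (Fin N → ℕ), (wt p.1 ^ (2 * N))⁻¹ * (wt p.2 ^ (2 * N))⁻¹ := by
    rw [← tsum_mul_left]
    exact tsum_of_norm_bounded (hs.mul_left (q T)).hasSum (h T)
  refine continuous_of_continuousAt_zero (matDistrLin ha) ?_
  rw [ContinuousAt, map_zero]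
  refine squeeze_zero_norm hb ?_
  have := (hq.tendsto 0).mul_const
    (∑' p : (Fin N → ℕ) × (Fin N → ℕ), (wt p.1 ^ (2 * N))⁻¹ * (wt p.2 ^ (2 * N))⁻¹)
  simpa using this

/-- The distribution `T ↦ ∑ T_{nm} a_{nm}`. -/
def matDistr {N : ℕ} {a : (Fin N → ℕ) × (Fin N → ℕ) → ℂ} (ha : CoeffBdd a) : Distr N :=
  ⟨matDistrLin ha, continuous_matDistrLin ha⟩

theorem matDistr_apply {N : ℕ} {a : (Fin N → ℕ) × (Fin N → ℕ) → ℂ} (ha : CoeffBdd a)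
    (T : SchwartzOp N) : matDistr ha T = ∑' p, mat T p.1 p.2 * a p := rfl

/-- The indices are transposed because tr[BT] = ∑ T_{nm} B_{mn}. -/
theorem coeffBdd_of_clm {N : ℕ} (B : Hil N →L[ℂ] Hil N) : CoeffBdd
    fun p : (Fin N → ℕ) × (Fin N → ℕ) => inner ℂ (emb N (hermN p.2)) (B (emb N (hermN p.1))) := by
  refine ⟨‖B‖, 0, norm_nonneg _, fun p => ?_⟩
  have h1 := norm_inner_le_norm (𝕜 := ℂ) (emb N (hermN p.2)) (B (emb N (hermN p.1)))
  have h2 := B.le_opNorm (emb N (hermN p.1))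
  rw [norm_emb_hermN] at h1 h2
  simp only [pow_zero, mul_one] at h2 ⊢
  linarith

/-- The distribution `T ↦ tr[B T]` of a bounded operator. -/
def clmDistr {N : ℕ} (B : Hil N →L[ℂ] Hil N) : Distr N := matDistr (coeffBdd_of_clm B)

theorem hasTrace_clmDistr {N : ℕ} (B : Hil N →L[ℂ] Hil N) (T : SchwartzOp N) :
    HasTrace (B * T.op) (clmDistr B T) := by
  have hs := summable_nuc_mat .one .one T
  have hs' : Summable fun p : (Fin N → ℕ) × (Fin N → ℕ) =>
      ‖B (mat T p.1 p.2 • emb N ((1 : Sch N →L[ℂ] Sch N) (hermN p.1)))‖ *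
      ‖emb N ((1 : Sch N →L[ℂ] Sch N) (hermN p.2))‖ := by
    refine (hs.mul_left ‖B‖).of_nonneg_of_le (fun p => by positivity) fun p => ?_
    rw [← mul_assoc]
    gcongr
    exact B.le_opNorm _
  have h := hasTrace_nuc hs'
  rw [op_eq_sandwich, sandwich, comp_nuc hs]
  convert h using 1
  rw [clmDistr, matDistr_apply]
  refine tsum_congr fun p => ?_
  rw [map_smul, inner_smul_right]
  rfl

/-- A bounded B equals (B R)(1+H^k) on the range of R = (1+H^k)⁻¹, and R(B R) = (R B) R. -/
theorem isRep_clmDistr {N k : ℕ} (hk : 2 * N ≤ k) (B : Hil N →L[ℂ] Hil N) :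
    IsRep k (clmDistr B) := by
  refine ⟨B * resolv N k, resolv N k * B, by rw [mul_assoc], fun T => ?_⟩
  rw [mul_assoc, resolv_mul_sandwich hk]
  exact hasTrace_clmDistr B T

theorem HasTrace.unique {N : ℕ} {B : Hil N →L[ℂ] Hil N} {s t : ℂ} (hs : HasTrace B s)
    (ht : HasTrace B t) : s = t :=
  (hs _ (hermBasis N)).unique (ht _ (hermBasis N))

/-- The distribution of the operator `∑ₖ |f_k⟩⟨g_k|`. -/
theorem clmDistr_nuc {N : ℕ} {κ : Type*} {f g : κ → Hil N}
    (h : Summable fun k => ‖f k‖ * ‖g k‖) (T : SchwartzOp N) :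
    clmDistr (nuc f g) T = ∑' k, inner ℂ (g k) (T.op (f k)) := by
  refine (hasTrace_clmDistr (nuc f g) T).unique ?_
  have h' : Summable fun k => ‖f k‖ * ‖T.op.adjoint (g k)‖ := by
    refine (h.mul_left ‖T.op.adjoint‖).of_nonneg_of_le (fun k => by positivity) fun k => ?_
    rw [mul_left_comm]
    gcongr
    exact T.op.adjoint.le_opNorm _
  rw [nuc_comp h (L' := T.op.adjoint) fun φ ψ => ContinuousLinearMap.adjoint_inner_left _ _ _]
  convert hasTrace_nuc h' using 1
  refine tsum_congr fun k => ?_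
  rw [ContinuousLinearMap.adjoint_inner_left]

theorem nuc_real_smul {N : ℕ} {κ : Type*} (c : κ → ℝ) (f g : κ → Hil N) :
    nuc (fun k => (c k : ℂ) • f k) g = nuc f (fun k => (c k : ℂ) • g k) := by
  unfold nuc
  congr 1
  funext k
  ext1 x
  simp only [InnerProductSpace.rankOne_apply, inner_smul_left, Complex.conj_ofReal, smul_smul,
    mul_comm]

/-- Coefficients that are summable after division by `1 + E^k` on either side define operators of
the required form. -/
theorem isRep_matDistr {N k : ℕ} (hk : 2 * N ≤ k) {a : (Fin N → ℕ) × (Fin N → ℕ) → ℂ}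
    (ha : CoeffBdd a) (h1 : Summable fun p => resVal k p.1 * ‖a p‖)
    (h2 : Summable fun p => resVal k p.2 * ‖a p‖) : IsRep k (matDistr ha) := by
  have s1 : Summable fun p : (Fin N → ℕ) × (Fin N → ℕ) =>
      ‖((resVal k p.1 : ℂ) * a p) • emb N (hermN p.2)‖ * ‖emb N (hermN p.1)‖ := by
    refine h1.congr fun p => ?_
    rw [norm_smul_emb_hermN, norm_emb_hermN, mul_one, norm_mul, norm_resVal]
  have s2 : Summable fun p : (Fin N → ℕ) × (Fin N → ℕ) =>
      ‖((resVal k p.2 : ℂ) * a p) • emb N (hermN p.2)‖ * ‖emb N (hermN p.1)‖ := by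
    refine h2.congr fun p => ?_
    rw [norm_smul_emb_hermN, norm_emb_hermN, mul_one, norm_mul, norm_resVal]
  set B : Hil N →L[ℂ] Hil N := nuc (fun p : (Fin N → ℕ) × (Fin N → ℕ) =>
    ((resVal k p.1 : ℂ) * a p) • emb N (hermN p.2)) (fun p => emb N (hermN p.1)) with hB
  -- If A is the formal operator with entries A_{mn} = a_{nm} and R = (1+H^k)⁻¹, then B = A R and
  -- the second witness is R A. Both are nuclear by the two summability hypotheses, and R(A R) = (R
  -- A)R.
  refine ⟨B, nuc (fun p : (Fin N → ℕ) × (Fin N → ℕ) =>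
    ((resVal k p.2 : ℂ) * a p) • emb N (hermN p.2)) (fun p => emb N (hermN p.1)), ?_, fun T => ?_⟩
  · rw [hB, comp_nuc s1, nuc_comp s2 (inner_resolv_left hk)]
    simp only [map_smul, resolv_hermN hk, ← nuc_real_smul]
    congr 1
    funext p
    simp only [smul_smul]
    congr 1
    ring
  · have hBe (n m : Fin N → ℕ) : inner ℂ (emb N (hermN m)) (B (emb N (hermN n))) =
        resVal k n * a (n, m) := by
      refine (hasSum_inner_nuc s1 (emb N (hermN m)) (emb N (hermN n))).unique ?_
      refine (hasSum_ite_eq (n, m) (resVal k n * a (n, m))).congr_fun fun p => ?_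
      rw [inner_smul_right, inner_hermN, inner_hermN]
      by_cases e1 : p.1 = n <;> by_cases e2 : m = p.2
      · obtain ⟨p1, p2⟩ := p
        simp only at e1 e2
        subst e1 e2
        simp
      all_goals
        simp [e1, e2, Prod.ext_iff, eq_comm (a := p.2)]
    have hs := summable_nuc_mat (isNice_onePow N k) .one T
    have hs' : Summable fun p : (Fin N → ℕ) × (Fin N → ℕ) =>
        ‖B (mat T p.1 p.2 • emb N (onePow N k (hermN p.1)))‖ *
        ‖emb N ((1 : Sch N →L[ℂ] Sch N) (hermN p.2))‖ := by
      refine (hs.mul_left ‖B‖).of_nonneg_of_le (fun p => by positivity) fun p => ?_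
      rw [← mul_assoc]
      gcongr
      exact B.le_opNorm _
    rw [sandwich, comp_nuc hs]
    convert hasTrace_nuc hs' using 1
    rw [matDistr_apply]
    refine tsum_congr fun p => ?_
    rw [onePow_hermN, map_smul, map_smul, map_smul, inner_smul_right, inner_smul_right,
      one_apply_eq_self, hBe, inv_mul_cancel_left₀
        (Complex.ofReal_ne_zero.2 (resVal_pos k _).ne')]

/-! ### Expansion of distributions in the Hermite basis -/

/-- X moves onto the Hermite function as its formal adjoint, which also grows polynomially. -/
theorem IsNice.exists_inner_le {N : ℕ} {X : Sch N →L[ℂ] Sch N} (h : IsNice X) :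
    ∃ F : (Fin N → ℕ) → ℝ, PolyBdd F ∧ (∀ n, 0 ≤ F n) ∧
      ∀ ψ n, ‖inner ℂ (emb N (X ψ)) (emb N (hermN n))‖ ≤ F n * ‖emb N ψ‖ := by
  obtain ⟨hX, X', aX, hX'⟩ := h
  have hn : IsNice X' := ⟨hX', X, aX.symm, hX⟩
  refine ⟨_, hn.polyBdd, fun n => norm_nonneg _, fun ψ n => ?_⟩
  rw [← aX.symm, mul_comm]
  exact norm_inner_le_norm _ _

/-- The operator `|h_n⟩⟨h_m|`. -/
def unitOp {N : ℕ} (n m : Fin N → ℕ) : Hil N →L[ℂ] Hil N :=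
  InnerProductSpace.rankOne ℂ (emb N (hermN n)) (emb N (hermN m))

theorem inner_unitOp {N : ℕ} (n m : Fin N → ℕ) (x y : Hil N) :
    inner ℂ x (unitOp n m y) =
      inner ℂ x (emb N (hermN n)) * inner ℂ (emb N (hermN m)) y := by
  rw [unitOp, InnerProductSpace.rankOne_apply, inner_smul_right, mul_comm]

theorem IsNice.norm_inner_unitOp_le {N : ℕ} {X Y : Sch N →L[ℂ] Sch N} {F G : (Fin N → ℕ) → ℝ}
    (hF : ∀ ψ n, ‖inner ℂ (emb N (X ψ)) (emb N (hermN n))‖ ≤ F n * ‖emb N ψ‖)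
    (hG : ∀ ψ n, ‖inner ℂ (emb N (Y ψ)) (emb N (hermN n))‖ ≤ G n * ‖emb N ψ‖)
    (n m : Fin N → ℕ) (ψ φ : Sch N) :
    ‖inner ℂ (emb N (X ψ)) (unitOp n m (emb N (Y φ)))‖ ≤
      F n * G m * (‖emb N ψ‖ * ‖emb N φ‖) := by
  rw [inner_unitOp, norm_mul, norm_inner_symm (emb N (hermN m))]
  calc _ ≤ (F n * ‖emb N ψ‖) * (G m * ‖emb N φ‖) :=
        mul_le_mul (hF ψ n) (hG φ m) (norm_nonneg _) ((norm_nonneg _).trans (hF ψ n))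
    _ = _ := by ring

theorem unitOp_mem {N : ℕ} (n m : Fin N → ℕ) : unitOp n m ∈ schwartzOps N := by
  refine mem_schwartzOps_of_forms fun X hX Y hY => ?_
  obtain ⟨F, -, -, hF⟩ := (IsNice.of_mem_normalOrd hX).exists_inner_le
  obtain ⟨G, -, -, hG⟩ := (IsNice.of_mem_normalOrd hY).exists_inner_le
  exact ⟨_, IsNice.norm_inner_unitOp_le hF hG n m⟩

/-- The Schwartz operator `|h_n⟩⟨h_m|`. -/
def matUnit {N : ℕ} (n m : Fin N → ℕ) : SchwartzOp N := .ofMem (unitOp_mem n m)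

theorem isNice_monomial {N : ℕ} (α β : Fin N → ℕ) : IsNice (powP β * powQ α) :=
  IsNice.of_mem_normalOrd (Submodule.subset_span ⟨(α, β), rfl⟩)

theorem exists_opSeminorm_matUnit_le {N : ℕ} (k : Idx4 N) : ∃ (C : ℝ) (l : ℕ), 0 ≤ C ∧
    ∀ n m : Fin N → ℕ, opSeminorm k (matUnit n m) ≤ C * (wt n ^ l * wt m ^ l) := by
  obtain ⟨F, ⟨C, a, hC, hFb⟩, hF0, hF⟩ := (isNice_monomial k.1 k.2.1).exists_inner_le
  obtain ⟨G, ⟨D, b, hD, hGb⟩, hG0, hG⟩ := (isNice_monomial k.2.2.1 k.2.2.2).exists_inner_le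
  refine ⟨C * D, a + b, mul_nonneg hC hD, fun n m => ?_⟩
  have h1 : opSeminorm k (matUnit n m) ≤ F n * G m :=
    opSeminorm_le k _ (mul_nonneg (hF0 n) (hG0 m)) (IsNice.norm_inner_unitOp_le hF hG n m)
  have hn := one_le_wt n
  have hm := one_le_wt m
  calc _ ≤ F n * G m := h1
    _ ≤ (C * wt n ^ a) * (D * wt m ^ b) :=
        mul_le_mul (hFb n) (hGb m) (hG0 m) (by have := wt_pos n; positivity)
    _ ≤ (C * wt n ^ (a + b)) * (D * wt m ^ (a + b)) := by
        have := wt_pos n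
        have := wt_pos m
        gcongr <;> first | assumption | omega
    _ = _ := by ring

/-- The matrix elements `Φ(|h_n⟩⟨h_m|)` of a distribution. -/
def coef {N : ℕ} (Φ : Distr N) (p : (Fin N → ℕ) × (Fin N → ℕ)) : ℂ := Φ (matUnit p.1 p.2)

/-- Continuity bounds Φ by finitely many seminorms, and each of them grows polynomially on the
matrix units |h_n⟩⟨h_m|. Sums of constants and exponents serve as a common bound. -/
theorem coeffBdd_coef {N : ℕ} (Φ : Distr N) : CoeffBdd (coef Φ) := by
  obtain ⟨s, C, -, h⟩ := Seminorm.bound_of_continuous (withSeminorms_op N)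
    ((normSeminorm ℂ ℂ).comp Φ.toLinearMap) (continuous_norm.comp Φ.continuous)
  choose D l hD hl using exists_opSeminorm_matUnit_le (N := N)
  refine ⟨C * ∑ k ∈ s, D k, ∑ k ∈ s, l k,
    mul_nonneg C.2 (Finset.sum_nonneg fun k _ => hD k), fun p => ?_⟩
  have h1 := one_le_wt p.1
  have h2 := one_le_wt p.2
  have h0 : ∀ r : ℕ, 0 ≤ wt p.1 ^ r * wt p.2 ^ r := fun r => by positivity
  refine (h (matUnit p.1 p.2)).trans ?_
  rw [smul_apply, NNReal.smul_def, smul_eq_mul, mul_assoc]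
  refine mul_le_mul_of_nonneg_left ?_ C.2
  refine Seminorm.finset_sup_apply_le
    (mul_nonneg (Finset.sum_nonneg fun k _ => hD k) (h0 _)) fun k hk => (hl k p.1 p.2).trans ?_
  refine mul_le_mul (Finset.single_le_sum (fun i _ => hD i) hk) ?_ (h0 _)
    (Finset.sum_nonneg fun k _ => hD k)
  have : l k ≤ ∑ k ∈ s, l k := Finset.single_le_sum (fun i _ => Nat.zero_le _) hk
  gcongr

/-- In each seminorm the remainder of the expansion is bounded by the tail of a convergent numerical
series, uniformly over unit vectors ψ and φ. -/
theorem hasSum_matUnit {N : ℕ} (T : SchwartzOp N) :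
    HasSum (fun p : (Fin N → ℕ) × (Fin N → ℕ) => mat T p.1 p.2 • matUnit p.1 p.2) T := by
  refine ((withSeminorms_op N).tendsto_nhds _ T).2 fun k ε hε => ?_
  obtain ⟨F, hFb, hF0, hF⟩ := (isNice_monomial k.1 k.2.1).exists_inner_le
  obtain ⟨G, hGb, hG0, hG⟩ := (isNice_monomial k.2.2.1 k.2.2.2).exists_inner_le
  have hs := hFb.summable_mat hGb hF0 hG0 T
  have ht := tendsto_tsum_compl_atTop_zero
    fun p : (Fin N → ℕ) × (Fin N → ℕ) => ‖mat T p.1 p.2‖ * (F p.1 * G p.2)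
  filter_upwards [ht.eventually_lt_const hε] with s hsε
  refine lt_of_le_of_lt ?_ hsε
  rw [← neg_sub, map_neg_eq_map]
  refine opSeminorm_le k _ (tsum_nonneg fun p => mul_nonneg (norm_nonneg _)
    (mul_nonneg (hF0 _) (hG0 _))) fun ψ φ => ?_
  have h1 := hasSum_inner_nuc (summable_nuc_mat .one .one T)
    (emb N (powP k.2.1 (powQ k.1 ψ))) (emb N (powP k.2.2.2 (powQ k.2.2.1 φ)))
  change HasSum _ (inner ℂ _ (sandwich 1 1 T _)) at h1
  rw [← op_eq_sandwich] at h1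
  have h2 : HasSum (fun p : (Fin N → ℕ) × (Fin N → ℕ) => mat T p.1 p.2 *
      inner ℂ (emb N (powP k.2.1 (powQ k.1 ψ)))
        (unitOp p.1 p.2 (emb N (powP k.2.2.2 (powQ k.2.2.1 φ))))) (sform k T.op ψ φ) := by
    refine h1.congr_fun fun p => ?_
    rw [inner_unitOp, inner_smul_right, mul_assoc]
    rfl
  have e : sform k (T - ∑ p ∈ s, mat T p.1 p.2 • matUnit p.1 p.2).op ψ φ +
      ∑ p ∈ s, mat T p.1 p.2 * inner ℂ (emb N (powP k.2.1 (powQ k.1 ψ)))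
        (unitOp p.1 p.2 (emb N (powP k.2.2.2 (powQ k.2.2.1 φ)))) = sform k T.op ψ φ := by
    simp only [sform, map_sub, map_sum, map_smul, sub_apply, sum_apply, smul_apply,
      inner_sub_right, inner_sum, inner_smul_right]
    exact sub_add_cancel _ _
  rw [← e] at h2
  have h3 := s.hasSum_compl_iff.2 h2
  rw [← h3.tsum_eq, ← tsum_mul_right]
  refine tsum_of_norm_bounded ((hs.subtype _).mul_right _).hasSum fun p => ?_
  rw [norm_mul]
  exact (mul_le_mul_of_nonneg_left (IsNice.norm_inner_unitOp_le hF hG _ _ ψ φ)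
    (norm_nonneg _)).trans_eq (mul_assoc _ _ _).symm

theorem eq_matDistr {N : ℕ} (Φ : Distr N) : Φ = matDistr (coeffBdd_coef Φ) := by
  refine ContinuousLinearMap.ext fun T => ?_
  have h := Φ.hasSum (hasSum_matUnit T)
  simp only [map_smul, smul_eq_mul] at h
  exact h.tsum_eq.symm

/-! ### Finite sums of derivatives of represented distributions -/

/-- The distributions with `IsRep k`, as a subspace. -/
def repSub (N k : ℕ) : Submodule ℂ (Distr N) where
  carrier := {Φ | IsRep k Φ}
  zero_mem' := .zero k
  add_mem' := .add
  smul_mem' c _ h := h.smul c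

/-- The map `Φ ↦ Φ ∘ D^α` of distributions. -/
def precompD {N : ℕ} (α : MIdx N) : Distr N →ₗ[ℂ] Distr N where
  toFun Φ := Φ.comp (opDPow α)
  map_add' _ _ := rfl
  map_smul' _ _ := rfl

/-- Finite sums of derivatives of distributions with `IsRep k`. -/
def regular (N k : ℕ) : Submodule ℂ (Distr N) := ⨆ α, (repSub N k).map (precompD α)

theorem precompD_mem_regular {N k : ℕ} {Ψ : Distr N} (h : IsRep k Ψ) (α : MIdx N) :
    precompD α Ψ ∈ regular N k :=
  Submodule.mem_iSup_of_mem α (Submodule.mem_map_of_mem h)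

theorem mem_regular_of_isRep {N k : ℕ} {Ψ : Distr N} (h : IsRep k Ψ) : Ψ ∈ regular N k := by
  have h1 : precompD 0 Ψ = Ψ := by
    refine ContinuousLinearMap.ext fun T => ?_
    change Ψ (opDPow 0 T) = Ψ T
    rw [opDPow_zero, one_apply_eq_self]
  rw [← h1]
  exact precompD_mem_regular h 0

theorem exists_isOpDistr_of_mem_regular {N k : ℕ} (hk : 2 * N ≤ k) {Φ : Distr N}
    (hΦ : Φ ∈ regular N k) :
    ∃ (m : ℕ) (A : MIdx N → (Hil N →ₗ.[ℂ] Hil N)) (ΦA DΦA : MIdx N → Distr N),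
      (∀ α ∈ multiIdx N m, IsPolyBounded (A α) ∧ IsOpDistr (A α) (ΦA α) ∧
        IsDistrDeriv α (ΦA α) (DΦA α)) ∧ Φ = ∑ α ∈ multiIdx N m, DΦA α := by
  obtain ⟨f, hf, rfl⟩ := (Submodule.mem_iSup_iff_exists_finsupp _ _).1 hΦ
  choose Ψ hΨ hΨf using hf
  have hrep (α : MIdx N) : IsRep k (((-1 : ℂ) ^ α.order) • Ψ α) := IsRep.smul _ (hΨ α)
  choose A hA hAΨ using fun α => (hrep α).exists_isOpDistr hk
  -- The sum of the orders is a crude bound for every order in the finite support; outside the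
  -- support the terms vanish. The sign in the definition of D^α Φ is put into the operator A_α.
  refine ⟨∑ α ∈ f.support, α.order, A, fun α => ((-1 : ℂ) ^ α.order) • Ψ α, f,
    fun α _ => ⟨hA α, hAΨ α, fun T => ⟨opDPow α T, isOpDeriv_opDPow α T, ?_⟩⟩, ?_⟩
  · rw [← hΨf, smul_apply, smul_eq_mul, ← mul_assoc, ← mul_pow,
      neg_mul_neg, one_mul, one_pow, one_mul]
    rfl
  · refine Finset.sum_subset (fun α hα => ?_) fun α _ hα => Finsupp.notMem_support_iff.1 hα
    have h1 : α.order ≤ ∑ α ∈ f.support, α.order :=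
      Finset.single_le_sum (fun _ _ => Nat.zero_le _) hα
    refine Finset.mem_filter.2 ⟨Fintype.mem_piFinset.2 fun i => Finset.mem_range.2 ?_, h1⟩
    have h2 : α i ≤ α.order := Finset.single_le_sum (fun _ _ => Nat.zero_le _) (Finset.mem_univ i)
    omega

/-! ### Moving the generators from one side of a Schwartz operator to the other -/

/-- The properties shared by the forms `⟨ψ | T φ⟩` and `⟨φ | T ψ⟩`. -/
structure IsForm {N : ℕ} (B : SchwartzOp N → Sch N → Sch N → ℂ) : Prop where
  add_right : ∀ T ψ φ φ', B T ψ (φ + φ') = B T ψ φ + B T ψ φ'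
  smul_left : ∀ T (c : ℝ) ψ φ, B T ((c : ℂ) • ψ) φ = c * B T ψ φ
  smul_right : ∀ T (c : ℝ) ψ φ, B T ψ ((c : ℂ) • φ) = c * B T ψ φ
  opD : ∀ j T ψ φ, B (opD j T) ψ φ = B T (gen j ψ) φ + B T ψ (gen j φ)
  rep : ∀ (k : ℕ), 2 * N ≤ k → ∀ (c : (Fin N → ℕ) × (Fin N → ℕ) → ℂ)
    (ψ φ : (Fin N → ℕ) × (Fin N → ℕ) → Sch N),
    (Summable fun p => ‖c p‖ * (‖emb N (ψ p)‖ * ‖emb N (φ p)‖)) →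
    ∃ Ψ : Distr N, IsRep k Ψ ∧ ∀ T, HasSum (fun p => c p * B T (ψ p) (φ p)) (Ψ T)

theorem hasSum_clmDistr_nuc {N : ℕ} {κ : Type*} {f g : κ → Hil N}
    (h : Summable fun k => ‖f k‖ * ‖g k‖) (T : SchwartzOp N) :
    HasSum (fun k => inner ℂ (g k) (T.op (f k))) (clmDistr (nuc f g) T) := by
  rw [clmDistr_nuc h]
  refine (Summable.of_norm_bounded (h.mul_left ‖T.op‖) fun k => ?_).hasSum
  calc ‖inner ℂ (g k) (T.op (f k))‖ ≤ ‖g k‖ * (‖T.op‖ * ‖f k‖) :=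
        (norm_inner_le_norm _ _).trans
          (mul_le_mul_of_nonneg_left (T.op.le_opNorm _) (norm_nonneg _))
    _ = _ := by ring

theorem isForm_inner (N : ℕ) :
    IsForm fun (T : SchwartzOp N) ψ φ => inner ℂ (emb N ψ) (T.op (emb N φ)) where
  add_right T ψ φ φ' := by simp only [map_add, inner_add_right]
  smul_left T c ψ φ := by simp only [map_smul, inner_smul_left, Complex.conj_ofReal]
  smul_right T c ψ φ := by simp only [map_smul, inner_smul_right]
  opD j T ψ φ := inner_opD j T ψ φ
  rep k hk c ψ φ h := by
    refine ⟨clmDistr (nuc (fun p => c p • emb N (φ p)) fun p => emb N (ψ p)),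
      isRep_clmDistr hk _, fun T => ?_⟩
    have h' : Summable fun p => ‖c p • emb N (φ p)‖ * ‖emb N (ψ p)‖ := by
      refine h.congr fun p => ?_
      rw [norm_smul]
      ring
    simpa only [map_smul, inner_smul_right] using hasSum_clmDistr_nuc h' T

/-- The mirror image, which serves the region where the first index dominates. Here the second
argument is conjugate linear, which is why `IsForm` asks for homogeneity under real scalars only. -/
theorem isForm_inner_swap (N : ℕ) :
    IsForm fun (T : SchwartzOp N) ψ φ => inner ℂ (emb N φ) (T.op (emb N ψ)) where
  add_right T ψ φ φ' := by simp only [map_add, inner_add_left]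
  smul_left T c ψ φ := by simp only [map_smul, inner_smul_right]
  smul_right T c ψ φ := by simp only [map_smul, inner_smul_left, Complex.conj_ofReal]
  opD j T ψ φ := (inner_opD j T φ ψ).trans (add_comm _ _)
  rep k hk c ψ φ h := by
    refine ⟨clmDistr (nuc (fun p => c p • emb N (ψ p)) fun p => emb N (φ p)),
      isRep_clmDistr hk _, fun T => ?_⟩
    have h' : Summable fun p => ‖c p • emb N (ψ p)‖ * ‖emb N (φ p)‖ := by
      refine h.congr fun p => ?_
      rw [norm_smul]
      ring
    simpa only [map_smul, inner_smul_right] using hasSum_clmDistr_nuc h' T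

/-- The operator `X` can be moved to the other argument of the form `B`, up to derivatives. -/
def Moves {N : ℕ} (B : SchwartzOp N → Sch N → Sch N → ℂ) (X : Sch N →L[ℂ] Sch N) : Prop :=
  ∃ (ι : Type) (_ : Fintype ι) (Y : ι → Sch N →L[ℂ] Sch N) (α : ι → MIdx N),
    (∀ i, IsNice (Y i)) ∧ ∀ T ψ φ, B T ψ (X φ) = ∑ i, B (opDPow (α i) T) (Y i ψ) φ

theorem commute_opD_opDPow {N : ℕ} (j : Fin N ⊕ Fin N) (α : MIdx N) :
    Commute (opD j) (opDPow α) :=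
  (commute_mprod (fun _ => opD_commute _ _) _).mul_right (commute_mprod (fun _ => opD_commute _ _) _)

theorem opDPow_opD {N : ℕ} (j : Fin N ⊕ Fin N) (α : MIdx N) (T : SchwartzOp N) :
    opDPow α (opD j T) = opDPow (α + Pi.single j 1) T := by
  rw [opDPow_add_single, (commute_opD_opDPow j α).eq, mul_apply_eq_comp]

section

variable {N : ℕ} {B : SchwartzOp N → Sch N → Sch N → ℂ} {X X' : Sch N →L[ℂ] Sch N}

theorem Moves.one : Moves B (1 : Sch N →L[ℂ] Sch N) :=
  ⟨Unit, inferInstance, fun _ => 1, fun _ => 0, fun _ => .one, fun T ψ φ => by simp [opDPow_zero]⟩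

theorem IsForm.zero_right (hB : IsForm B) (T : SchwartzOp N) (ψ : Sch N) : B T ψ 0 = 0 := by
  simpa using hB.smul_right T 0 ψ 0

theorem Moves.zero (hB : IsForm B) : Moves B (0 : Sch N →L[ℂ] Sch N) :=
  ⟨Empty, inferInstance, Empty.elim, Empty.elim, fun i => i.elim,
    fun T ψ φ => by simp [hB.zero_right]⟩

theorem Moves.add (hB : IsForm B) (h : Moves B X) (h' : Moves B X') : Moves B (X + X') := by
  obtain ⟨ι, _, Y, α, hY, h⟩ := h
  obtain ⟨ι', _, Y', α', hY', h'⟩ := h'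
  refine ⟨ι ⊕ ι', inferInstance, Sum.elim Y Y', Sum.elim α α', by simp [hY, hY'],
    fun T ψ φ => ?_⟩
  rw [add_apply, hB.add_right, h, h', Fintype.sum_sum_type]
  rfl

theorem Moves.smul (hB : IsForm B) (c : ℝ) (h : Moves B X) : Moves B ((c : ℂ) • X) := by
  obtain ⟨ι, _, Y, α, hY, h⟩ := h
  refine ⟨ι, inferInstance, fun i => (c : ℂ) • Y i, α, fun i => (hY i).smul _, fun T ψ φ => ?_⟩
  simp only [smul_apply, hB.smul_right, hB.smul_left, h, Finset.mul_sum]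

theorem Moves.sum (hB : IsForm B) {ι : Type*} (s : Finset ι) {X : ι → Sch N →L[ℂ] Sch N}
    (h : ∀ i ∈ s, Moves B (X i)) : Moves B (∑ i ∈ s, X i) := by
  classical
  induction s using Finset.induction_on with
  | empty => exact .zero hB
  | insert i s hi ih =>
    rw [Finset.sum_insert hi]
    exact (h i (by simp)).add hB (ih fun j hj => h j (by simp [hj]))

theorem Moves.gen_mul (hB : IsForm B) (j : Fin N ⊕ Fin N) (h : Moves B X) :
    Moves B (gen j * X) := by
  obtain ⟨ι, _, Y, α, hY, h⟩ := h
  -- From B(T, ψ, K X φ) = B(D_j T, ψ, X φ) - B(T, Kψ, X φ): each term yields one with a further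
  -- derivative and one with the generator on the other vector.
  refine ⟨ι ⊕ ι, inferInstance, Sum.elim Y fun i => ((-1 : ℝ) : ℂ) • (Y i * gen j),
    Sum.elim (fun i => α i + Pi.single j 1) α, ?_, fun T ψ φ => ?_⟩
  · rintro (i | i)
    · exact hY i
    · exact ((hY i).mul (isNice_gen j)).smul _
  · have h1 := hB.opD j T ψ (X φ)
    rw [h, h] at h1
    rw [mul_apply_eq_comp, Fintype.sum_sum_type]
    simp only [Sum.elim_inl, Sum.elim_inr, ← opDPow_opD, smul_apply, mul_apply_eq_comp,
      hB.smul_left, ← Finset.mul_sum]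
    rw [h1]
    push_cast
    ring

/-- By `hamS_eq_gen` the factor 1 + H is quadratic in the generators with real coefficients, so
moving single generators suffices. -/
theorem Moves.hamOne_pow (hB : IsForm B) (a : ℕ) : Moves B (hamOne N ^ a) := by
  induction a with
  | zero => exact .one
  | succ a ih =>
    have e : hamOne N ^ (a + 1) = ((-1 / 2 : ℝ) : ℂ) • (∑ j, gen j * (gen j * hamOne N ^ a)) +
        hamOne N ^ a := by
      rw [pow_succ', hamOne, hamS_eq_gen, add_mul, one_mul, smul_mul_assoc, Finset.sum_mul]
      push_cast
      simp only [mul_assoc]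
    rw [e]
    exact ((Moves.sum hB _ fun j _ => (ih.gen_mul hB j).gen_mul hB j).smul hB _).add hB ih

end

/-! ### The regularity theorem -/

/-- The part of a distribution far away from the diagonal is a finite sum of derivatives of bounded
operators. -/
theorem IsForm.exists_mem_regular {N : ℕ} {B : SchwartzOp N → Sch N → Sch N → ℂ} (hB : IsForm B)
    (K : ℕ) : ∃ c₀ : ℕ, ∀ c, c₀ ≤ c → ∀ k, 2 * N ≤ k →
      ∀ (f : (Fin N → ℕ) × (Fin N → ℕ) → ℂ) (C : ℝ), 0 ≤ C →
        (∀ p, ‖f p‖ ≤ C * (wt p.1 ^ K * wt p.2 ^ K)) → (∀ p, f p ≠ 0 → wt p.1 ^ c ≤ wt p.2) →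
        ∃ Ψ ∈ regular N k, ∀ T,
          HasSum (fun p => f p * B T (hermN p.1) (hermN p.2)) (Ψ T) := by
  -- The powers K + 1 + 2N of w(m) cancel the growth of the coefficients, leave one spare power, and
  -- give summability in m. The exponent does not involve c, so the growth rate r of the Y_i is
  -- known before c is chosen.
  obtain ⟨ι, _, Y, α, hY, hmove⟩ := Moves.hamOne_pow hB (K + 1 + 2 * N)
  obtain ⟨D, r, hD, hDr⟩ := PolyBdd.sum Finset.univ fun i _ => (hY i).polyBdd
  -- Growth w(n)^K of the coefficients, growth w(n)^r of Y_i h_n, and w(n)^{2N} for summability in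
  -- n: all are absorbed by the spare power of w(m).
  refine ⟨K + r + 2 * N, fun c hc k hk f C hC hf hfc => ?_⟩
  have hYn (i : ι) (n : Fin N → ℕ) : ‖emb N (Y i (hermN n))‖ ≤ D * wt n ^ r :=
    (Finset.single_le_sum (f := fun i => ‖emb N (Y i (hermN n))‖) (fun _ _ => norm_nonneg _)
      (Finset.mem_univ i)).trans (hDr n)
  have hsum (i : ι) : Summable fun p : (Fin N → ℕ) × (Fin N → ℕ) =>
      ‖f p * (((wt p.2 ^ (K + 1 + 2 * N))⁻¹ : ℝ) : ℂ)‖ *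
        (‖emb N (Y i (hermN p.1))‖ * ‖emb N (hermN p.2)‖) := by
    refine ((summable_wt_prod N).mul_left (C * D)).of_nonneg_of_le (fun p => by positivity)
      fun p => ?_
    have h1 := wt_pos p.1
    have h2 := wt_pos p.2
    by_cases hp : f p = 0
    · rw [hp, zero_mul, norm_zero, zero_mul]
      positivity
    · have h3 : wt p.1 ^ (K + r + 2 * N) ≤ wt p.2 :=
        (pow_le_pow_right₀ (one_le_wt _) hc).trans (hfc p hp)
      rw [norm_emb_hermN, mul_one, norm_mul, Complex.norm_real,
        Real.norm_of_nonneg (by positivity)]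
      calc ‖f p‖ * (wt p.2 ^ (K + 1 + 2 * N))⁻¹ * ‖emb N (Y i (hermN p.1))‖
          ≤ C * (wt p.1 ^ K * wt p.2 ^ K) * (wt p.2 ^ (K + 1 + 2 * N))⁻¹ *
            (D * wt p.1 ^ r) := by
            gcongr
            · exact hf p
            · exact hYn i p.1
        _ = C * D * (wt p.1 ^ (K + r + 2 * N) * (wt p.2)⁻¹) *
            ((wt p.1 ^ (2 * N))⁻¹ * (wt p.2 ^ (2 * N))⁻¹) := by
            field_simp
            ring
        _ ≤ C * D * 1 * ((wt p.1 ^ (2 * N))⁻¹ * (wt p.2 ^ (2 * N))⁻¹) := by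
            gcongr
            rwa [← div_eq_mul_inv, div_le_one h2]
        _ = _ := by ring
  choose Ψ hΨ hΨs using fun i => hB.rep k hk _ _ _ (hsum i)
  refine ⟨∑ i, precompD (α i) (Ψ i),
    Submodule.sum_mem _ fun i _ => precompD_mem_regular (hΨ i) (α i), fun T => ?_⟩
  rw [sum_apply]
  refine (hasSum_sum fun i _ => hΨs i (opDPow (α i) T)).congr_fun fun p => ?_
  have h2 : ((wt p.2 : ℝ) : ℂ) ^ (K + 1 + 2 * N) ≠ 0 :=
    pow_ne_zero _ (Complex.ofReal_ne_zero.2 (wt_pos p.2).ne')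
  have h3 : (((wt p.2 : ℝ) : ℂ) ^ (K + 1 + 2 * N)) = ((wt p.2 ^ (K + 1 + 2 * N) : ℝ) : ℂ) := by
    push_cast
    rfl
  rw [← Finset.mul_sum, ← hmove, hamOne_pow_hermN, h3, hB.smul_right, mul_assoc,
    ← mul_assoc _ _ (B _ _ _), ← Complex.ofReal_mul, inv_mul_cancel₀ (pow_ne_zero _ (wt_pos p.2).ne'), Complex.ofReal_one,
    one_mul]

theorem CoeffBdd.of_norm_le {N : ℕ} {a b : (Fin N → ℕ) × (Fin N → ℕ) → ℂ} (ha : CoeffBdd a)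
    (h : ∀ p, ‖b p‖ ≤ ‖a p‖) : CoeffBdd b := by
  obtain ⟨C, k, hC, hk⟩ := ha
  exact ⟨C, k, hC, fun p => (h p).trans (hk p)⟩

/-- Of the exponent (K+2N)(1+c), the part K cancels the growth in s, the part 2N gives summability
in s, and c(K+2N) dominates w(t)^{K+2N}, because w(t) ≤ w(s)^c wherever the coefficient is nonzero.
-/
theorem summable_resVal_mul {N K c : ℕ} {C : ℝ} (hC : 0 ≤ C)
    {a : (Fin N → ℕ) × (Fin N → ℕ) → ℂ} (s : (Fin N → ℕ) × (Fin N → ℕ) → (Fin N → ℕ))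
    (t : (Fin N → ℕ) × (Fin N → ℕ) → (Fin N → ℕ))
    (ha : ∀ p, ‖a p‖ ≤ C * (wt (s p) ^ K * wt (t p) ^ K))
    (hac : ∀ p, a p ≠ 0 → wt (t p) ≤ wt (s p) ^ c)
    (hs : Summable fun p => (wt (s p) ^ (2 * N))⁻¹ * (wt (t p) ^ (2 * N))⁻¹) :
    Summable fun p => resVal ((K + 2 * N) * (1 + c)) (s p) * ‖a p‖ := by
  refine (hs.mul_left (2 ^ ((K + 2 * N) * (1 + c)) * C)).of_nonneg_of_le
    (fun p => mul_nonneg (resVal_pos _ _).le (norm_nonneg _)) fun p => ?_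
  have h1 := wt_pos (s p)
  have h2 := wt_pos (t p)
  by_cases hp : a p = 0
  · rw [hp, norm_zero, mul_zero]
    positivity
  calc resVal ((K + 2 * N) * (1 + c)) (s p) * ‖a p‖
      ≤ 2 ^ ((K + 2 * N) * (1 + c)) * (wt (s p) ^ ((K + 2 * N) * (1 + c)))⁻¹ *
        (C * (wt (s p) ^ K * wt (t p) ^ K)) :=
        mul_le_mul (resVal_le _ _) (ha p) (norm_nonneg _) (by positivity)
    _ = 2 ^ ((K + 2 * N) * (1 + c)) * C * (wt (t p) ^ (K + 2 * N) *
          ((wt (s p) ^ c) ^ (K + 2 * N))⁻¹) *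
        ((wt (s p) ^ (2 * N))⁻¹ * (wt (t p) ^ (2 * N))⁻¹) := by
        have e : wt (s p) ^ ((K + 2 * N) * (1 + c)) =
            wt (s p) ^ K * wt (s p) ^ (2 * N) * (wt (s p) ^ c) ^ (K + 2 * N) := by ring
        rw [e, pow_add (wt (t p))]
        field_simp
    _ ≤ 2 ^ ((K + 2 * N) * (1 + c)) * C * 1 *
        ((wt (s p) ^ (2 * N))⁻¹ * (wt (t p) ^ (2 * N))⁻¹) := by
        gcongr
        rw [← div_eq_mul_inv, div_le_one (by positivity)]
        gcongr
        exact hac p hp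
    _ = _ := by ring

theorem exists_mem_regular {N : ℕ} (Φ : Distr N) : ∃ k, 2 * N ≤ k ∧ Φ ∈ regular N k := by
  classical
  have hΦ := coeffBdd_coef Φ
  obtain ⟨C, K, hC, hb⟩ := coeffBdd_coef Φ
  obtain ⟨c₁, h₁⟩ := (isForm_inner N).exists_mem_regular K
  obtain ⟨c₂, h₂⟩ := (isForm_inner_swap N).exists_mem_regular K
  set c := max c₁ c₂
  have hk : 2 * N ≤ (K + 2 * N) * (1 + c) := by nlinarith
  refine ⟨(K + 2 * N) * (1 + c), hk, ?_⟩
  set k := (K + 2 * N) * (1 + c)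
  -- The nested conditions make the three pieces disjoint by construction, so they add up to the
  -- full coefficients whatever the value of c.
  let a₁ : (Fin N → ℕ) × (Fin N → ℕ) → ℂ := fun p => if wt p.1 ^ c < wt p.2 then coef Φ p else 0
  let a₂ : (Fin N → ℕ) × (Fin N → ℕ) → ℂ := fun p =>
    if wt p.1 ^ c < wt p.2 then 0 else if wt p.2 ^ c < wt p.1 then coef Φ p else 0
  let a₃ : (Fin N → ℕ) × (Fin N → ℕ) → ℂ := fun p =>
    if wt p.1 ^ c < wt p.2 then 0 else if wt p.2 ^ c < wt p.1 then 0 else coef Φ p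
  have ha₁ (p) : ‖a₁ p‖ ≤ ‖coef Φ p‖ := by
    simp only [a₁]
    split_ifs <;> simp
  have ha₂ (p) : ‖a₂ p‖ ≤ ‖coef Φ p‖ := by
    simp only [a₂]
    split_ifs <;> simp
  have ha₃ (p) : ‖a₃ p‖ ≤ ‖coef Φ p‖ := by
    simp only [a₃]
    split_ifs <;> simp
  have hadd (p) : a₁ p + a₂ p + a₃ p = coef Φ p := by
    simp only [a₁, a₂, a₃]
    split_ifs <;> simp
  obtain ⟨Ψ₁, hΨ₁, hs₁⟩ := h₁ c (le_max_left _ _) k hk a₁ C hC (fun p => (ha₁ p).trans (hb p))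
    fun p hp => by
      by_contra h
      exact hp (if_neg fun h' => h h'.le)
  -- For the swapped form the roles of the indices are exchanged, hence the coefficients are read at
  -- the swapped pair.
  obtain ⟨Ψ₂, hΨ₂, hs₂⟩ := h₂ c (le_max_right _ _) k hk (fun p => a₂ p.swap) C hC
    (fun p => ((ha₂ _).trans (hb _)).trans_eq (by rw [Prod.fst_swap, Prod.snd_swap]; ring))
    fun p hp => by
      by_contra h
      refine hp ?_
      simp only [a₂]
      split_ifs with h3 h4
      · rfl
      · exact absurd h4.le h
      · rfl
  have hbd₃ := hΦ.of_norm_le ha₃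
  have hr₁ := summable_resVal_mul (c := c) hC Prod.fst Prod.snd (fun p => (ha₃ p).trans (hb p))
    (fun p hp => by
      by_contra h
      exact hp (if_pos (not_le.1 h))) (summable_wt_prod N)
  have hr₂ := summable_resVal_mul (c := c) hC Prod.snd Prod.fst
    (fun p => ((ha₃ p).trans (hb p)).trans_eq (by ring))
    (fun p hp => by
      by_contra h
      refine hp ?_
      simp only [a₃]
      split_ifs with h3 h4
      · rfl
      · rfl
      · exact absurd (not_le.1 h) h4) ((summable_wt_prod N).congr fun p => mul_comm _ _)
  have hrep : IsRep k (matDistr hbd₃) := isRep_matDistr hk hbd₃ hr₁ hr₂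
  have e : Φ = Ψ₁ + Ψ₂ + matDistr hbd₃ := by
    refine ContinuousLinearMap.ext fun T => ?_
    have t₂ := (Equiv.prodComm (Fin N → ℕ) (Fin N → ℕ)).hasSum_iff.2 (hs₂ T)
    have t := ((hs₁ T).add t₂).add (hbd₃.summable T).hasSum
    have hu : HasSum (fun p => mat T p.1 p.2 * coef Φ p) (Φ T) := by
      have := (hΦ.summable T).hasSum
      rwa [← matDistr_apply hΦ, ← eq_matDistr Φ] at this
    refine hu.unique (t.congr_fun fun p => ?_)
    rw [← hadd p]
    change _ = a₁ p * mat T p.1 p.2 + a₂ p * mat T p.1 p.2 + _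
    ring
  rw [e]
  exact add_mem (add_mem hΨ₁ hΨ₂) (mem_regular_of_isRep hrep)

end QDist

end

theorem mainTheorem10 (N : ℕ) (Φ : QDist.Distr N) :
    ∃ (m : ℕ) (A : QDist.MIdx N → (QDist.Hil N →ₗ.[ℂ] QDist.Hil N))
      (ΦA DΦA : QDist.MIdx N → QDist.Distr N),
      (∀ α ∈ QDist.multiIdx N m,
        QDist.IsPolyBounded (A α) ∧
        QDist.IsOpDistr (A α) (ΦA α) ∧
        QDist.IsDistrDeriv α (ΦA α) (DΦA α)) ∧
      Φ = ∑ α ∈ QDist.multiIdx N m, DΦA α := by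
  obtain ⟨_, hk, h⟩ := QDist.exists_mem_regular Φ
  exact QDist.exists_isOpDistr_of_mem_regular hk h
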